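/- **Proposition 2.1.** Let $X$ be a smooth irreducible complex algebraic curve (affine or complete), $K$ its field of rational functions, $\Omega_{\rm rat}(X)$ the space of rational differentials on $X$ and $\Omega^1(X)$ the group of regular differentials. Let $\Omega_3^{\mathbb Z}(X)\subset\Omega_{\rm rat}(X)$ be the group of rational differentials with only simple poles on $X$ and with integer residues, let $\operatorname{Div}X$ be the group of divisors on $X$, and let $\operatorname{res}:\Omega_3^{\mathbb Z}(X)\to\operatorname{Div}X$ be the homomorphism $\omega\mapsto\sum_{x\in X}(\operatorname{res}_x\omega)\,x$. Let $P$ be the image of $\operatorname{dlog}:K^\times\to\Omega_{\rm rat}(X)$, $f\mapsto df/f$. For $D=\sum n_x x$ let $\mathcal O(D)$ be the line bundle whose sections are the rational functions $f$ with $\nu_x(f)\ge -n_x$ for all $x$, where $\nu_x$ is the order of vanishing. Let $\operatorname{Pic}X$ be the group of isomorphism classes of line bundles on $X$, and $\operatorname{Pic}^\flat X$ the group of isomorphism classes of line bundles with flat algebraic connection on $X$, both under tensor product; let $p:\operatorname{Pic}^\flat X\to\operatorname{Pic}X$ forget the connection, and let $\iota:\Omega^1(X)\to\operatorname{Pic}^\flat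 X$ send $\eta$ to the class of the trivial bundle with the connection $d+\eta$. Then $\Omega^1(X)$ and $P$ are contained in $\Omega_3^{\mathbb Z}(X)$, $\operatorname{res}(\operatorname{dlog}f)$ is the divisor of $f$ for every $f\in K^\times$, and there is a canonical isomorphism of groups $$\Phi:\ \Omega_3^{\mathbb Z}(X)/P\ \xrightarrow{\ \sim\ }\ \operatorname{Pic}^\flat X ,$$ characterized as follows: $\Phi(\omega)$ is the class of $(\mathcal L,\nabla)$ if and only if $\mathcal L$ has a rational trivialization (an embedding into the constant sheaf $K$) in which $\nabla$ becomes $d+\omega$. The diagram $$\begin{array}{ccccc} \Omega^1(X)&\longrightarrow&\Omega_3^{\mathbb Z}(X)&\xrightarrow{\ \operatorname{res}\ }&\operatorname{Div}X\\ \Big\Vert&&\Big\downarrow{\scriptstyle\Phi}&&\Big\downarrow\\ \Omega^1(X)&\xrightarrow{\ \iota\ }&\operatorname{Pic}^\flat X&\xrightarrow{\ p\ }&\operatorname{Pic}X \end{array}$$ commutes, where the middle arrow is the quotient map followed by $\Phi$ and the right-hand arrow is the homomorphism $D\mapsto[\mathcal O(D)]$. Moreover $\ker\operatorname{res}=\Omega^1(X)$,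 $\ker p=\iota(\Omega^1(X))$, and $\ker\iota=\{\,du/u : u\in\mathcal O(X)^\times\}$ (so $\iota$ is injective if $X$ has no nonconstant units). If $X$ is affine, $\operatorname{res}$ and $p$ are surjective. -/

import Mathlib

open CategoryTheory AlgebraicGeometry TopologicalSpace

noncomputable section

namespace FlatPic

/-- The point `Spec ℂ`. A scheme over `ℂ` is a scheme `X` with `[X.Over SpecC]`. -/
abbrev SpecC : Scheme.{0} := Spec (CommRingCat.of ℂ)

section Basic

variable (X : Scheme.{0}) [X.Over SpecC]

/-- The complex constants inside the regular functions on an open set. -/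
def constHom (U : X.Opens) : ℂ →+* Γ(X, U) :=
  ((X.presheaf.map (homOfLE le_top : U ⟶ ⊤).op).hom.comp (X ↘ SpecC).appTop.hom).comp
    (Scheme.ΓSpecIso (CommRingCat.of ℂ)).inv.hom

/-- The ring of regular functions on an open set of a `ℂ`-scheme is a `ℂ`-algebra. -/
instance sectionsAlgebra (U : X.Opens) : Algebra ℂ Γ(X, U) := (constHom X U).toAlgebra

/-- The field of rational functions on an integral `ℂ`-scheme is a `ℂ`-algebra. -/
instance functionFieldAlgebra [IsIntegral X] : Algebra ℂ X.functionField :=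
  ((X.presheaf.germ ⊤ (genericPoint X) trivial).hom.comp (constHom X ⊤)).toAlgebra

/-- A smooth curve over `ℂ` is locally noetherian (so that orders of vanishing make sense). -/
instance [SmoothOfRelativeDimension 1 (X ↘ SpecC)] : IsLocallyNoetherian X :=
  haveI : Smooth (X ↘ SpecC) := SmoothOfRelativeDimension.smooth 1 _
  LocallyOfFiniteType.isLocallyNoetherian (X ↘ SpecC)

end Basic

/-! ### Rational differentials and divisors -/

section Differentials

variable (X : Scheme.{0}) [X.Over SpecC] [IsIntegral X]

/-- Rational differentials on `X`: Kähler differentials of the function field over `ℂ`. -/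
abbrev RatDiff : Type := Ω[X.functionField⁄ℂ]

/-- The differential `df` of a rational function. -/
abbrev dRat (f : X.functionField) : RatDiff X := KaehlerDifferential.D ℂ X.functionField f

/-- The group `Div X` of (Weil) divisors: finite integral combinations of closed points. -/
abbrev Div (X : Scheme.{0}) : Type := closedPoints X →₀ ℤ

/-- The rational differentials regular at the point `x`: the finite sums `∑ aᵢ dbᵢ` where the
`aᵢ, bᵢ` are rational functions regular at `x`. -/
def regularAt (x : X) : AddSubgroup (RatDiff X) :=
  AddSubgroup.closure {η | ∃ a b : X.presheaf.stalk x,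
    η = algebraMap (X.presheaf.stalk x) X.functionField a •
      dRat X (algebraMap (X.presheaf.stalk x) X.functionField b)}

/-- The group `Ω¹(X)` of regular differentials. -/
def regularDiff : AddSubgroup (RatDiff X) := ⨅ x : X, regularAt X x

/-- The homomorphism `dlog : K^× → Ω_rat(X)`, `f ↦ df / f`. -/
def dlog : Additive X.functionFieldˣ →+ RatDiff X where
  toFun f := ((f.toMul⁻¹ : X.functionFieldˣ) : X.functionField) • dRat X (f.toMul : X.functionField)
  map_zero' := by simp
  map_add' f g := by
    have hf : (f.toMul : X.functionField) ≠ 0 := f.toMul.ne_zero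
    have hg : (g.toMul : X.functionField) ≠ 0 := g.toMul.ne_zero
    simp only [toMul_add, Units.val_mul, Derivation.leibniz, smul_add, smul_smul, mul_inv,
      Units.val_inv_eq_inv_val]
    rw [add_comm]
    congr 2 <;> field_simp

/-- The subgroup `P = dlog K^×` of the rational differentials. -/
def dlogRange : AddSubgroup (RatDiff X) := (dlog X).range

/-- `ω` has at most a simple pole at `x`: `z ω` is regular at `x` for every local parameter `z`. -/
def HasAtMostSimplePoleAt (x : X) (ω : RatDiff X) : Prop :=
  ∀ z : X.presheaf.stalk x, Irreducible z →
    algebraMap (X.presheaf.stalk x) X.functionField z • ω ∈ regularAt X x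

/-- For `ω` with at most a simple pole at the closed point `x`: the residue of `ω` at `x` is `c`.
That is, `ω = c dz / z + (regular at x)` for every local parameter `z` at `x`. -/
def IsResidueAt (x : X) (ω : RatDiff X) (c : ℂ) : Prop :=
  ∀ z : X.presheaf.stalk x, Irreducible z →
    ω - c • ((algebraMap (X.presheaf.stalk x) X.functionField z)⁻¹ •
      dRat X (algebraMap (X.presheaf.stalk x) X.functionField z)) ∈ regularAt X x

/-- The group `Ω₃(X)` of rational differentials with only simple poles. -/
def thirdKind : AddSubgroup (RatDiff X) where
  carrier := {ω | ∀ x ∈ closedPoints X, HasAtMostSimplePoleAt X x ω}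
  zero_mem' := fun x _ z _ => by rw [smul_zero]; exact zero_mem _
  add_mem' := fun ha hb x hx z hz => by
    rw [smul_add]; exact add_mem (ha x hx z hz) (hb x hx z hz)
  neg_mem' := fun ha x hx z hz => by
    rw [smul_neg]; exact neg_mem (ha x hx z hz)

/-- The group `Ω₃^ℤ(X)` of rational differentials with only simple poles and with integer residue
at every closed point. -/
def thirdKindInt : AddSubgroup (RatDiff X) where
  carrier := {ω | ω ∈ thirdKind X ∧ ∀ x ∈ closedPoints X, ∃ n : ℤ, IsResidueAt X x ω n}
  zero_mem' := ⟨zero_mem _, fun x _ => ⟨0, fun z _ => by simp [zero_mem]⟩⟩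
  add_mem' := fun ha hb => ⟨add_mem ha.1 hb.1, fun x hx => by
    obtain ⟨m, hm⟩ := ha.2 x hx
    obtain ⟨n, hn⟩ := hb.2 x hx
    refine ⟨m + n, fun z hz => ?_⟩
    have h := add_mem (hm z hz) (hn z hz)
    rw [Int.cast_add, add_smul]
    convert h using 1
    abel⟩
  neg_mem' := fun ha => ⟨neg_mem ha.1, fun x hx => by
    obtain ⟨m, hm⟩ := ha.2 x hx
    refine ⟨-m, fun z hz => ?_⟩
    have h := neg_mem (hm z hz)
    rw [Int.cast_neg, neg_smul]
    convert h using 1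
    abel⟩

end Differentials

/-! ### Line bundles -/

section LineBundles

variable {X : Scheme.{0}}

/-- Restriction of sections of a sheaf of modules to a smaller open set. -/
abbrev restr (L : X.Modules) {U V : X.Opens} (h : V ≤ U) (e : Γ(L, U)) : Γ(L, V) :=
  L.presheaf.map (homOfLE h).op e

/-- Restriction of regular functions to a smaller open set. -/
abbrev resFun {U V : X.Opens} (h : V ≤ U) (f : Γ(X, U)) : Γ(X, V) :=
  X.presheaf.map (homOfLE h).op f

/-- The section `e` trivializes `L` over `U`: the map `f ↦ f e` is an isomorphism of `𝒪_U` with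
the restriction of `L` to `U`. -/
def IsFrame (L : X.Modules) {U : X.Opens} (e : Γ(L, U)) : Prop :=
  ∀ (V : X.Opens) (h : V ≤ U), Function.Bijective fun f : Γ(X, V) => f • restr L h e

/-- `L` is a line bundle: a sheaf of modules that is locally isomorphic to the structure sheaf. -/
def IsLineBundle (L : X.Modules) : Prop :=
  ∀ x : X, ∃ U : X.Opens, x ∈ U ∧ ∃ e : Γ(L, U), IsFrame L e

variable (X) in
/-- Line bundles on `X`. -/
structure LineBundle where
  /-- the sheaf of sections -/
  sheaf : X.Modules
  isLineBundle : IsLineBundle sheaf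

/-- Isomorphism of line bundles. -/
instance LineBundle.setoid : Setoid (LineBundle X) where
  r L M := Nonempty (L.sheaf ≅ M.sheaf)
  iseqv := ⟨fun _ => ⟨Iso.refl _⟩, fun ⟨φ⟩ => ⟨φ.symm⟩, fun ⟨φ⟩ ⟨ψ⟩ => ⟨φ ≪≫ ψ⟩⟩

variable (X) in
/-- The set of isomorphism classes of line bundles on `X`. -/
def Pic : Type 1 := Quotient (LineBundle.setoid (X := X))

/-- The isomorphism class of a line bundle. -/
def LineBundle.cls (L : LineBundle X) : Pic X := Quotient.mk _ L

/-- A pairing exhibiting the line bundle `N` as the tensor product `L ⊗ M`: a bilinear map of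
sheaves of modules which sends a pair of local frames to a local frame, i.e. for which the
induced map `L ⊗ M → N` is an isomorphism. -/
structure TensorPairing (L M N : LineBundle X) where
  /-- the value `s ⊗ t` of the pairing -/
  pair (U : X.Opens) : Γ(L.sheaf, U) →ₗ[Γ(X, U)] Γ(M.sheaf, U) →ₗ[Γ(X, U)] Γ(N.sheaf, U)
  pair_res {U V : X.Opens} (h : V ≤ U) (s : Γ(L.sheaf, U)) (t : Γ(M.sheaf, U)) :
    pair V (restr L.sheaf h s) (restr M.sheaf h t) = restr N.sheaf h (pair U s t)
  isFrame_pair {U : X.Opens} (s : Γ(L.sheaf, U)) (t : Γ(M.sheaf, U)) :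
    IsFrame L.sheaf s → IsFrame M.sheaf t → IsFrame N.sheaf (pair U s t)

/-- A rational trivialization of `L`: an embedding of `L` into the constant sheaf of rational
functions. -/
structure RatTriv [IsIntegral X] (L : LineBundle X) where
  /-- the rational function attached to a section -/
  toRat (U : X.Opens) [Nonempty U] : Γ(L.sheaf, U) →ₗ[Γ(X, U)] X.functionField
  toRat_res {U V : X.Opens} [Nonempty U] [Nonempty V] (h : V ≤ U) (s : Γ(L.sheaf, U)) :
    toRat V (restr L.sheaf h s) = toRat U s
  toRat_injective (U : X.Opens) [Nonempty U] : Function.Injective (toRat U)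

/-- The rational trivialization `τ` identifies `L` with `𝒪(D)`, the sheaf of rational functions
`f` with `ν_x(f) ≥ -n_x` at all closed points `x`, where `D = ∑ n_x x`. -/
def RatTriv.HasDivisor [IsIntegral X] [IsLocallyNoetherian X] {L : LineBundle X} (τ : RatTriv L)
    (D : Div X) : Prop :=
  ∀ (U : X.Opens) [Nonempty U] (f : X.functionField), f ∈ Set.range (τ.toRat U) ↔
    f = 0 ∨ ∀ x : closedPoints X, x.1 ∈ U → -D x ≤ Scheme.ord f x.1

end LineBundles

/-! ### Line bundles with flat connection -/

section Connections

variable {X : Scheme.{0}} [X.Over SpecC]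

/-- A flat algebraic connection on `L`: over each affine open set, vector fields `v` act on
sections of `L` by covariant derivatives `∇_v`, compatibly with restriction. -/
structure FlatConnection (L : X.Modules) where
  /-- the covariant derivative `∇_v` -/
  nabla (U : X.affineOpens) :
    Derivation ℂ Γ(X, U.1) Γ(X, U.1) →ₗ[Γ(X, U.1)] (Γ(L, U.1) →+ Γ(L, U.1))
  leibniz (U : X.affineOpens) (v : Derivation ℂ Γ(X, U.1) Γ(X, U.1)) (f : Γ(X, U.1))
    (s : Γ(L, U.1)) : nabla U v (f • s) = v f • s + f • nabla U v s
  flat (U : X.affineOpens) (v w : Derivation ℂ Γ(X, U.1) Γ(X, U.1)) (s : Γ(L, U.1)) :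
    nabla U ⁅v, w⁆ s = nabla U v (nabla U w s) - nabla U w (nabla U v s)
  nabla_res {U V : X.affineOpens} (h : V.1 ≤ U.1) (v : Derivation ℂ Γ(X, U.1) Γ(X, U.1))
    (v' : Derivation ℂ Γ(X, V.1) Γ(X, V.1)) (hv : ∀ f, v' (resFun h f) = resFun h (v f))
    (s : Γ(L, U.1)) : nabla V v' (restr L h s) = restr L h (nabla U v s)

variable (X) in
/-- Line bundles with flat connection on `X`. -/
structure FlatLineBundle extends LineBundle X where
  /-- the connection -/
  conn : FlatConnection sheaf

/-- Isomorphism of line bundles with connection: isomorphism of the underlying line bundles that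
commutes with covariant derivatives. -/
instance FlatLineBundle.setoid : Setoid (FlatLineBundle X) where
  r E F := ∃ φ : E.sheaf ≅ F.sheaf, ∀ (U : X.affineOpens) v (s : Γ(E.sheaf, U.1)),
    φ.hom.app U.1 (E.conn.nabla U v s) = F.conn.nabla U v (φ.hom.app U.1 s)
  iseqv := by
    refine ⟨fun E => ⟨Iso.refl _, fun U v s => by simp⟩, ?_, ?_⟩
    · rintro E F ⟨φ, h⟩
      have h1 (U : X.Opens) (s : Γ(E.sheaf, U)) : φ.inv.app U (φ.hom.app U s) = s := by
        rw [← ConcreteCategory.comp_apply, ← Scheme.Modules.Hom.comp_app, φ.hom_inv_id]; simp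
      have h2 (U : X.Opens) (s : Γ(F.sheaf, U)) : φ.hom.app U (φ.inv.app U s) = s := by
        rw [← ConcreteCategory.comp_apply, ← Scheme.Modules.Hom.comp_app, φ.inv_hom_id]; simp
      refine ⟨φ.symm, fun U v s => ?_⟩
      have := h U v (φ.inv.app U.1 s)
      rw [h2] at this
      simp only [Iso.symm_hom]
      rw [← this, h1]
    · rintro E F G ⟨φ, h⟩ ⟨ψ, k⟩
      refine ⟨φ ≪≫ ψ, fun U v s => ?_⟩
      simp [h, k]

variable (X) in
/-- The set `Pic^♭ X` of isomorphism classes of line bundles with flat connection on `X`. -/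
def PicFlat : Type 1 := Quotient (FlatLineBundle.setoid (X := X))

/-- The isomorphism class of a line bundle with flat connection. -/
def FlatLineBundle.cls (E : FlatLineBundle X) : PicFlat X := Quotient.mk _ E

/-- `G` is the tensor product of `E` and `F`, where `E ⊗ F` carries the connection
`∇(s ⊗ t) = ∇s ⊗ t + s ⊗ ∇t`. -/
def IsFlatTensor (E F G : FlatLineBundle X) : Prop :=
  ∃ b : TensorPairing E.toLineBundle F.toLineBundle G.toLineBundle,
    ∀ (U : X.affineOpens) v (s : Γ(E.sheaf, U.1)) (t : Γ(F.sheaf, U.1)),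
      G.conn.nabla U v (b.pair U.1 s t) =
        b.pair U.1 (E.conn.nabla U v s) t + b.pair U.1 s (F.conn.nabla U v t)

variable [IsIntegral X]

/-- The derivation `w` of the function field extends the vector field `v` on `U`. -/
def Extends {U : X.Opens} [Nonempty U] (v : Derivation ℂ Γ(X, U) Γ(X, U))
    (w : Derivation ℂ X.functionField X.functionField) : Prop :=
  ∀ f : Γ(X, U), w (algebraMap Γ(X, U) X.functionField f) =
    algebraMap Γ(X, U) X.functionField (v f)

/-- In the rational trivialization `τ` of `E` the connection is `d + ω`, that is,
`∇_v` is `v + ⟨ω, v⟩`. -/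
def HasConnectionForm (E : FlatLineBundle X) (τ : RatTriv E.toLineBundle) (ω : RatDiff X) : Prop :=
  ∀ (U : X.affineOpens) [Nonempty U.1] (v : Derivation ℂ Γ(X, U.1) Γ(X, U.1))
    (w : Derivation ℂ X.functionField X.functionField), Extends v w → ∀ s : Γ(E.sheaf, U.1),
      τ.toRat U.1 (E.conn.nabla U v s) =
        w (τ.toRat U.1 s) + w.liftKaehlerDifferential ω * τ.toRat U.1 s

/-- `E` is isomorphic to the trivial line bundle with the connection `d + ω`: there is a global
frame `e` with `∇_v e = ⟨ω, v⟩ e`. -/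
def IsTrivialWithForm (E : FlatLineBundle X) (ω : RatDiff X) : Prop :=
  ∃ e : Γ(E.sheaf, ⊤), IsFrame E.sheaf e ∧
    ∀ (U : X.affineOpens) [Nonempty U.1] (v : Derivation ℂ Γ(X, U.1) Γ(X, U.1))
      (w : Derivation ℂ X.functionField X.functionField), Extends v w →
      ∃ g : Γ(X, U.1), algebraMap Γ(X, U.1) X.functionField g = w.liftKaehlerDifferential ω ∧
        E.conn.nabla U v (restr E.sheaf le_top e) = g • restr E.sheaf le_top e

end Connections

end FlatPic

end

/-!
# Line bundles with flat connection on a curve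

A line bundle `L` on the curve `X` has a rational trivialization `τ`, given by a frame at the
generic point and unique up to multiplication by a rational function `h`. It has two invariants.

* Its divisor `D`: minus the orders of local frames. The image of `τ` is `𝒪(D)`, so `D` determines
  `(L, τ)` up to isomorphism; multiplying `τ` by `h` subtracts `div h` from `D`, and divisors add
  up in tensor products. Hence `Pic X` is `Div X` modulo principal divisors (`exists_pic_group`).
* If `L` has a connection `∇`, the rational differential `ω` with `∇ = d + ω`
  (`exists_hasConnectionForm`). Multiplying `τ` by `h` subtracts `dlog h` from `ω`, and forms add
  up in tensor products (`isFlatTensor_iff`).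

The two invariants are related by `res ω = D`. If `g` is the rational function of a local frame,
then `∇` acts on that frame by the differential `ω + dg / g`, so the latter is regular
(`HasConnectionForm.isResidueAt`). Conversely, if `res ω = D` then all differentials `ω + dg / g`
are regular, so that `d + ω` preserves `𝒪(D)` and is a connection on it (`exists_flatConnection`);
it is flat because every rational differential on a curve is closed (`lift_lie`). As the divisor
of `τ` is determined by `ω`, so are `(L, τ)` and `∇`. Hence `Pic^♭ X` is the group of
differentials of the third kind with integral residues modulo `dlog K^×` (`exists_picFlat_group`),
which gives the isomorphism `Φ` and the compatibility of `res` with the maps to the Picard groups.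
The exactness statements follow: a differential `ω` whose residue divisor is `div f` differs from
`dlog f` by a regular differential, and `dlog f` is regular only if `f` has no zeros and poles,
that is, only if `f` is a unit.

On an affine curve `res` is surjective (`residueDiv_surjective`): given a closed point `x`, choose
a global function `a` with a simple zero at `x` and a global function `h` with `h(x) ≠ 0` that
vanishes at the other zeros of `a`; then a constant multiple of `h da / a` has `x` as its residue
divisor.

The local input is that the local ring at a closed point is a discrete valuation ring and that
`dz` generates the differentials for each uniformizer `z`. It gives a derivation `d / dz` of the
function field which preserves the local ring, so that regularity of a differential at `x` can be
tested by pairing it with `d / dz` (`mem_regularAt_iff`).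
-/

noncomputable section

namespace FlatPic

/-! ### Smooth local rings of dimension one -/

section LocalRings

open KaehlerDifferential IsLocalRing

variable {k A : Type} [Field k] [CommRing A] [IsLocalRing A] [Algebra k A]

/-- If the residue field of a smooth local `k`-algebra is `k`, an element of the maximal ideal whose
differential lies in `𝔪 Ω` belongs to `𝔪²`: the map `𝔪 / 𝔪² → k ⊗ Ω` is injective. -/
theorem mem_maximalIdeal_sq_of_differential [Algebra.FormallySmooth k A]
    (hres : Function.Bijective (algebraMap k (ResidueField A)))
    (e : Ω[A⁄k] ≃ₗ[A] A) {x : A} (hx : x ∈ maximalIdeal A)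
    (hd : e (D k A x) ∈ maximalIdeal A) : x ∈ maximalIdeal A ^ 2 := by
  have hs : Function.Surjective (algebraMap A (ResidueField A)) := residue_surjective
  have hsub : Subsingleton (Algebra.H1Cotangent k (ResidueField A)) := by
    have : Algebra.FormallyEtale k (ResidueField A) :=
      Algebra.FormallyEtale.of_equiv (AlgEquiv.ofBijective (Algebra.ofId k (ResidueField A)) hres)
    infer_instance
  have hinj := (Algebra.FormallySmooth.kerCotangentToTensor_injective_iff (R := k) (P := A)
    (A := ResidueField A) hs).2 hsub
  have hker : RingHom.ker (algebraMap A (ResidueField A)) = maximalIdeal A := ker_residue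
  have hx' : x ∈ RingHom.ker (algebraMap A (ResidueField A)) := hker ▸ hx
  have h0 : Ideal.toCotangent (RingHom.ker (algebraMap A (ResidueField A))) ⟨x, hx'⟩ = 0 := by
    apply hinj
    rw [kerCotangentToTensor_toCotangent, map_zero]
    have h1 : D k A x = e (D k A x) • e.symm 1 := by
      rw [← map_smul, smul_eq_mul, mul_one, e.symm_apply_apply]
    have h2 : algebraMap A (ResidueField A) (e (D k A x)) = 0 := by
      rw [← RingHom.mem_ker, hker]; exact hd
    change (1 : ResidueField A) ⊗ₜ[A] D k A x = 0
    rw [h1, TensorProduct.tmul_smul, TensorProduct.smul_tmul', ← Algebra.algebraMap_eq_smul_one,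
      h2, TensorProduct.zero_tmul]
  have h3 := (Ideal.toCotangent_eq_zero _ _).1 h0
  rw [← hker]
  exact h3

variable [IsNoetherianRing A]

/-- Some element of the maximal ideal has a differential generating `Ω`, and any such element
generates the maximal ideal. -/
theorem exists_maximalIdeal_eq_span [Algebra.FormallySmooth k A]
    (hres : Function.Bijective (algebraMap k (ResidueField A)))
    (e : Ω[A⁄k] ≃ₗ[A] A) :
    ∃ z : A, maximalIdeal A = Ideal.span {z} ∧ IsUnit (e (D k A z)) := by
  have h1 : ∃ z ∈ maximalIdeal A, IsUnit (e (D k A z)) := by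
    by_contra! hcon
    -- otherwise every differential lies in `𝔪 Ω`, since `A = k + 𝔪`
    have h2 : ∀ a : A, e (D k A a) ∈ maximalIdeal A := by
      intro a
      obtain ⟨c, hc⟩ := hres.2 (residue A a)
      have h3 : a - algebraMap k A c ∈ maximalIdeal A := by
        rw [← residue_eq_zero_iff, map_sub, sub_eq_zero, ← hc]
        rfl
      have h4 := hcon _ h3
      rw [map_sub, Derivation.map_algebraMap, sub_zero] at h4
      exact (mem_maximalIdeal _).2 h4
    have h5 : (⊤ : Submodule A Ω[A⁄k]) ≤ Submodule.comap e.toLinearMap (maximalIdeal A) := by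
      rw [← span_range_derivation, Submodule.span_le]
      rintro _ ⟨a, rfl⟩
      exact h2 a
    have h6 : e.symm 1 ∈ Submodule.comap e.toLinearMap (maximalIdeal A) := h5 trivial
    rw [Submodule.mem_comap, LinearEquiv.coe_coe, e.apply_symm_apply] at h6
    exact (Ideal.ne_top_iff_one _).1 (maximalIdeal.isMaximal A).ne_top h6
  obtain ⟨z, hz, hu⟩ := h1
  refine ⟨z, le_antisymm ?_ ((Ideal.span_singleton_le_iff_mem _).2 hz), hu⟩
  apply Submodule.le_of_le_smul_of_le_jacobson_bot (I := maximalIdeal A)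
    (IsNoetherian.noetherian _) (maximalIdeal_le_jacobson _)
  intro x hx
  obtain ⟨u, hu⟩ := hu
  -- subtracting a multiple of `z` brings the differential of `x` into `𝔪 Ω`
  set c := e (D k A x) * (u⁻¹ : Aˣ) with hc
  have h7 : x - c * z ∈ maximalIdeal A ^ 2 := by
    apply mem_maximalIdeal_sq_of_differential hres e
      (sub_mem hx (Ideal.mul_mem_left _ _ hz))
    have h8 : e (D k A (x - c * z)) = - (z * e (D k A c)) := by
      rw [map_sub, Derivation.leibniz, map_sub, map_add, map_smul, map_smul, ← hu, smul_eq_mul,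
        smul_eq_mul, hc, mul_assoc, Units.inv_mul]
      ring
    rw [h8]
    exact neg_mem (Ideal.mul_mem_right _ _ hz)
  rw [pow_two] at h7
  have h9 : x = c * z + (x - c * z) := by ring
  rw [h9]
  exact Submodule.add_mem_sup (Ideal.mul_mem_left _ _ (Ideal.mem_span_singleton_self z)) h7

variable [IsDomain A]

theorem isDiscreteValuationRing_of_smooth [Algebra.FormallySmooth k A]
    (hres : Function.Bijective (algebraMap k (ResidueField A)))
    (e : Ω[A⁄k] ≃ₗ[A] A) : IsDiscreteValuationRing A := by
  obtain ⟨z, hz, hu⟩ := exists_maximalIdeal_eq_span hres e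
  have hz0 : z ≠ 0 := by
    rintro rfl
    simp at hu
  have hnf : ¬ IsField A := by
    intro hf
    rw [isField_iff_maximalIdeal_eq] at hf
    rw [hf] at hz
    exact hz0 (by simpa using hz.symm)
  have hp : (maximalIdeal A).IsPrincipal := ⟨⟨z, hz⟩⟩
  exact ((IsDiscreteValuationRing.TFAE A hnf).out 0 4).2 hp

/-- The differential of a local parameter generates `Ω`. -/
theorem isUnit_differential_of_irreducible [Algebra.FormallySmooth k A]
    (hres : Function.Bijective (algebraMap k (ResidueField A)))
    (e : Ω[A⁄k] ≃ₗ[A] A) {z : A} (hz : Irreducible z) : IsUnit (e (D k A z)) := by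
  have := isDiscreteValuationRing_of_smooth hres e
  obtain ⟨t, ht, hu⟩ := exists_maximalIdeal_eq_span hres e
  have htm : t ∈ maximalIdeal A := ht ▸ Ideal.mem_span_singleton_self t
  rw [(IsDiscreteValuationRing.irreducible_iff_uniformizer z).1 hz,
    Ideal.span_singleton_eq_span_singleton] at ht
  obtain ⟨v, rfl⟩ := ht.symm
  rw [Derivation.leibniz, map_add, map_smul, map_smul, smul_eq_mul, smul_eq_mul]
  by_contra hn
  have h1 : t * e (D k A v) + v * e (D k A t) ∈ maximalIdeal A := (mem_maximalIdeal _).2 hn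
  have h2 : (v : A) * e (D k A t) ∈ maximalIdeal A := by
    simpa using sub_mem h1 (Ideal.mul_mem_right (e (D k A v)) _ htm)
  exact (mem_maximalIdeal _).1 h2 (v.isUnit.mul hu)

variable {K : Type} [Field K] [Algebra A K] [Algebra k K]
  [IsScalarTower k A K]

theorem differential_ne_zero_of_irreducible [IsFractionRing A K] [Algebra.FormallySmooth k A]
    (hres : Function.Bijective (algebraMap k (ResidueField A)))
    (e : Ω[A⁄k] ≃ₗ[A] A) {z : A} (hz : Irreducible z) : D k K (algebraMap A K z) ≠ 0 := by
  intro h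
  have h1 : KaehlerDifferential.map k k A K (D k A z) = 0 := by rw [map_D, h]
  rw [IsLocalizedModule.eq_zero_iff (nonZeroDivisors A)] at h1
  obtain ⟨s, hs⟩ := h1
  have h2 : (s : A) * e (D k A z) = 0 := by
    rw [← smul_eq_mul, ← map_smul]
    exact (congrArg e hs).trans (map_zero e)
  rcases mul_eq_zero.1 h2 with h3 | h3
  · exact nonZeroDivisors.coe_ne_zero s h3
  · exact (isUnit_differential_of_irreducible hres e hz).ne_zero h3

theorem exists_differential_eq_smul [Algebra.FormallySmooth k A]
    (hres : Function.Bijective (algebraMap k (ResidueField A)))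
    (e : Ω[A⁄k] ≃ₗ[A] A) {z : A} (hz : Irreducible z) (a : A) :
    ∃ c : A, D k K (algebraMap A K a) = algebraMap A K c • D k K (algebraMap A K z) := by
  obtain ⟨u, hu⟩ := isUnit_differential_of_irreducible hres e hz
  have h1 : D k A a = (e (D k A a) * (u⁻¹ : Aˣ)) • D k A z := by
    apply e.injective
    rw [map_smul, ← hu, smul_eq_mul, mul_assoc, Units.inv_mul, mul_one]
  refine ⟨e (D k A a) * (u⁻¹ : Aˣ), ?_⟩
  have h2 := congrArg (KaehlerDifferential.map k k A K) h1
  rw [map_smul, map_D, map_D] at h2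
  rw [h2, algebraMap_smul]

end LocalRings

/-! ### Local rings of a smooth curve at closed points -/

section Stalks

open KaehlerDifferential IsLocalRing

theorem genericPoint_mem {X : Scheme.{0}} [IsIntegral X] (U : X.Opens) [h : Nonempty U] :
    genericPoint X ∈ U :=
  ((genericPoint_spec X).mem_open_set_iff U.isOpen).mpr (by simpa using h)

variable (X : Scheme.{0}) [X.Over SpecC]

/-- The local rings of a `ℂ`-scheme are `ℂ`-algebras. -/
instance stalkAlgebra (x : X) : Algebra ℂ (X.presheaf.stalk x) :=
  ((X.presheaf.germ ⊤ x trivial).hom.comp (constHom X ⊤)).toAlgebra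

variable {X}

theorem resFun_constHom {U V : X.Opens} (h : V ≤ U) (c : ℂ) :
    resFun h (constHom X U c) = constHom X V c := by
  simp only [constHom, RingHom.comp_apply, resFun]
  rw [← ConcreteCategory.comp_apply, ← X.presheaf.map_comp]
  rfl

theorem constHom_top (c : ℂ) : constHom X ⊤ c =
    (X ↘ SpecC).appTop ((Scheme.ΓSpecIso (CommRingCat.of ℂ)).inv c) := by
  have h : (homOfLE le_top : (⊤ : X.Opens) ⟶ ⊤).op = 𝟙 _ := rfl
  simp only [constHom, h, X.presheaf.map_id]
  rfl

theorem germ_constHom {U : X.Opens} {x : X} (hx : x ∈ U) (c : ℂ) :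
    X.presheaf.germ U x hx (constHom X U c) = algebraMap ℂ (X.presheaf.stalk x) c := by
  rw [← resFun_constHom (le_top : U ≤ ⊤), resFun, X.presheaf.germ_res_apply]
  rfl

theorem algebraMap_residueField_surjective [LocallyOfFiniteType (X ↘ SpecC)] {x : X}
    (hx : IsClosed {x}) :
    Function.Surjective (algebraMap ℂ (ResidueField (X.presheaf.stalk x))) := by
  have h1 := SpecMap_residueFieldIsoBase_inv (X ↘ SpecC) x hx
  have h2 : (X ↘ SpecC) = X.toSpecΓ ≫
      Spec.map ((Scheme.ΓSpecIso (CommRingCat.of ℂ)).inv ≫ (X ↘ SpecC).appTop) := by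
    rw [Spec.map_comp, ← Category.assoc, ← Scheme.toSpecΓ_naturality, Category.assoc,
      ← SpecMap_ΓSpecIso_hom, ← Spec.map_comp, Iso.inv_hom_id, Spec.map_id,
      Category.comp_id]
  have hcomp {f g : X ⟶ SpecC} (h : f = g) :
      X.fromSpecResidueField x ≫ f = X.fromSpecResidueField x ≫ g := by rw [h]
  have h3 : X.fromSpecResidueField x = Spec.map (X.residue x) ≫ X.fromSpecStalk x := rfl
  rw [hcomp h2, h3, Category.assoc, Scheme.fromSpecStalk_toSpecΓ_assoc, ← Spec.map_comp,
    ← Spec.map_comp] at h1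
  have h4 := Spec.map_injective h1
  intro a
  obtain ⟨c, hc⟩ : ∃ c : ℂ, (residueFieldIsoBase (X ↘ SpecC) x hx).inv c = a :=
    (ConcreteCategory.bijective_of_isIso (residueFieldIsoBase (X ↘ SpecC) x hx).inv).2 a
  refine ⟨c, ?_⟩
  rw [← hc, h4]
  change residue _ (algebraMap ℂ _ c) = _
  rw [← germ_constHom (U := ⊤) trivial, constHom_top]
  rfl

theorem algebraMap_residueField_bijective [LocallyOfFiniteType (X ↘ SpecC)] {x : X}
    (hx : IsClosed {x}) :
    Function.Bijective (algebraMap ℂ (ResidueField (X.presheaf.stalk x))) :=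
  ⟨(algebraMap ℂ _).injective, algebraMap_residueField_surjective hx⟩

instance stalk_isScalarTower [IsIntegral X] (x : X) :
    IsScalarTower ℂ (X.presheaf.stalk x) X.functionField :=
  IsScalarTower.of_algebraMap_eq fun c => by
    have : Nonempty (⊤ : X.Opens) := ⟨⟨x, trivial⟩⟩
    exact (Scheme.algebraMap_germ_eq_germToFunctionField X (U := ⊤) (x := x) trivial
      (constHom X ⊤ c)).symm

instance sections_isScalarTower [IsIntegral X] (U : X.Opens) [Nonempty U] :
    IsScalarTower ℂ Γ(X, U) X.functionField :=
  IsScalarTower.of_algebraMap_eq fun c => by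
    exact (germ_constHom (genericPoint_mem U) c).symm

variable [SmoothOfRelativeDimension 1 (X ↘ SpecC)]

variable (X) in
theorem exists_isStandardSmooth (x : X) : ∃ V : X.Opens, IsAffineOpen V ∧ x ∈ V ∧
    Algebra.IsStandardSmoothOfRelativeDimension 1 ℂ Γ(X, V) := by
  obtain ⟨U, hU, V, hV, hxV, hVU, h⟩ :=
    SmoothOfRelativeDimension.exists_isStandardSmoothOfRelativeDimension
      (n := 1) (f := X ↘ SpecC) x
  have hUtop : U = ⊤ := by
    have hss : Subsingleton (PrimeSpectrum ℂ) := inferInstance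
    rw [eq_top_iff]
    intro y _
    have : y = (X ↘ SpecC) x := hss.elim _ _
    exact this ▸ hVU hxV
  subst hUtop
  refine ⟨V, hV, hxV, ?_⟩
  have h1 := RingHom.IsStandardSmoothOfRelativeDimension.comp h
    (RingHom.IsStandardSmoothOfRelativeDimension.equiv
      (Scheme.ΓSpecIso (CommRingCat.of ℂ)).symm.commRingCatIsoToRingEquiv)
  have h2 : (((X ↘ SpecC).appLE ⊤ V hVU).hom.comp
      (Scheme.ΓSpecIso (CommRingCat.of ℂ)).symm.commRingCatIsoToRingEquiv.toRingHom) =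
      algebraMap ℂ Γ(X, V) := rfl
  rw [← RingHom.isStandardSmoothOfRelativeDimension_algebraMap, ← h2]
  simpa using h1

theorem exists_smooth_stalk [IsIntegral X] (x : X) :
    Algebra.FormallySmooth ℂ (X.presheaf.stalk x) ∧
      Nonempty (Ω[X.presheaf.stalk x⁄ℂ] ≃ₗ[X.presheaf.stalk x] X.presheaf.stalk x) := by
  obtain ⟨V, hV, hxV, h⟩ := exists_isStandardSmooth X x
  let _ : Algebra Γ(X, V) (X.presheaf.stalk x) := (X.presheaf.germ V x hxV).hom.toAlgebra
  have hloc : IsLocalization.AtPrime (X.presheaf.stalk x) (hV.primeIdealOf ⟨x, hxV⟩).asIdeal :=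
    hV.isLocalization_stalk ⟨x, hxV⟩
  have : IsScalarTower ℂ Γ(X, V) (X.presheaf.stalk x) :=
    IsScalarTower.of_algebraMap_eq fun c => (germ_constHom hxV c).symm
  have : Nonempty V := ⟨⟨x, hxV⟩⟩
  have hst : Algebra.IsStandardSmooth ℂ Γ(X, V) := h.isStandardSmooth 1
  have hrank := Algebra.IsStandardSmoothOfRelativeDimension.rank_kaehlerDifferential
    (R := ℂ) (S := Γ(X, V)) 1
  have : Algebra.FormallyEtale Γ(X, V) (X.presheaf.stalk x) :=
    Algebra.FormallyEtale.of_isLocalization (hV.primeIdealOf ⟨x, hxV⟩).asIdeal.primeCompl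
  refine ⟨Algebra.FormallySmooth.comp ℂ Γ(X, V) _, ?_⟩
  obtain ⟨e⟩ : Nonempty (Ω[Γ(X, V)⁄ℂ] ≃ₗ[Γ(X, V)] Γ(X, V)) :=
    nonempty_linearEquiv_of_rank_eq (by rw [hrank, Module.rank_self]; simp)
  have hb := KaehlerDifferential.isBaseChange_of_formallyEtale ℂ Γ(X, V) (X.presheaf.stalk x)
  exact ⟨hb.equiv.symm ≪≫ₗ (TensorProduct.AlgebraTensorModule.congr
    (LinearEquiv.refl (X.presheaf.stalk x) (X.presheaf.stalk x)) e) ≪≫ₗ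
    TensorProduct.AlgebraTensorModule.rid Γ(X, V) (X.presheaf.stalk x) (X.presheaf.stalk x)⟩

instance locallyOfFiniteType_curve : LocallyOfFiniteType (X ↘ SpecC) :=
  haveI : Smooth (X ↘ SpecC) := SmoothOfRelativeDimension.smooth 1 _
  inferInstance

variable [IsIntegral X]

theorem isDiscreteValuationRing_stalk {x : X} (hx : x ∈ closedPoints X) :
    IsDiscreteValuationRing (X.presheaf.stalk x) := by
  obtain ⟨_, ⟨e⟩⟩ := exists_smooth_stalk x
  exact isDiscreteValuationRing_of_smooth (algebraMap_residueField_bijective hx) e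

theorem dRat_parameter_ne_zero {x : X} (hx : x ∈ closedPoints X) {z : X.presheaf.stalk x}
    (hz : Irreducible z) : dRat X (algebraMap _ X.functionField z) ≠ 0 := by
  obtain ⟨_, ⟨e⟩⟩ := exists_smooth_stalk x
  exact differential_ne_zero_of_irreducible (algebraMap_residueField_bijective hx) e hz

theorem exists_dRat_eq_smul {x : X} (hx : x ∈ closedPoints X) {z : X.presheaf.stalk x}
    (hz : Irreducible z) (a : X.presheaf.stalk x) : ∃ c : X.presheaf.stalk x,
      dRat X (algebraMap _ X.functionField a) =
        algebraMap _ X.functionField c • dRat X (algebraMap _ X.functionField z) := by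
  obtain ⟨_, ⟨e⟩⟩ := exists_smooth_stalk x
  exact exists_differential_eq_smul (algebraMap_residueField_bijective hx) e hz a

theorem coheight_closedPoint {x : X} (hx : x ∈ closedPoints X) : Order.coheight x = 1 := by
  have := isDiscreteValuationRing_stalk hx
  have h := ringKrullDim_stalk_eq_coheight x
  rw [IsDiscreteValuationRing.ringKrullDim_eq_one] at h
  exact_mod_cast h.symm

end Stalks

/-! ### Rational functions: local rings, sections and orders -/

theorem exists_closedPoint_specializes {X : Scheme.{0}} [JacobsonSpace X] {U : X.Opens} {x : X}
    (hx : x ∈ U) : ∃ y ∈ U, y ∈ closedPoints X ∧ x ⤳ y := by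
  obtain ⟨y, ⟨hy1, hy2⟩, hy3⟩ := nonempty_inter_closedPoints (X := X) (Z := closure {x} ∩ U)
    ⟨x, subset_closure rfl, hx⟩ (isClosed_closure.isLocallyClosed.inter U.isOpen.isLocallyClosed)
  exact ⟨y, hy2, hy3, specializes_iff_mem_closure.2 hy1⟩

theorem exists_opens_compl {X : Scheme.{0}} (S : Set (closedPoints X)) (hS : S.Finite) :
    ∃ U : X.Opens, ∀ x : X, x ∈ U ↔ ∀ y ∈ S, x ≠ y.1 := by
  refine ⟨⟨(⋃ y ∈ S, {y.1})ᶜ, (hS.isClosed_biUnion fun y _ => y.2).isOpen_compl⟩, fun x => ?_⟩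
  change x ∈ (⋃ y ∈ S, {y.1})ᶜ ↔ _
  simp

section RationalFunctions

variable (X : Scheme.{0}) [IsIntegral X]

/-- The local ring at `x` as a subring of the field of rational functions. -/
def localRing (x : X) : Subring X.functionField :=
  (algebraMap (X.presheaf.stalk x) X.functionField).range

variable {X}

theorem algebraMap_mem_localRing {x : X} (a : X.presheaf.stalk x) :
    algebraMap _ X.functionField a ∈ localRing X x := ⟨a, rfl⟩

theorem algebraMap_stalk_injective (x : X) :
    Function.Injective (algebraMap (X.presheaf.stalk x) X.functionField) :=
  IsFractionRing.injective _ _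

theorem algebraMap_sections_injective (U : X.Opens) [Nonempty U] :
    Function.Injective (algebraMap Γ(X, U) X.functionField) :=
  Scheme.germToFunctionField_injective X U

theorem algebraMap_resFun {U V : X.Opens} [Nonempty U] [Nonempty V] (h : V ≤ U) (f : Γ(X, U)) :
    algebraMap Γ(X, V) X.functionField (resFun h f) = algebraMap Γ(X, U) X.functionField f :=
  X.presheaf.germ_res_apply (homOfLE h) _ (genericPoint_mem V) f

theorem algebraMap_germ {U : X.Opens} [Nonempty U] {x : X} (hx : x ∈ U) (f : Γ(X, U)) :
    algebraMap (X.presheaf.stalk x) X.functionField (X.presheaf.germ U x hx f) =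
      algebraMap Γ(X, U) X.functionField f :=
  Scheme.algebraMap_germ_eq_germToFunctionField X hx f

theorem algebraMap_section_mem_localRing {U : X.Opens} [Nonempty U] (f : Γ(X, U)) {x : X}
    (hx : x ∈ U) : algebraMap Γ(X, U) X.functionField f ∈ localRing X x :=
  ⟨_, algebraMap_germ hx f⟩

theorem nonempty_inf (U V : X.Opens) [Nonempty U] [Nonempty V] : Nonempty (U ⊓ V : X.Opens) :=
  ⟨⟨_, genericPoint_mem U, genericPoint_mem V⟩⟩

theorem exists_section_of_mem_localRing {x : X} {f : X.functionField} (hf : f ∈ localRing X x) :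
    ∃ (U : X.Opens) (_ : x ∈ U) (_ : Nonempty U) (s : Γ(X, U)),
      algebraMap Γ(X, U) X.functionField s = f := by
  obtain ⟨a, rfl⟩ := hf
  obtain ⟨U, hU, s, rfl⟩ := X.presheaf.exists_germ_eq a
  have : Nonempty U := ⟨⟨x, hU⟩⟩
  exact ⟨U, hU, this, s, (algebraMap_germ hU s).symm⟩

theorem localRing_le_of_specializes {x y : X} (h : x ⤳ y) : localRing X y ≤ localRing X x := by
  intro f hf
  obtain ⟨U, hU, hne, s, rfl⟩ := exists_section_of_mem_localRing hf
  exact algebraMap_section_mem_localRing s (h.mem_open U.isOpen hU)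

/-- A rational function that is regular at all points of `U` is a regular function on `U`. -/
theorem exists_section_of_forall_mem {U : X.Opens} [Nonempty U] {f : X.functionField}
    (hf : ∀ x ∈ U, f ∈ localRing X x) :
    ∃ s : Γ(X, U), algebraMap Γ(X, U) X.functionField s = f := by
  choose V hxV hV s hs using fun x : U => exists_section_of_mem_localRing (hf x.1 x.2)
  have hW (x : U) : Nonempty (V x ⊓ U : X.Opens) := nonempty_inf _ _
  obtain ⟨t, ht, -⟩ := X.sheaf.existsUnique_gluing' (fun x : U => V x ⊓ U) U
    (fun x => homOfLE inf_le_right)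
    (fun x hx => Opens.mem_iSup.2 ⟨⟨x, hx⟩, hxV ⟨x, hx⟩, hx⟩)
    (fun x => resFun inf_le_left (s x)) (by
      intro x y
      have : Nonempty ((V x ⊓ U) ⊓ (V y ⊓ U) : X.Opens) := nonempty_inf _ _
      apply algebraMap_sections_injective
      refine (algebraMap_resFun _ _).trans (Eq.trans ?_ (algebraMap_resFun _ _).symm)
      rw [algebraMap_resFun, algebraMap_resFun, hs, hs])
  refine ⟨t, ?_⟩
  let x : U := ⟨genericPoint X, genericPoint_mem U⟩
  rw [← hs x, ← algebraMap_resFun (inf_le_left : V x ⊓ U ≤ V x) (s x), ← ht x]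
  exact (algebraMap_resFun _ _).symm

theorem parameter_ne_zero {x : X} {z : X.presheaf.stalk x} (hz : Irreducible z) :
    algebraMap _ X.functionField z ≠ 0 :=
  (map_ne_zero_iff _ (algebraMap_stalk_injective x)).2 hz.ne_zero

variable [X.Over SpecC]

theorem regularAt_le_of_specializes {x y : X} (h : x ⤳ y) : regularAt X y ≤ regularAt X x := by
  rw [regularAt, AddSubgroup.closure_le]
  rintro _ ⟨a, b, rfl⟩
  obtain ⟨a', ha⟩ := localRing_le_of_specializes h (algebraMap_mem_localRing a)
  obtain ⟨b', hb⟩ := localRing_le_of_specializes h (algebraMap_mem_localRing b)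
  rw [← ha, ← hb]
  exact AddSubgroup.subset_closure ⟨a', b', rfl⟩

variable [SmoothOfRelativeDimension 1 (X ↘ SpecC)]

instance jacobsonSpace_curve : JacobsonSpace X :=
  haveI : JacobsonSpace SpecC := inferInstanceAs (JacobsonSpace (PrimeSpectrum ℂ))
  LocallyOfFiniteType.jacobsonSpace (X ↘ SpecC)

theorem exists_section_iff {U : X.Opens} [Nonempty U] {f : X.functionField} :
    (∃ s : Γ(X, U), algebraMap Γ(X, U) X.functionField s = f) ↔
      ∀ x ∈ U, x ∈ closedPoints X → f ∈ localRing X x := by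
  constructor
  · rintro ⟨s, rfl⟩ x hx _
    exact algebraMap_section_mem_localRing s hx
  · intro h
    refine exists_section_of_forall_mem fun x hx => ?_
    obtain ⟨y, hyU, hy, hxy⟩ := exists_closedPoint_specializes hx
    exact localRing_le_of_specializes hxy (h y hyU hy)

theorem mem_regularDiff_iff {ω : RatDiff X} :
    ω ∈ regularDiff X ↔ ∀ x ∈ closedPoints X, ω ∈ regularAt X x := by
  rw [regularDiff, AddSubgroup.mem_iInf]
  refine ⟨fun h x _ => h x, fun h x => ?_⟩
  obtain ⟨y, -, hy, hxy⟩ := exists_closedPoint_specializes (U := ⊤) (x := x) trivial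
  exact regularAt_le_of_specializes hxy (h y hy)

theorem exists_parameter {x : X} (hx : x ∈ closedPoints X) :
    ∃ z : X.presheaf.stalk x, Irreducible z :=
  haveI := isDiscreteValuationRing_stalk hx
  IsDiscreteValuationRing.exists_irreducible _

theorem ord_parameter {x : X} (hx : x ∈ closedPoints X) {z : X.presheaf.stalk x}
    (hz : Irreducible z) : Scheme.ord (algebraMap _ X.functionField z) x = 1 := by
  have := isDiscreteValuationRing_stalk hx
  rw [Scheme.ord_eq_iff (coheight_closedPoint hx) (parameter_ne_zero hz)]
  exact Ring.ordFrac_irreducible hz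

theorem ord_one {x : X} : Scheme.ord (1 : X.functionField) x = 0 := by
  have h := Scheme.ord_mul (x := x) (one_ne_zero (α := X.functionField)) one_ne_zero
  rw [mul_one] at h
  lia

theorem ord_inv {x : X} {f : X.functionField} (hf : f ≠ 0) :
    Scheme.ord f⁻¹ x = - Scheme.ord f x := by
  have h := Scheme.ord_mul (x := x) hf (inv_ne_zero hf)
  rw [mul_inv_cancel₀ hf, ord_one] at h
  lia

theorem ord_zpow {x : X} {f : X.functionField} (hf : f ≠ 0) (n : ℤ) :
    Scheme.ord (f ^ n) x = n * Scheme.ord f x := by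
  induction n with
  | zero => simp [ord_one]
  | succ i ih => rw [zpow_add_one₀ hf, Scheme.ord_mul (zpow_ne_zero _ hf) hf, ih]; ring
  | pred i ih =>
    rw [zpow_sub_one₀ hf, Scheme.ord_mul (zpow_ne_zero _ hf) (inv_ne_zero hf), ih, ord_inv hf]; ring

/-- A nonzero rational function is a unit times a power of a local parameter. -/
theorem exists_eq_unit_mul_zpow {x : X} (hx : x ∈ closedPoints X) {z : X.presheaf.stalk x}
    (hz : Irreducible z) {f : X.functionField} (hf : f ≠ 0) :
    ∃ u : (X.presheaf.stalk x)ˣ, f = algebraMap _ X.functionField (u : X.presheaf.stalk x) *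
      algebraMap _ X.functionField z ^ Scheme.ord f x := by
  have := isDiscreteValuationRing_stalk hx
  have h1 : X.ordHom x (coheight_closedPoint hx) (algebraMap _ X.functionField z ^ Scheme.ord f x) =
      X.ordHom x (coheight_closedPoint hx) f := by
    rw [(Scheme.ord_eq_iff (coheight_closedPoint hx) hf).1 rfl,
      ← Scheme.ord_eq_iff (coheight_closedPoint hx) (zpow_ne_zero _ (parameter_ne_zero hz)),
      ord_zpow (parameter_ne_zero hz), ord_parameter hx hz, mul_one]
  obtain ⟨u, hu⟩ := Ring.associated_of_ordFrac_eq (R := X.presheaf.stalk x) _ _ h1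
  refine ⟨u, ?_⟩
  conv_lhs => rw [← hu]
  rw [Units.smul_def, Algebra.smul_def]

theorem mem_localRing_iff {x : X} (hx : x ∈ closedPoints X) {f : X.functionField} :
    f ∈ localRing X x ↔ f = 0 ∨ 0 ≤ Scheme.ord f x := by
  have := isDiscreteValuationRing_stalk hx
  obtain ⟨z, hz⟩ := exists_parameter hx
  constructor
  · rintro ⟨a, rfl⟩
    by_cases ha : algebraMap _ X.functionField a = 0
    · exact Or.inl ha
    · right
      rw [Scheme.le_ord_iff (coheight_closedPoint hx) ha]
      exact Ring.ordFrac_ge_one_of_ne_zero (fun h => ha (by rw [h, map_zero]))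
  · rintro (rfl | h)
    · exact zero_mem _
    · by_cases hf : f = 0
      · rw [hf]; exact zero_mem _
      obtain ⟨u, hu⟩ := exists_eq_unit_mul_zpow hx hz hf
      obtain ⟨n, hn⟩ := Int.eq_ofNat_of_zero_le h
      rw [hu, hn, zpow_natCast]
      exact mul_mem (algebraMap_mem_localRing _) (pow_mem (algebraMap_mem_localRing _) _)

theorem le_ord_iff_div_mem {x : X} (hx : x ∈ closedPoints X) {f g : X.functionField} (hg : g ≠ 0) :
    (f = 0 ∨ Scheme.ord g x ≤ Scheme.ord f x) ↔ f / g ∈ localRing X x := by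
  rw [mem_localRing_iff hx]
  by_cases hf : f = 0
  · simp [hf]
  · rw [div_eq_mul_inv, Scheme.ord_mul hf (inv_ne_zero hg), ord_inv hg]
    simp only [hf, false_or, mul_eq_zero, inv_eq_zero, hg]
    lia

/-- A rational function of order zero at all points of `U` is a unit on `U`. -/
theorem exists_section_unit {U : X.Opens} [Nonempty U] {f : X.functionField} (hf : f ≠ 0)
    (h : ∀ x ∈ U, x ∈ closedPoints X → Scheme.ord f x = 0) :
    ∃ u : Γ(X, U)ˣ, algebraMap Γ(X, U) X.functionField u = f := by
  obtain ⟨s, hs⟩ := exists_section_iff.2 fun x hxU hx =>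
    (mem_localRing_iff hx).2 (Or.inr (h x hxU hx).ge)
  obtain ⟨t, ht⟩ := exists_section_iff.2 fun x hxU hx => (mem_localRing_iff hx (f := f⁻¹)).2
    (Or.inr (by rw [ord_inv hf, h x hxU hx, neg_zero]))
  have hst : s * t = 1 := by
    apply algebraMap_sections_injective U
    rw [map_mul, hs, ht, mul_inv_cancel₀ hf, map_one]
  exact ⟨⟨s, t, hst, by rw [mul_comm, hst]⟩, hs⟩

section Finiteness

variable [QuasiCompact (X ↘ SpecC)]

instance noetherianSpace_curve : NoetherianSpace X := by
  have : CompactSpace SpecC := inferInstanceAs (CompactSpace (PrimeSpectrum ℂ))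
  have : CompactSpace X := QuasiCompact.compactSpace_of_compactSpace (X ↘ SpecC)
  have : IsNoetherian X := {}
  infer_instance

/-- A nonempty open subset of a curve contains all but finitely many closed points. -/
theorem finite_closedPoints_not_mem (U : X.Opens) [Nonempty U] :
    {x : closedPoints X | x.1 ∉ U}.Finite := by
  obtain ⟨S, hS, hSc, hSi, hU⟩ := NoetherianSpace.exists_finite_set_isClosed_irreducible
    (U.isOpen.isClosed_compl)
  have key : ∀ t ∈ S, ∀ x ∈ closedPoints X, x ∈ t → t = {x} := by
    intro t ht x hx hxt
    have hgen : IsGenericPoint (hSi t ht).genericPoint t := by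
      have h := (hSi t ht).isGenericPoint_genericPoint_closure
      rwa [(hSc t ht).closure_eq] at h
    set w := (hSi t ht).genericPoint
    have hwU : w ∉ U := by
      have : w ∈ ⋃₀ S := ⟨t, ht, hgen.mem⟩
      rwa [← hU] at this
    -- otherwise `x < w < genericPoint X` would be a chain of specializations of length two
    by_cases hwx : x ⤳ w
    · have h1 : w ∈ closure {x} := specializes_iff_mem_closure.1 hwx
      have h2 : IsClosed {x} := hx
      rw [h2.closure_eq] at h1
      rw [← hgen.def, Set.mem_singleton_iff.1 h1, h2.closure_eq]
    · have hlt : x < w := ⟨hgen.specializes hxt, hwx⟩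
      have hlt2 : w < genericPoint X := by
        refine ⟨(genericPoint_spec X).specializes trivial, fun h => ?_⟩
        exact hwU (h.mem_open U.isOpen (genericPoint_mem U))
      have h3 := Order.coheight_add_one_le hlt
      have h4 := Order.coheight_add_one_le hlt2
      rw [coheight_closedPoint hx] at h3
      have h5 : (1 : ℕ∞) + 1 ≤ 1 := le_trans (by gcongr; exact le_trans (by simp) h4) h3
      exact absurd h5 (by decide)
  have hfin : (⋃ t ∈ S, {x : closedPoints X | t = {x.1}}).Finite := by
    refine hS.biUnion fun t _ => Set.Subsingleton.finite ?_
    intro x hx y hy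
    have : ({x.1} : Set X) = {y.1} := hx.symm.trans hy
    exact Subtype.ext (Set.singleton_injective this)
  refine hfin.subset fun x hx => ?_
  have h1 : x.1 ∈ ⋃₀ S := by rw [← hU]; exact hx
  obtain ⟨t, ht, hxt⟩ := h1
  exact Set.mem_biUnion ht (key t ht x.1 x.2 hxt)

theorem finite_ord_ne_zero {f : X.functionField} (hf : f ≠ 0) :
    {x : closedPoints X | Scheme.ord f x.1 ≠ 0}.Finite := by
  obtain ⟨U, -, s, hU, rfl, hs⟩ := exists_isUnit_germ_eq X f hf
  refine (finite_closedPoints_not_mem U).subset fun x hx hxU => hx ?_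
  exact Scheme.ord_of_isUnit hs hxU

/-- The divisor of a nonzero rational function. -/
def principalDiv (f : X.functionFieldˣ) : Div X :=
  Finsupp.ofSupportFinite (fun x => Scheme.ord (f : X.functionField) x.1)
    (finite_ord_ne_zero f.ne_zero)

theorem principalDiv_apply (f : X.functionFieldˣ) (x : closedPoints X) :
    principalDiv f x = Scheme.ord (f : X.functionField) x.1 := rfl

end Finiteness

end RationalFunctions

/-! ### Derivations of the function field and rational differentials -/

theorem exists_eq_div {X : Scheme.{0}} [IsIntegral X] {U : X.Opens} [Nonempty U]
    (hU : IsAffineOpen U) {x : X} (hx : x ∈ U) {f : X.functionField} (hf : f ∈ localRing X x) :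
    ∃ a s : Γ(X, U), (algebraMap Γ(X, U) X.functionField s)⁻¹ ∈ localRing X x ∧
      algebraMap Γ(X, U) X.functionField s ≠ 0 ∧
      f = algebraMap Γ(X, U) X.functionField a / algebraMap Γ(X, U) X.functionField s := by
  obtain ⟨g, rfl⟩ := hf
  let _ : Algebra Γ(X, U) (X.presheaf.stalk x) := (X.presheaf.germ U x hx).hom.toAlgebra
  have hloc : IsLocalization.AtPrime (X.presheaf.stalk x) (hU.primeIdealOf ⟨x, hx⟩).asIdeal :=
    hU.isLocalization_stalk ⟨x, hx⟩
  obtain ⟨a, s, hs⟩ := IsLocalization.exists_mk'_eq (hU.primeIdealOf ⟨x, hx⟩).asIdeal.primeCompl g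
  have hgerm (r : Γ(X, U)) : algebraMap _ X.functionField (algebraMap Γ(X, U)
      (X.presheaf.stalk x) r) = algebraMap Γ(X, U) X.functionField r := algebraMap_germ hx r
  obtain ⟨u, hu⟩ := IsLocalization.map_units (X.presheaf.stalk x) s
  have hinv : (algebraMap Γ(X, U) X.functionField (s : Γ(X, U)))⁻¹ =
      algebraMap _ X.functionField ((u⁻¹ : (X.presheaf.stalk x)ˣ) : X.presheaf.stalk x) := by
    apply inv_eq_of_mul_eq_one_right
    rw [← hgerm, ← hu, ← map_mul, Units.mul_inv, map_one]
  have hne : algebraMap Γ(X, U) X.functionField (s : Γ(X, U)) ≠ 0 := by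
    rw [← hgerm, ← hu]
    exact (u.isUnit.map _).ne_zero
  refine ⟨a, s, hinv ▸ algebraMap_mem_localRing _, hne, ?_⟩
  rw [eq_div_iff hne, ← hgerm, ← hgerm, ← map_mul, ← hs, IsLocalization.mk'_spec]

theorem finiteType_sections {X : Scheme.{0}} [X.Over SpecC]
    [LocallyOfFiniteType (X ↘ SpecC)] {U : X.Opens} (hU : IsAffineOpen U) :
    Algebra.FiniteType ℂ Γ(X, U) := by
  have h := (X ↘ SpecC).finiteType_appLE (isAffineOpen_top SpecC) hU le_top
  have h1 : ((X ↘ SpecC).appLE ⊤ U le_top).hom.comp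
      (Scheme.ΓSpecIso (CommRingCat.of ℂ)).inv.hom = algebraMap ℂ Γ(X, U) := rfl
  rw [← RingHom.finiteType_algebraMap, ← h1]
  exact h.comp (RingHom.FiniteType.of_surjective _
    (ConcreteCategory.bijective_of_isIso (Scheme.ΓSpecIso (CommRingCat.of ℂ)).inv).2)

section Derivations

variable {X : Scheme.{0}} [X.Over SpecC] [IsIntegral X]

/-- The derivation `w` of the function field is regular at `x`: it preserves the local ring. -/
def Preserves (w : Derivation ℂ X.functionField X.functionField) (x : X) : Prop :=
  ∀ f ∈ localRing X x, w f ∈ localRing X x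

@[simp]
theorem lift_dRat (w : Derivation ℂ X.functionField X.functionField) (f : X.functionField) :
    w.liftKaehlerDifferential (dRat X f) = w f :=
  Derivation.liftKaehlerDifferential_comp_D _ _

theorem lift_dlog (w : Derivation ℂ X.functionField X.functionField) (f : X.functionFieldˣ) :
    w.liftKaehlerDifferential (dlog X (Additive.ofMul f)) =
      w (f : X.functionField) / f := by
  change w.liftKaehlerDifferential (((f⁻¹ : X.functionFieldˣ) : X.functionField) •
    dRat X (f : X.functionField)) = _
  rw [map_smul, lift_dRat, Units.val_inv_eq_inv_val, smul_eq_mul, div_eq_inv_mul]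

theorem Preserves.lift_mem {w : Derivation ℂ X.functionField X.functionField} {x : X}
    (hw : Preserves w x) {ω : RatDiff X} (hω : ω ∈ regularAt X x) :
    w.liftKaehlerDifferential ω ∈ localRing X x := by
  induction hω using AddSubgroup.closure_induction with
  | mem _ h =>
    obtain ⟨a, b, rfl⟩ := h
    rw [map_smul, lift_dRat, smul_eq_mul]
    exact mul_mem (algebraMap_mem_localRing a) (hw _ (algebraMap_mem_localRing b))
  | zero => rw [map_zero]; exact zero_mem _
  | add _ _ _ _ h1 h2 => rw [map_add]; exact add_mem h1 h2
  | neg _ _ h => rw [map_neg]; exact neg_mem h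

theorem smul_mem_regularAt {x : X} {f : X.functionField} (hf : f ∈ localRing X x) {ω : RatDiff X}
    (hω : ω ∈ regularAt X x) : f • ω ∈ regularAt X x := by
  obtain ⟨c, rfl⟩ := hf
  induction hω using AddSubgroup.closure_induction with
  | mem _ h =>
    obtain ⟨a, b, rfl⟩ := h
    exact AddSubgroup.subset_closure ⟨c * a, b, by rw [smul_smul, map_mul]⟩
  | zero => rw [smul_zero]; exact zero_mem _
  | add _ _ _ _ h1 h2 => rw [smul_add]; exact add_mem h1 h2
  | neg _ _ h => rw [smul_neg]; exact neg_mem h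

theorem dRat_mem_regularAt {x : X} {f : X.functionField} (hf : f ∈ localRing X x) :
    dRat X f ∈ regularAt X x := by
  obtain ⟨b, rfl⟩ := hf
  exact AddSubgroup.subset_closure ⟨1, b, by rw [map_one, one_smul]⟩

theorem preserves_of_forall {U : X.Opens} [Nonempty U] (hU : IsAffineOpen U) {x : X} (hx : x ∈ U)
    {w : Derivation ℂ X.functionField X.functionField}
    (h : ∀ a : Γ(X, U), w (algebraMap _ X.functionField a) ∈ localRing X x) : Preserves w x := by
  intro f hf
  obtain ⟨a, s, hs, -, rfl⟩ := exists_eq_div hU hx hf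
  rw [Derivation.leibniz_div, smul_eq_mul, smul_eq_mul, smul_eq_mul]
  have ha := algebraMap_section_mem_localRing a hx
  have hs' := algebraMap_section_mem_localRing s hx
  exact mul_mem (pow_mem hs 2) (sub_mem (mul_mem hs' (h a)) (mul_mem ha (h s)))

theorem Extends.preserves {U : X.Opens} [Nonempty U] (hU : IsAffineOpen U)
    {v : Derivation ℂ Γ(X, U) Γ(X, U)} {w : Derivation ℂ X.functionField X.functionField}
    (h : Extends v w) {x : X} (hx : x ∈ U) : Preserves w x :=
  preserves_of_forall hU hx fun a => h a ▸ algebraMap_section_mem_localRing _ hx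

theorem Extends.right_unique {U : X.Opens} [Nonempty U] (hU : IsAffineOpen U)
    {v : Derivation ℂ Γ(X, U) Γ(X, U)} {w w' : Derivation ℂ X.functionField X.functionField}
    (h : Extends v w) (h' : Extends v w') : w = w' := by
  have := functionField_isFractionRing_of_isAffineOpen X U hU
  ext f
  obtain ⟨a, b, -, rfl⟩ := IsFractionRing.div_surjective (A := Γ(X, U)) f
  rw [Derivation.leibniz_div, Derivation.leibniz_div, h, h, h', h']

theorem Extends.add {U : X.Opens} [Nonempty U] {v v' : Derivation ℂ Γ(X, U) Γ(X, U)}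
    {w w' : Derivation ℂ X.functionField X.functionField} (h : Extends v w) (h' : Extends v' w') :
    Extends (v + v') (w + w') := fun f => by
  rw [Derivation.add_apply, Derivation.add_apply, map_add, h, h']

theorem Extends.smul {U : X.Opens} [Nonempty U] {v : Derivation ℂ Γ(X, U) Γ(X, U)}
    {w : Derivation ℂ X.functionField X.functionField} (h : Extends v w) (a : Γ(X, U)) :
    Extends (a • v) (algebraMap _ X.functionField a • w) := fun f => by
  rw [Derivation.smul_apply, Derivation.smul_apply, smul_eq_mul, smul_eq_mul, map_mul, h]

theorem Extends.lie {U : X.Opens} [Nonempty U] {v v' : Derivation ℂ Γ(X, U) Γ(X, U)}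
    {w w' : Derivation ℂ X.functionField X.functionField} (h : Extends v w) (h' : Extends v' w') :
    Extends ⁅v, v'⁆ ⁅w, w'⁆ := fun f => by
  rw [Derivation.commutator_apply, Derivation.commutator_apply, map_sub, h', h, h, h']

theorem Extends.res {U V : X.Opens} [Nonempty U] [Nonempty V] (hVU : V ≤ U)
    {v : Derivation ℂ Γ(X, U) Γ(X, U)} {v' : Derivation ℂ Γ(X, V) Γ(X, V)}
    {w : Derivation ℂ X.functionField X.functionField} (h : Extends v w) (h' : Extends v' w)
    (f : Γ(X, U)) : v' (resFun hVU f) = resFun hVU (v f) := by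
  apply algebraMap_sections_injective V
  rw [← h', algebraMap_resFun, algebraMap_resFun, h]

theorem Extends.of_res {U V : X.Opens} [Nonempty U] [Nonempty V] (hVU : V ≤ U)
    (hU : IsAffineOpen U)
    {v : Derivation ℂ Γ(X, U) Γ(X, U)} {v' : Derivation ℂ Γ(X, V) Γ(X, V)}
    {w w' : Derivation ℂ X.functionField X.functionField} (h : Extends v w) (h' : Extends v' w')
    (hres : ∀ f : Γ(X, U), v' (resFun hVU f) = resFun hVU (v f)) : w = w' := by
  refine h.right_unique hU fun f => ?_
  rw [← algebraMap_resFun hVU, h', hres, algebraMap_resFun]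

theorem exists_extends {U : X.Opens} [Nonempty U] (hU : IsAffineOpen U)
    (v : Derivation ℂ Γ(X, U) Γ(X, U)) :
    ∃ w : Derivation ℂ X.functionField X.functionField, Extends v w := by
  have := functionField_isFractionRing_of_isAffineOpen X U hU
  have : Algebra.FormallyEtale Γ(X, U) X.functionField :=
    Algebra.FormallyEtale.of_isLocalization (nonZeroDivisors Γ(X, U))
  have hb := KaehlerDifferential.isBaseChange_of_formallyEtale ℂ Γ(X, U) X.functionField
  let φ : Ω[X.functionField⁄ℂ] →ₗ[X.functionField] X.functionField :=
    hb.lift ((Algebra.linearMap Γ(X, U) X.functionField).comp v.liftKaehlerDifferential)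
  refine ⟨φ.compDer (KaehlerDifferential.D ℂ X.functionField), fun f => ?_⟩
  have h := hb.lift_eq ((Algebra.linearMap Γ(X, U) X.functionField).comp
    v.liftKaehlerDifferential) (KaehlerDifferential.D ℂ _ f)
  rw [KaehlerDifferential.map_D] at h
  refine h.trans ?_
  rw [LinearMap.comp_apply, Derivation.liftKaehlerDifferential_comp_D, Algebra.linearMap_apply]

theorem lift_smul (c : X.functionField) (w : Derivation ℂ X.functionField X.functionField)
    (ω : RatDiff X) :
    (c • w).liftKaehlerDifferential ω = c * w.liftKaehlerDifferential ω := by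
  have : (c • w).liftKaehlerDifferential = c • w.liftKaehlerDifferential := by
    apply Derivation.liftKaehlerDifferential_unique
    ext f
    simp
  rw [this, LinearMap.smul_apply, smul_eq_mul]

theorem lift_add (w w' : Derivation ℂ X.functionField X.functionField) (ω : RatDiff X) :
    (w + w').liftKaehlerDifferential ω =
      w.liftKaehlerDifferential ω + w'.liftKaehlerDifferential ω := by
  have : (w + w').liftKaehlerDifferential =
      w.liftKaehlerDifferential + w'.liftKaehlerDifferential := by
    apply Derivation.liftKaehlerDifferential_unique
    ext f
    simp
  rw [this, LinearMap.add_apply]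

end Derivations

section SmoothDerivations

variable {X : Scheme.{0}} [X.Over SpecC] [IsIntegral X] [SmoothOfRelativeDimension 1 (X ↘ SpecC)]

theorem exists_derivation_of_preserves {U : X.Opens} [Nonempty U]
    {w : Derivation ℂ X.functionField X.functionField}
    (h : ∀ x ∈ U, x ∈ closedPoints X → Preserves w x) :
    ∃ v : Derivation ℂ Γ(X, U) Γ(X, U), Extends v w := by
  have key (f : Γ(X, U)) : ∃ g : Γ(X, U), algebraMap _ X.functionField g =
      w (algebraMap _ X.functionField f) := exists_section_iff.2 fun x hxU hx =>
    h x hxU hx _ (algebraMap_section_mem_localRing f hxU)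
  choose v hv using key
  have hinj := algebraMap_sections_injective U
  refine ⟨Derivation.mk' ⟨⟨v, fun f g => ?_⟩, fun c f => ?_⟩ fun f g => ?_, fun f => (hv f).symm⟩
  · apply hinj
    rw [map_add, hv, hv, hv, map_add, map_add]
  · apply hinj
    have hc (r : Γ(X, U)) : algebraMap _ X.functionField (c • r) =
        c • algebraMap _ X.functionField r := by
      rw [Algebra.smul_def, map_mul, ← IsScalarTower.algebraMap_apply ℂ, ← Algebra.smul_def]
    rw [RingHom.id_apply, hv, hc, hc, hv]
    exact w.toLinearMap.map_smul c _
  · apply hinj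
    change algebraMap _ _ (v (f * g)) = algebraMap _ _ (f * v g + g * v f)
    rw [hv, map_mul, Derivation.leibniz, map_add, map_mul, map_mul, hv, hv]
    rfl

variable {x : X}

theorem exists_smul_dRat_parameter (hx : x ∈ closedPoints X) {z : X.presheaf.stalk x}
    (hz : Irreducible z) (ω : RatDiff X) :
    ∃ c : X.functionField, ω = c • dRat X (algebraMap _ X.functionField z) := by
  have h1 : (⊤ : Submodule X.functionField (RatDiff X)) ≤
      Submodule.span X.functionField {dRat X (algebraMap _ X.functionField z)} := by
    rw [← KaehlerDifferential.span_range_derivation, Submodule.span_le]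
    rintro _ ⟨f, rfl⟩
    obtain ⟨a, b, -, rfl⟩ := IsFractionRing.div_surjective (A := X.presheaf.stalk x) f
    obtain ⟨c, hc⟩ := exists_dRat_eq_smul hx hz a
    obtain ⟨d, hd⟩ := exists_dRat_eq_smul hx hz b
    rw [SetLike.mem_coe, Derivation.leibniz_div]
    refine Submodule.smul_mem _ _ (sub_mem (Submodule.smul_mem _ _ ?_) (Submodule.smul_mem _ _ ?_))
    · exact Submodule.mem_span_singleton.2 ⟨_, hc.symm⟩
    · exact Submodule.mem_span_singleton.2 ⟨_, hd.symm⟩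
  obtain ⟨c, hc⟩ := Submodule.mem_span_singleton.1 (h1 (Submodule.mem_top (x := ω)))
  exact ⟨c, hc.symm⟩

/-- The derivation `d/dz` at a closed point with local parameter `z`. -/
theorem exists_derivation_parameter (hx : x ∈ closedPoints X) {z : X.presheaf.stalk x}
    (hz : Irreducible z) : ∃ w : Derivation ℂ X.functionField X.functionField,
      Preserves w x ∧ w (algebraMap _ X.functionField z) = 1 := by
  obtain ⟨φ, hφ⟩ := LinearMap.exists_leftInverse_of_injective
    (LinearMap.toSpanSingleton X.functionField (RatDiff X)
      (dRat X (algebraMap _ X.functionField z)))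
    (LinearMap.ker_toSpanSingleton _ (dRat_parameter_ne_zero hx hz))
  have h1 : φ (dRat X (algebraMap _ X.functionField z)) = 1 := by
    have := LinearMap.congr_fun hφ 1
    simpa using this
  refine ⟨φ.compDer (KaehlerDifferential.D ℂ X.functionField), ?_, h1⟩
  rintro _ ⟨a, rfl⟩
  obtain ⟨c, hc⟩ := exists_dRat_eq_smul hx hz a
  change φ (dRat X (algebraMap _ X.functionField a)) ∈ _
  rw [hc, map_smul, h1, smul_eq_mul, mul_one]
  exact algebraMap_mem_localRing c

theorem eq_lift_smul_dRat (hx : x ∈ closedPoints X) {z : X.presheaf.stalk x}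
    (hz : Irreducible z) {w : Derivation ℂ X.functionField X.functionField}
    (hw : w (algebraMap _ X.functionField z) = 1) (ω : RatDiff X) :
    ω = w.liftKaehlerDifferential ω • dRat X (algebraMap _ X.functionField z) := by
  obtain ⟨c, rfl⟩ := exists_smul_dRat_parameter hx hz ω
  rw [map_smul, lift_dRat, hw, smul_eq_mul, mul_one]

theorem mem_regularAt_iff (hx : x ∈ closedPoints X) {z : X.presheaf.stalk x}
    (hz : Irreducible z) {w : Derivation ℂ X.functionField X.functionField} (hwx : Preserves w x)
    (hw : w (algebraMap _ X.functionField z) = 1) {ω : RatDiff X} :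
    ω ∈ regularAt X x ↔ w.liftKaehlerDifferential ω ∈ localRing X x := by
  refine ⟨hwx.lift_mem, fun h => ?_⟩
  rw [eq_lift_smul_dRat hx hz hw ω]
  exact smul_mem_regularAt h (dRat_mem_regularAt (algebraMap_mem_localRing z))

theorem derivation_eq_smul (hx : x ∈ closedPoints X) {z : X.presheaf.stalk x}
    (hz : Irreducible z) {w : Derivation ℂ X.functionField X.functionField}
    (hw : w (algebraMap _ X.functionField z) = 1)
    (w' : Derivation ℂ X.functionField X.functionField) :
    w' = w' (algebraMap _ X.functionField z) • w := by
  ext f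
  rw [← lift_dRat w' f, eq_lift_smul_dRat hx hz hw (dRat X f), map_smul, lift_dRat, lift_dRat,
    Derivation.smul_apply, smul_eq_mul, smul_eq_mul, mul_comm]

variable (X) in
/-- The derivations of the function field form a one-dimensional space, in duality with the
rational differentials. -/
theorem exists_derivation_generator : ∃ w₀ : Derivation ℂ X.functionField X.functionField,
    (∀ w : Derivation ℂ X.functionField X.functionField, ∃ c : X.functionField, w = c • w₀) ∧
    Function.Bijective w₀.liftKaehlerDifferential := by
  obtain ⟨x, -, hx, -⟩ := exists_closedPoint_specializes (U := ⊤) (x := genericPoint X) trivial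
  obtain ⟨z, hz⟩ := exists_parameter hx
  obtain ⟨w, -, hw⟩ := exists_derivation_parameter hx hz
  refine ⟨w, fun w' => ⟨_, derivation_eq_smul hx hz hw w'⟩, fun ω ω' h => ?_, fun c => ?_⟩
  · rw [eq_lift_smul_dRat hx hz hw ω, h, ← eq_lift_smul_dRat hx hz hw ω']
  · exact ⟨c • dRat X (algebraMap _ X.functionField z), by
      rw [map_smul, lift_dRat, hw, smul_eq_mul, mul_one]⟩

/-- Every rational differential on a curve is closed. -/
theorem lift_lie (w w' : Derivation ℂ X.functionField X.functionField) (ω : RatDiff X) :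
    ⁅w, w'⁆.liftKaehlerDifferential ω =
      w (w'.liftKaehlerDifferential ω) - w' (w.liftKaehlerDifferential ω) := by
  obtain ⟨w₀, h, -⟩ := exists_derivation_generator X
  obtain ⟨a, rfl⟩ := h w
  obtain ⟨b, rfl⟩ := h w'
  have h1 : ⁅a • w₀, b • w₀⁆ = (a * w₀ b - b * w₀ a) • w₀ := by
    ext f
    simp only [Derivation.commutator_apply, Derivation.smul_apply, smul_eq_mul, Derivation.leibniz]
    ring
  rw [h1]
  simp only [lift_smul, Derivation.smul_apply, smul_eq_mul, Derivation.leibniz]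
  ring

/-- A derivation that is regular at `x` is a vector field on a neighbourhood of `x`. -/
theorem Preserves.exists_extends {w : Derivation ℂ X.functionField X.functionField}
    (hw : Preserves w x) {W : X.Opens} (hxW : x ∈ W) :
    ∃ (U : X.affineOpens) (_ : x ∈ U.1) (_ : U.1 ≤ W) (_ : Nonempty U.1)
      (v : Derivation ℂ Γ(X, U.1) Γ(X, U.1)), Extends v w := by
  obtain ⟨_, ⟨V, hV, rfl⟩, hxV, hVW⟩ :=
    X.isBasis_affineOpens.exists_subset_of_mem_open hxW W.isOpen
  have : Nonempty V := ⟨⟨x, hxV⟩⟩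
  obtain ⟨S, hS⟩ := (finiteType_sections hV).out
  choose Ub hxb hne sb hsb using fun b : Γ(X, V) => exists_section_of_mem_localRing
    (hw _ (algebraMap_section_mem_localRing b hxV))
  have hmem : x ∈ (V ⊓ S.inf Ub : X.Opens) := by
    refine ⟨hxV, ?_⟩
    have : ∀ T : Finset Γ(X, V), x ∈ T.inf Ub := by
      intro T
      induction T using Finset.cons_induction with
      | empty => simp
      | cons a s ha ih => rw [Finset.inf_cons]; exact ⟨hxb a, ih⟩
    exact this S
  obtain ⟨_, ⟨U, hU, rfl⟩, hxU, hUV⟩ :=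
    X.isBasis_affineOpens.exists_subset_of_mem_open hmem (V ⊓ S.inf Ub : X.Opens).isOpen
  have hUV' : U ≤ V := fun y hy => (hUV hy).1
  have : Nonempty U := ⟨⟨x, hxU⟩⟩
  refine ⟨⟨U, hU⟩, hxU, fun y hy => hVW (hUV' hy), this, ?_⟩
  refine exists_derivation_of_preserves fun y hy _ => preserves_of_forall hV (hUV' hy) fun a => ?_
  have ha : a ∈ Algebra.adjoin ℂ (S : Set Γ(X, V)) := hS ▸ Algebra.mem_top
  induction ha using Algebra.adjoin_induction with
  | mem b hb =>
    have hyb : y ∈ Ub b := (Finset.inf_le (f := Ub) hb : S.inf Ub ≤ Ub b) (hUV hy).2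
    rw [← hsb b]
    exact algebraMap_section_mem_localRing _ hyb
  | algebraMap c =>
    rw [← IsScalarTower.algebraMap_apply ℂ, Derivation.map_algebraMap]
    exact zero_mem _
  | add f g _ _ h1 h2 => rw [map_add, map_add]; exact add_mem h1 h2
  | mul f g _ _ h1 h2 =>
    rw [map_mul, Derivation.leibniz, smul_eq_mul, smul_eq_mul]
    exact add_mem (mul_mem (algebraMap_section_mem_localRing _ (hUV' hy)) h2)
      (mul_mem (algebraMap_section_mem_localRing _ (hUV' hy)) h1)

end SmoothDerivations

/-! ### Residues -/

section Residues

variable {X : Scheme.{0}} [X.Over SpecC] [IsIntegral X]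

theorem dlog_eq (f : X.functionFieldˣ) :
    dlog X (Additive.ofMul f) = (f : X.functionField)⁻¹ • dRat X (f : X.functionField) := by
  rw [← Units.val_inv_eq_inv_val]
  rfl

theorem dlog_mul (f g : X.functionFieldˣ) :
    dlog X (Additive.ofMul (f * g)) = dlog X (Additive.ofMul f) + dlog X (Additive.ofMul g) := by
  rw [ofMul_mul, map_add]

theorem dlog_mem_regularAt {x : X} {f : X.functionFieldˣ}
    (h1 : (f : X.functionField) ∈ localRing X x)
    (h2 : (f : X.functionField)⁻¹ ∈ localRing X x) :
    dlog X (Additive.ofMul f) ∈ regularAt X x := by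
  rw [dlog_eq]
  exact smul_mem_regularAt h2 (dRat_mem_regularAt h1)

theorem const_mem_localRing (x : X) (c : ℂ) : algebraMap ℂ X.functionField c ∈ localRing X x := by
  rw [IsScalarTower.algebraMap_apply ℂ (X.presheaf.stalk x)]
  exact algebraMap_mem_localRing _

theorem complex_smul_mem_regularAt {x : X} (c : ℂ) {ω : RatDiff X} (hω : ω ∈ regularAt X x) :
    c • ω ∈ regularAt X x := by
  rw [← algebraMap_smul X.functionField c ω]
  exact smul_mem_regularAt (const_mem_localRing x c) hω

theorem IsResidueAt.hasAtMostSimplePoleAt {x : X} {ω : RatDiff X} {c : ℂ}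
    (h : IsResidueAt X x ω c) : HasAtMostSimplePoleAt X x ω := by
  intro z hz
  have h1 := smul_mem_regularAt (algebraMap_mem_localRing z) (h z hz)
  rw [smul_sub, smul_comm _ c, smul_smul, mul_inv_cancel₀ (parameter_ne_zero hz), one_smul] at h1
  have h2 := add_mem h1 (complex_smul_mem_regularAt c
    (dRat_mem_regularAt (algebraMap_mem_localRing z)))
  rwa [sub_add_cancel] at h2

theorem IsResidueAt.add {x : X} {ω ω' : RatDiff X} {c c' : ℂ} (h : IsResidueAt X x ω c)
    (h' : IsResidueAt X x ω' c') : IsResidueAt X x (ω + ω') (c + c') := fun z hz => by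
  have := add_mem (h z hz) (h' z hz)
  rw [add_smul]
  convert this using 1
  abel

theorem IsResidueAt.neg {x : X} {ω : RatDiff X} {c : ℂ} (h : IsResidueAt X x ω c) :
    IsResidueAt X x (-ω) (-c) := fun z hz => by
  have := neg_mem (h z hz)
  rw [neg_smul]
  convert this using 1
  abel

theorem mem_thirdKindInt_iff {ω : RatDiff X} :
    ω ∈ thirdKindInt X ↔ ∀ x ∈ closedPoints X, ∃ n : ℤ, IsResidueAt X x ω n := by
  refine ⟨fun h => h.2, fun h => ⟨fun x hx => ?_, h⟩⟩
  obtain ⟨n, hn⟩ := h x hx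
  exact hn.hasAtMostSimplePoleAt

variable [SmoothOfRelativeDimension 1 (X ↘ SpecC)]
variable {x : X}

/-- Near a zero or pole, `df / f = ord(f) dz / z + (regular)`. -/
theorem dlog_sub_mem_regularAt (hx : x ∈ closedPoints X) {z : X.presheaf.stalk x}
    (hz : Irreducible z) (f : X.functionFieldˣ) :
    dlog X (Additive.ofMul f) - (Scheme.ord (f : X.functionField) x : ℂ) •
      ((algebraMap _ X.functionField z)⁻¹ • dRat X (algebraMap _ X.functionField z)) ∈
        regularAt X x := by
  obtain ⟨u, hu⟩ := exists_eq_unit_mul_zpow hx hz f.ne_zero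
  set n := Scheme.ord (f : X.functionField) x
  set ζ : X.functionFieldˣ := Units.mk0 _ (parameter_ne_zero hz)
  set υ : X.functionFieldˣ := Units.map (algebraMap _ X.functionField).toMonoidHom u
  have hf : f = υ * ζ ^ n := Units.ext (by rw [hu, Units.val_mul, Units.val_zpow_eq_zpow_val]; rfl)
  have hζ : dlog X (Additive.ofMul ζ) =
      (algebraMap _ X.functionField z)⁻¹ • dRat X (algebraMap _ X.functionField z) := dlog_eq ζ
  rw [hf, dlog_mul, ofMul_zpow, map_zsmul, hζ, Int.cast_smul_eq_zsmul, add_sub_cancel_right]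
  refine dlog_mem_regularAt (algebraMap_mem_localRing _) ?_
  rw [← Units.val_inv_eq_inv_val, ← map_inv]
  exact algebraMap_mem_localRing _

theorem parameter_dlog_sub_mem_regularAt (hx : x ∈ closedPoints X) {z z' : X.presheaf.stalk x}
    (hz : Irreducible z) (hz' : Irreducible z') :
    (algebraMap _ X.functionField z')⁻¹ • dRat X (algebraMap _ X.functionField z') -
      (algebraMap _ X.functionField z)⁻¹ • dRat X (algebraMap _ X.functionField z) ∈
        regularAt X x := by
  have h := dlog_sub_mem_regularAt hx hz (Units.mk0 _ (parameter_ne_zero hz'))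
  rw [dlog_eq, Units.val_mk0, ord_parameter hx hz', Int.cast_one, one_smul] at h
  exact h

theorem isResidueAt_of_exists (hx : x ∈ closedPoints X) {z : X.presheaf.stalk x}
    (hz : Irreducible z) {ω : RatDiff X} {c : ℂ}
    (h : ω - c • ((algebraMap _ X.functionField z)⁻¹ • dRat X (algebraMap _ X.functionField z)) ∈
      regularAt X x) : IsResidueAt X x ω c := by
  intro z' hz'
  have h1 := sub_mem h
    (complex_smul_mem_regularAt c (parameter_dlog_sub_mem_regularAt hx hz hz'))
  rw [smul_sub] at h1
  convert h1 using 1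
  abel

theorem isResidueAt_zero_iff (hx : x ∈ closedPoints X) {ω : RatDiff X} :
    IsResidueAt X x ω 0 ↔ ω ∈ regularAt X x := by
  obtain ⟨z, hz⟩ := exists_parameter hx
  refine ⟨fun h => by simpa using h z hz, fun h z _ => by simpa using h⟩

theorem IsResidueAt.unique (hx : x ∈ closedPoints X) {ω : RatDiff X} {c c' : ℂ}
    (h : IsResidueAt X x ω c) (h' : IsResidueAt X x ω c') : c = c' := by
  obtain ⟨z, hz⟩ := exists_parameter hx
  obtain ⟨w, hwx, hw⟩ := exists_derivation_parameter hx hz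
  have h1 := hwx.lift_mem (h.add h'.neg z hz)
  rw [add_neg_cancel, zero_sub, map_neg, neg_mem_iff, ← algebraMap_smul X.functionField,
    map_smul, map_smul, lift_dRat, hw, smul_eq_mul, smul_eq_mul, mul_one] at h1
  by_contra hne
  have hd : c + -c' ≠ 0 := by rwa [← sub_eq_add_neg, sub_ne_zero]
  -- a nonzero constant times `z⁻¹` is not regular at `x`
  have h2 := mul_mem (const_mem_localRing x (c + -c')⁻¹) h1
  rw [← mul_assoc, ← map_mul, inv_mul_cancel₀ hd, map_one, one_mul, mem_localRing_iff hx,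
    ord_inv (parameter_ne_zero hz), ord_parameter hx hz, inv_eq_zero] at h2
  rcases h2 with h2 | h2
  · exact parameter_ne_zero hz h2
  · lia

theorem isResidueAt_dlog (hx : x ∈ closedPoints X) (f : X.functionFieldˣ) :
    IsResidueAt X x (dlog X (Additive.ofMul f)) (Scheme.ord (f : X.functionField) x : ℤ) :=
  fun _ hz => dlog_sub_mem_regularAt hx hz f

theorem regularDiff_le_thirdKindInt : regularDiff X ≤ thirdKindInt X := fun ω hω =>
  mem_thirdKindInt_iff.2 fun x hx => ⟨0, by
    rw [Int.cast_zero, isResidueAt_zero_iff hx]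
    exact mem_regularDiff_iff.1 hω x hx⟩

theorem dlogRange_le_thirdKindInt : dlogRange X ≤ thirdKindInt X := by
  rintro _ ⟨f, rfl⟩
  exact mem_thirdKindInt_iff.2 fun x hx => ⟨_, isResidueAt_dlog hx f.toMul⟩

theorem one_le_ord_of_mem_maximalIdeal (hx : x ∈ closedPoints X) {a : X.presheaf.stalk x}
    (ha : a ∈ IsLocalRing.maximalIdeal (X.presheaf.stalk x)) :
    algebraMap _ X.functionField a = 0 ∨ 1 ≤ Scheme.ord (algebraMap _ X.functionField a) x := by
  have := isDiscreteValuationRing_stalk hx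
  obtain ⟨z, hz⟩ := exists_parameter hx
  rw [(IsDiscreteValuationRing.irreducible_iff_uniformizer z).1 hz,
    Ideal.mem_span_singleton] at ha
  obtain ⟨b, rfl⟩ := ha
  rw [← ord_parameter hx hz, le_ord_iff_div_mem hx (parameter_ne_zero hz), map_mul,
    mul_div_cancel_left₀ _ (parameter_ne_zero hz)]
  exact algebraMap_mem_localRing b

theorem smul_dlog_mem_regularAt (hx : x ∈ closedPoints X) {g : X.functionField}
    (hg : g = 0 ∨ 1 ≤ Scheme.ord g x) (f : X.functionFieldˣ) :
    g • dlog X (Additive.ofMul f) ∈ regularAt X x := by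
  obtain ⟨z, hz⟩ := exists_parameter hx
  have hz0 := parameter_ne_zero hz
  have hg1 : g / algebraMap _ X.functionField z ∈ localRing X x := by
    rwa [← le_ord_iff_div_mem hx hz0, ord_parameter hx hz]
  have hg2 : g ∈ localRing X x := by
    have := mul_mem hg1 (algebraMap_mem_localRing z)
    rwa [div_mul_cancel₀ _ hz0] at this
  have h1 := smul_mem_regularAt hg2 (dlog_sub_mem_regularAt hx hz f)
  have h2 := complex_smul_mem_regularAt (Scheme.ord (f : X.functionField) x : ℂ)
    (smul_mem_regularAt hg1 (dRat_mem_regularAt (algebraMap_mem_localRing z)))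
  rw [smul_sub, smul_comm g, smul_smul g, ← div_eq_mul_inv] at h1
  simpa using add_mem h1 h2

variable [QuasiCompact (X ↘ SpecC)]

theorem finite_not_mem_regularAt (ω : RatDiff X) :
    {x : closedPoints X | ω ∉ regularAt X x.1}.Finite := by
  have hloc (f : X.functionField) : {x : closedPoints X | f ∉ localRing X x.1}.Finite := by
    by_cases hf : f = 0
    · simp [hf, zero_mem]
    · refine (finite_ord_ne_zero hf).subset fun x hx h => hx ?_
      exact (mem_localRing_iff x.2).2 (Or.inr h.ge)
  have hω : ω ∈ Submodule.span X.functionField (Set.range (dRat X)) := by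
    rw [KaehlerDifferential.span_range_derivation]
    trivial
  induction hω using Submodule.span_induction with
  | mem _ h =>
    obtain ⟨f, rfl⟩ := h
    exact (hloc f).subset fun x hx h => hx (dRat_mem_regularAt h)
  | zero => simp [zero_mem]
  | add _ _ _ _ h1 h2 =>
    refine (h1.union h2).subset fun x hx => ?_
    by_contra hcon
    rw [Set.mem_union, not_or, Set.mem_ofPred_eq, Set.mem_ofPred_eq, not_not, not_not] at hcon
    exact hx (add_mem hcon.1 hcon.2)
  | smul f _ _ h =>
    refine ((hloc f).union h).subset fun x hx => ?_
    by_contra hcon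
    rw [Set.mem_union, not_or, Set.mem_ofPred_eq, Set.mem_ofPred_eq, not_not, not_not] at hcon
    exact hx (smul_mem_regularAt hcon.1 hcon.2)

theorem exists_residueDivisor (ω : thirdKindInt X) :
    ∃ D : Div X, ∀ x : closedPoints X, IsResidueAt X x.1 ω (D x : ℤ) := by
  choose n hn using fun x : closedPoints X => mem_thirdKindInt_iff.1 ω.2 x.1 x.2
  refine ⟨Finsupp.ofSupportFinite n ((finite_not_mem_regularAt (ω : RatDiff X)).subset ?_), hn⟩
  intro x hx h
  have h1 := (hn x).unique x.2 ((isResidueAt_zero_iff x.2).2 h)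
  exact hx (by exact_mod_cast h1)

variable (X) in
/-- The residue homomorphism `ω ↦ ∑ (res_x ω) x`. -/
def residueDiv : thirdKindInt X →+ Div X where
  toFun ω := (exists_residueDivisor ω).choose
  map_zero' := by
    ext x
    have h1 := (exists_residueDivisor (0 : thirdKindInt X)).choose_spec x
    have h2 := h1.unique x.2 ((isResidueAt_zero_iff x.2).2 (zero_mem _))
    exact_mod_cast h2
  map_add' ω ω' := by
    ext x
    have h1 := (exists_residueDivisor (ω + ω')).choose_spec x
    have h2 := h1.unique x.2 (((exists_residueDivisor ω).choose_spec x).add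
      ((exists_residueDivisor ω').choose_spec x))
    exact_mod_cast h2

theorem isResidueAt_residueDiv (ω : thirdKindInt X) (x : closedPoints X) :
    IsResidueAt X x.1 ω (residueDiv X ω x : ℤ) :=
  (exists_residueDivisor ω).choose_spec x

theorem residueDiv_eq_of_isResidueAt {ω : thirdKindInt X} {x : closedPoints X} {n : ℤ}
    (h : IsResidueAt X x.1 ω n) : residueDiv X ω x = n := by
  exact_mod_cast (isResidueAt_residueDiv ω x).unique x.2 h

theorem residueDiv_dlog {f : X.functionFieldˣ} {ω : thirdKindInt X}
    (h : (ω : RatDiff X) = dlog X (Additive.ofMul f)) : residueDiv X ω = principalDiv f := by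
  ext x
  exact residueDiv_eq_of_isResidueAt (h ▸ isResidueAt_dlog x.2 f)

theorem residueDiv_eq_zero_iff (ω : thirdKindInt X) :
    residueDiv X ω = 0 ↔ (ω : RatDiff X) ∈ regularDiff X := by
  rw [mem_regularDiff_iff]
  constructor
  · intro h x hx
    rw [← isResidueAt_zero_iff hx]
    have := isResidueAt_residueDiv ω ⟨x, hx⟩
    rwa [h, Finsupp.zero_apply, Int.cast_zero] at this
  · intro h
    ext x
    apply residueDiv_eq_of_isResidueAt
    rw [Finsupp.zero_apply, Int.cast_zero, isResidueAt_zero_iff x.2]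
    exact h x.1 x.2

/-- On an affine curve there is a differential of the third kind whose only pole is a given point.
It is a constant multiple of `h dlog a`, where `a` is a global function with a simple zero at `x`
and `h` is a global function that vanishes at the other zeros of `a` but not at `x`. -/
theorem exists_residueDiv_eq_single [IsAffine X] (x : closedPoints X) :
    ∃ ω : thirdKindInt X, residueDiv X ω = Finsupp.single x 1 := by
  have : Nonempty (⊤ : X.Opens) := ⟨⟨x.1, trivial⟩⟩
  obtain ⟨z, hz⟩ := exists_parameter x.2
  obtain ⟨a, s, hs1, hs0, has⟩ := exists_eq_div (isAffineOpen_top X) (x := x.1) trivial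
    (algebraMap_mem_localRing z)
  have ha0 : algebraMap _ X.functionField a ≠ 0 := by
    intro h
    rw [h, zero_div] at has
    exact parameter_ne_zero hz has
  have hax : Scheme.ord (algebraMap _ X.functionField a) x.1 = 1 := by
    have h1 := (mem_localRing_iff x.2).1 hs1
    have h2 := (mem_localRing_iff x.2).1 (algebraMap_section_mem_localRing s (x := x.1) trivial)
    rw [ord_inv hs0, inv_eq_zero] at h1
    simp only [hs0, false_or] at h1 h2
    have h3 := ord_parameter x.2 hz
    rw [has, div_eq_mul_inv, Scheme.ord_mul ha0 (inv_ne_zero hs0), ord_inv hs0] at h3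
    lia
  set f : X.functionFieldˣ := Units.mk0 _ ha0
  obtain ⟨W, hW⟩ := exists_opens_compl
    ({y : closedPoints X | Scheme.ord (f : X.functionField) y.1 ≠ 0} \ {x})
    ((finite_ord_ne_zero f.ne_zero).subset Set.sdiff_subset)
  have hxW : x.1 ∈ W := (hW _).2 fun y hy h => hy.2 (Subtype.ext h.symm)
  obtain ⟨h, hhW, hxh⟩ := (isAffineOpen_top X).exists_basicOpen_le ⟨x.1, hxW⟩ trivial
  rw [Scheme.mem_basicOpen _ _ _ (show x.1 ∈ (⊤ : X.Opens) from trivial)] at hxh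
  have hgerm (y : X) := algebraMap_germ (U := ⊤) (x := y) trivial h
  -- `h` vanishes at the zeros of `a` other than `x`
  have hy (y : closedPoints X) (hyx : y ≠ x) : algebraMap _ X.functionField h •
      dlog X (Additive.ofMul f) ∈ regularAt X y.1 := by
    by_cases hord : Scheme.ord (f : X.functionField) y.1 = 0
    · refine smul_mem_regularAt (algebraMap_section_mem_localRing h trivial)
        (dlog_mem_regularAt ?_ ?_)
      · exact (mem_localRing_iff y.2).2 (Or.inr hord.ge)
      · exact (mem_localRing_iff y.2).2 (Or.inr (by rw [ord_inv f.ne_zero, hord, neg_zero]))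
    · refine smul_dlog_mem_regularAt y.2 ?_ f
      rw [← hgerm]
      refine one_le_ord_of_mem_maximalIdeal y.2 ((IsLocalRing.mem_maximalIdeal _).2 fun hu => ?_)
      have hyW := hhW ((Scheme.mem_basicOpen _ _ _ (show y.1 ∈ (⊤ : X.Opens) from trivial)).2 hu)
      exact (hW _).1 hyW y ⟨hord, hyx⟩ rfl
  obtain ⟨c, hc⟩ := algebraMap_residueField_surjective x.2
    (IsLocalRing.residue _ (X.presheaf.germ ⊤ x.1 trivial h))
  have hc0 : c ≠ 0 := by
    rintro rfl
    rw [map_zero, eq_comm, IsLocalRing.residue_eq_zero_iff] at hc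
    exact (IsLocalRing.mem_maximalIdeal _).1 hc hxh
  have hm : X.presheaf.germ ⊤ x.1 trivial h - algebraMap ℂ _ c ∈
      IsLocalRing.maximalIdeal (X.presheaf.stalk x.1) := by
    rw [← IsLocalRing.residue_eq_zero_iff, map_sub, ← hc, sub_eq_zero]
    rfl
  have hreg := smul_dlog_mem_regularAt x.2 (one_le_ord_of_mem_maximalIdeal x.2 hm) f
  rw [map_sub, hgerm, sub_smul, ← IsScalarTower.algebraMap_apply,
    algebraMap_smul X.functionField c] at hreg
  set η := algebraMap _ X.functionField h • dlog X (Additive.ofMul f) with hη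
  have hres : IsResidueAt X x.1 (c⁻¹ • η) (1 : ℤ) := by
    refine isResidueAt_of_exists x.2 hz ?_
    have h1 := complex_smul_mem_regularAt c⁻¹ hreg
    rw [smul_sub, inv_smul_smul₀ hc0] at h1
    have h2 := dlog_sub_mem_regularAt x.2 hz f
    rw [Units.val_mk0, hax] at h2
    simpa using add_mem h1 h2
  have hres' (y : closedPoints X) (hyx : y ≠ x) : IsResidueAt X y.1 (c⁻¹ • η) (0 : ℤ) := by
    rw [Int.cast_zero, isResidueAt_zero_iff y.2]
    exact complex_smul_mem_regularAt _ (hy y hyx)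
  have hmem : c⁻¹ • η ∈ thirdKindInt X := mem_thirdKindInt_iff.2 fun y hyc => by
    by_cases hyx : (⟨y, hyc⟩ : closedPoints X) = x
    · subst hyx
      exact ⟨1, hres⟩
    · exact ⟨0, hres' ⟨y, hyc⟩ hyx⟩
  refine ⟨⟨_, hmem⟩, ?_⟩
  ext y
  by_cases hyx : y = x
  · subst hyx
    rw [Finsupp.single_eq_same]
    exact residueDiv_eq_of_isResidueAt hres
  · rw [Finsupp.single_eq_of_ne hyx]
    exact residueDiv_eq_of_isResidueAt (hres' y hyx)

theorem residueDiv_surjective [IsAffine X] : Function.Surjective (residueDiv X) := by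
  intro D
  induction D using Finsupp.induction_linear with
  | zero => exact ⟨0, map_zero _⟩
  | add D D' h h' =>
    obtain ⟨ω, rfl⟩ := h
    obtain ⟨ω', rfl⟩ := h'
    exact ⟨ω + ω', map_add _ _ _⟩
  | single x n =>
    obtain ⟨ω, hω⟩ := exists_residueDiv_eq_single x
    exact ⟨n • ω, by rw [map_zsmul, hω, Finsupp.smul_single, smul_eq_mul, mul_one]⟩

end Residues

/-! ### Sheaves of fractional ideals -/

section RatSheaf

variable {X : Scheme.{0}} [IsIntegral X]

/-- The rational functions that lie in `M x` at all points `x` of `U`. They are encoded as constant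
functions on `U` with values in the function field, so that there is only one over `U = ∅`. -/
def ratSections (M : ∀ x : X, Submodule (X.presheaf.stalk x) X.functionField) (U : X.Opens) :
    AddSubgroup (U → X.functionField) where
  carrier := {s | (∀ y y', s y = s y') ∧ ∀ y, s y ∈ M y.1}
  zero_mem' := ⟨fun _ _ => rfl, fun _ => zero_mem _⟩
  add_mem' ha hb := ⟨fun y y' => congrArg₂ (· + ·) (ha.1 y y') (hb.1 y y'),
    fun y => add_mem (ha.2 y) (hb.2 y)⟩
  neg_mem' ha := ⟨fun y y' => congrArg (- ·) (ha.1 y y'), fun y => neg_mem (ha.2 y)⟩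

variable (M : ∀ x : X, Submodule (X.presheaf.stalk x) X.functionField)

theorem germ_smul_eq {U : X.Opens} [Nonempty U] {x : X} (hx : x ∈ U) (f : Γ(X, U))
    (g : X.functionField) :
    X.presheaf.germ U x hx f • g = algebraMap Γ(X, U) X.functionField f * g := by
  rw [Algebra.smul_def, algebraMap_germ]

instance ratSectionsModule (U : X.Opens) : Module Γ(X, U) (ratSections M U) where
  smul f s := ⟨fun y => X.presheaf.germ U y.1 y.2 f • s.1 y, fun y y' => by
      have : Nonempty U := ⟨y⟩
      change X.presheaf.germ U y.1 y.2 f • s.1 y = X.presheaf.germ U y'.1 y'.2 f • s.1 y'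
      rw [germ_smul_eq, germ_smul_eq, s.2.1 y y'],
    fun y => Submodule.smul_mem _ _ (s.2.2 y)⟩
  one_smul s := Subtype.ext <| funext fun y => by
    change X.presheaf.germ U y.1 y.2 1 • s.1 y = _
    rw [map_one, one_smul]
  mul_smul f g s := Subtype.ext <| funext fun y => by
    change X.presheaf.germ U y.1 y.2 (f * g) • s.1 y = _
    rw [map_mul, mul_smul]
    rfl
  smul_zero f := Subtype.ext <| funext fun y => smul_zero _
  smul_add f s t := Subtype.ext <| funext fun y => smul_add _ _ _
  add_smul f g s := Subtype.ext <| funext fun y => by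
    change X.presheaf.germ U y.1 y.2 (f + g) • s.1 y = _
    rw [map_add, add_smul]
    rfl
  zero_smul s := Subtype.ext <| funext fun y => by
    change X.presheaf.germ U y.1 y.2 0 • s.1 y = _
    rw [map_zero, zero_smul]
    rfl

/-- The presheaf of abelian groups underlying `ratSheaf`. -/
def ratPresheaf : TopCat.Presheaf Ab X where
  obj U := AddCommGrpCat.of (ratSections M U.unop)
  map {U V} i := AddCommGrpCat.ofHom
    { toFun := fun s => ⟨fun y => s.1 ⟨y.1, i.unop.le y.2⟩,
        fun _ _ => s.2.1 _ _, fun y => s.2.2 ⟨y.1, i.unop.le y.2⟩⟩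
      map_zero' := rfl
      map_add' := fun _ _ => rfl }

theorem ratPresheaf_isSheaf : (ratPresheaf M).IsSheaf := by
  rw [TopCat.Presheaf.isSheaf_iff_isSheafUniqueGluing]
  intro ι U sf hsf
  have hval (i j : ι) (y : U i) (y' : U j) : (sf i).1 y = (sf j).1 y' := by
    have hi : Nonempty (U i) := ⟨y⟩
    have hj : Nonempty (U j) := ⟨y'⟩
    have hg : genericPoint X ∈ (U i ⊓ U j : X.Opens) := ⟨genericPoint_mem _, genericPoint_mem _⟩
    have h1 := congrFun (congrArg Subtype.val (hsf i j)) ⟨genericPoint X, hg⟩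
    exact ((sf i).2.1 _ _).trans (h1.trans ((sf j).2.1 _ _))
  have hmem (y : (iSup U : X.Opens)) : ∃ i, y.1 ∈ U i := Opens.mem_iSup.1 y.2
  choose k hk using hmem
  refine ⟨⟨fun y => (sf (k y)).1 ⟨y.1, hk y⟩, fun y y' => hval _ _ _ _,
    fun y => (sf (k y)).2.2 ⟨y.1, hk y⟩⟩, fun i => ?_, fun t ht => ?_⟩
  · exact Subtype.ext <| funext fun y => hval _ _ _ _
  · refine Subtype.ext <| funext fun y => ?_
    exact congrFun (congrArg Subtype.val (ht (k y))) ⟨y.1, hk y⟩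

instance ratPresheafModule (U : (Opens X)ᵒᵖ) :
    Module (X.ringCatSheaf.obj.obj U) ((ratPresheaf M).obj U) := ratSectionsModule M U.unop

/-- The sheaf of modules of the rational functions that lie in `M x` at each point `x`. -/
def ratSheaf : X.Modules where
  val := PresheafOfModules.ofPresheaf (R := X.ringCatSheaf.obj) (ratPresheaf M)
    (fun {U V} i f s => Subtype.ext <| funext fun y => by
      exact congrArg (fun r : X.presheaf.stalk y.1 => r • s.1 ⟨y.1, i.unop.le y.2⟩)
        (X.presheaf.germ_res_apply i.unop y.1 y.2 f).symm)
  isSheaf := ratPresheaf_isSheaf M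

variable {M}

theorem exists_ratSheaf_section {U : X.Opens} {f : X.functionField} (hf : ∀ x ∈ U, f ∈ M x) :
    ∃ s : Γ(ratSheaf M, U), ∀ y, (show ratSections M U from s).1 y = f :=
  ⟨(⟨fun _ => f, fun _ _ => rfl, fun y => hf y.1 y.2⟩ : ratSections M U), fun _ => rfl⟩

variable (M) in
/-- The rational function underlying a section of `ratSheaf M`. -/
def ratSheafToRat (U : X.Opens) [Nonempty U] :
    Γ(ratSheaf M, U) →ₗ[Γ(X, U)] X.functionField where
  toFun s := (show ratSections M U from s).1 ⟨genericPoint X, genericPoint_mem U⟩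
  map_add' _ _ := rfl
  map_smul' f s := (germ_smul_eq (genericPoint_mem U) f
    ((show ratSections M U from s).1 ⟨genericPoint X, genericPoint_mem U⟩)).trans
      (Algebra.smul_def f _).symm

theorem ratSheafToRat_apply {U : X.Opens} [Nonempty U] (s : Γ(ratSheaf M, U)) (y : U) :
    (show ratSections M U from s).1 y = ratSheafToRat M U s :=
  (show ratSections M U from s).2.1 _ _

theorem ratSheafToRat_res {U V : X.Opens} [Nonempty U] [Nonempty V] (h : V ≤ U)
    (s : Γ(ratSheaf M, U)) :
    ratSheafToRat M V (restr (ratSheaf M) h s) = ratSheafToRat M U s := rfl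

theorem ratSheafToRat_injective (U : X.Opens) [Nonempty U] :
    Function.Injective (ratSheafToRat M U) := by
  intro s t h
  refine Subtype.ext (p := fun s => s ∈ ratSections M U) (funext fun y => ?_)
  exact (ratSheafToRat_apply s y).trans (h.trans (ratSheafToRat_apply t y).symm)

theorem mem_range_ratSheafToRat {U : X.Opens} [Nonempty U] {f : X.functionField} :
    f ∈ Set.range (ratSheafToRat M U) ↔ ∀ x ∈ U, f ∈ M x := by
  constructor
  · rintro ⟨s, rfl⟩ x hx
    rw [← ratSheafToRat_apply s ⟨x, hx⟩]
    exact (show ratSections M U from s).2.2 ⟨x, hx⟩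
  · intro h
    obtain ⟨s, hs⟩ := exists_ratSheaf_section h
    exact ⟨s, hs _⟩

end RatSheaf

/-! ### Sections and frames of sheaves of modules -/

section Modules

variable {X : Scheme.{0}} {L M : X.Modules}

theorem restr_restr {U V W : X.Opens} (h : V ≤ U) (h' : W ≤ V) (s : Γ(L, U)) :
    restr L h' (restr L h s) = restr L (h'.trans h) s := by
  simp only [restr]
  rw [← ConcreteCategory.comp_apply, ← L.presheaf.map_comp]
  rfl

theorem restr_self {U : X.Opens} (h : U ≤ U) (s : Γ(L, U)) : restr L h s = s := by
  have : (homOfLE h).op = 𝟙 (Opposite.op U) := rfl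
  rw [restr, this, L.presheaf.map_id]
  rfl

theorem restr_smul {U V : X.Opens} (h : V ≤ U) (f : Γ(X, U)) (s : Γ(L, U)) :
    restr L h (f • s) = resFun h f • restr L h s :=
  Scheme.Modules.map_smul L (homOfLE h) f s

theorem restr_zero {U V : X.Opens} (h : V ≤ U) : restr L h (0 : Γ(L, U)) = 0 := map_zero _

theorem restr_add {U V : X.Opens} (h : V ≤ U) (s t : Γ(L, U)) :
    restr L h (s + t) = restr L h s + restr L h t := map_add _ _ _

theorem subsingleton_sections {X : Scheme.{0}} (U : X.Opens) (hU : ¬ Nonempty U) :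
    Subsingleton Γ(X, U) := by
  have : U = ⊥ := by
    ext x
    exact ⟨fun hx => (hU ⟨⟨x, hx⟩⟩).elim, fun hx => hx.elim⟩
  subst this
  infer_instance

theorem subsingleton_moduleSections (L : X.Modules) (U : X.Opens) (hU : ¬ Nonempty U) :
    Subsingleton Γ(L, U) :=
  haveI := subsingleton_sections U hU
  Module.subsingleton Γ(X, U) _

/-- Sections that agree locally are equal. -/
theorem section_ext {U : X.Opens} {s t : Γ(L, U)}
    (h : ∀ x ∈ U, ∃ (V : X.Opens) (_ : x ∈ V) (hV : V ≤ U), restr L hV s = restr L hV t) :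
    s = t := by
  choose V hxV hVU hV using fun x : U => h x.1 x.2
  exact TopCat.Sheaf.eq_of_locally_eq' ⟨L.presheaf, L.isSheaf⟩ V U (fun x => homOfLE (hVU x))
    (fun x hx => Opens.mem_iSup.2 ⟨⟨x, hx⟩, hxV ⟨x, hx⟩⟩) s t hV

/-- Linear maps on sections that are compatible with restriction form a morphism. -/
theorem exists_hom (f : ∀ U : X.Opens, Γ(L, U) →ₗ[Γ(X, U)] Γ(M, U))
    (hf : ∀ (U V : X.Opens) (h : V ≤ U) (s : Γ(L, U)),
      f V (restr L h s) = restr M h (f U s)) :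
    ∃ φ : L ⟶ M, ∀ (U : X.Opens) (s : Γ(L, U)), φ.app U s = f U s := by
  let φ : L.presheaf ⟶ M.presheaf :=
    { app := fun U => AddCommGrpCat.ofHom (f U.unop).toAddMonoidHom
      naturality := fun U V i => by
        ext s
        exact hf U.unop V.unop i.unop.le s }
  exact ⟨⟨PresheafOfModules.homMk φ fun U r s => (f U.unop).map_smul r s⟩, fun U s => rfl⟩

theorem IsFrame.restr {U V : X.Opens} (h : V ≤ U) {e : Γ(L, U)} (he : IsFrame L e) :
    IsFrame L (restr L h e) := fun W hW => by
  have := he W (hW.trans h)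
  simp only [restr_restr]
  exact this

theorem IsFrame.smul_injective {U : X.Opens} {e : Γ(L, U)} (he : IsFrame L e) {a b : Γ(X, U)}
    (h : a • e = b • e) : a = b :=
  (he U le_rfl).1 (by simpa only [restr_self] using h)

theorem IsFrame.exists_smul_eq {U V : X.Opens} {e : Γ(L, U)} (he : IsFrame L e) (h : V ≤ U)
    (s : Γ(L, V)) : ∃ a : Γ(X, V), a • FlatPic.restr L h e = s :=
  (he V h).2 s

/-- Criterion for frames of a subsheaf of the constant sheaf of rational functions, embedded by `t`:
every section is a regular multiple of `e`. -/
theorem isFrame_of_range [IsIntegral X]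
    (t : ∀ (V : X.Opens) [Nonempty V], Γ(L, V) →ₗ[Γ(X, V)] X.functionField)
    (tinj : ∀ (V : X.Opens) [Nonempty V], Function.Injective (t V))
    {U : X.Opens} {e : Γ(L, U)} {g : X.functionField} (hg : g ≠ 0)
    (he : ∀ (V : X.Opens) [Nonempty V] (h : V ≤ U), t V (restr L h e) = g)
    (hrange : ∀ (V : X.Opens) [Nonempty V], V ≤ U → ∀ s : Γ(L, V),
      ∃ a : Γ(X, V), algebraMap _ X.functionField a = t V s / g) : IsFrame L e := by
  intro V hVU
  by_cases hV : Nonempty V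
  · constructor
    · intro a b hab
      apply algebraMap_sections_injective V
      have h1 := congrArg (t V) hab
      simp only [map_smul, he, Algebra.smul_def] at h1
      exact mul_right_cancel₀ hg h1
    · intro s
      obtain ⟨a, ha⟩ := hrange V hVU s
      refine ⟨a, tinj V ?_⟩
      change t V (a • restr L hVU e) = _
      rw [map_smul, he, Algebra.smul_def, ha, div_mul_cancel₀ _ hg]
  · have := subsingleton_sections V hV
    have := subsingleton_moduleSections L V hV
    exact ⟨fun _ _ _ => Subsingleton.elim _ _, fun s => ⟨0, Subsingleton.elim _ _⟩⟩

end Modules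

/-! ### The line bundle of a divisor -/

section SheafOfDivisor

variable {X : Scheme.{0}} [X.Over SpecC] [IsIntegral X] [SmoothOfRelativeDimension 1 (X ↘ SpecC)]

/-- The rational functions `f` with `ν_x(f) ≥ -n_x`; no condition if `x` is not closed. -/
def divSubmodule (D : Div X) (x : X) : Submodule (X.presheaf.stalk x) X.functionField where
  carrier := {f | ∀ hx : x ∈ closedPoints X, f = 0 ∨ -D ⟨x, hx⟩ ≤ Scheme.ord f x}
  zero_mem' _ := Or.inl rfl
  add_mem' {f g} hf hg hx := by
    have := isDiscreteValuationRing_stalk hx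
    by_cases hfg : f + g = 0
    · exact Or.inl hfg
    rcases hf hx with rfl | hf
    · simpa using hg hx
    rcases hg hx with rfl | hg
    · simpa using Or.inr hf
    exact Or.inr ((le_min hf hg).trans (Scheme.ord_add hfg))
  smul_mem' a f hf hx := by
    rw [Algebra.smul_def]
    rcases hf hx with rfl | hf
    · exact Or.inl (mul_zero _)
    by_cases hf0 : f = 0
    · exact Or.inl (by rw [hf0, mul_zero])
    rcases (mem_localRing_iff hx).1 (algebraMap_mem_localRing a) with ha | ha
    · exact Or.inl (by rw [ha, zero_mul])
    by_cases ha0 : algebraMap _ X.functionField a = 0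
    · exact Or.inl (by rw [ha0, zero_mul])
    right
    rw [Scheme.ord_mul ha0 hf0]
    lia

variable [QuasiCompact (X ↘ SpecC)]

/-- Every divisor is principal on a neighbourhood of each point. -/
theorem exists_local_equation (D : Div X) (x : X) : ∃ (U : X.Opens) (_ : x ∈ U)
    (g : X.functionField), g ≠ 0 ∧
      ∀ y ∈ U, ∀ hy : y ∈ closedPoints X, Scheme.ord g y = -D ⟨y, hy⟩ := by
  obtain ⟨g, hg, hgx⟩ : ∃ g : X.functionField, g ≠ 0 ∧
      ∀ hx : x ∈ closedPoints X, Scheme.ord g x = -D ⟨x, hx⟩ := by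
    by_cases hx : x ∈ closedPoints X
    · obtain ⟨z, hz⟩ := exists_parameter hx
      exact ⟨_, zpow_ne_zero (-D ⟨x, hx⟩) (parameter_ne_zero hz), fun _ => by
        rw [ord_zpow (parameter_ne_zero hz), ord_parameter hx hz, mul_one]⟩
    · exact ⟨1, one_ne_zero, fun h => (hx h).elim⟩
  obtain ⟨U, hU⟩ := exists_opens_compl
    {y : closedPoints X | Scheme.ord g y.1 ≠ -D y} (by
      refine ((finite_ord_ne_zero hg).union D.support.finite_toSet).subset fun y hy => ?_
      by_contra hcon
      rw [Set.mem_union, not_or, Set.mem_ofPred_eq, not_not, Finset.mem_coe] at hcon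
      refine hy ?_
      rw [hcon.1, Finsupp.notMem_support_iff.1 hcon.2, neg_zero])
  refine ⟨U, (hU x).2 fun y hy hxy => ?_, g, hg, fun y hyU hy => ?_⟩
  · subst hxy
    exact hy (hgx y.2)
  · by_contra hcon
    exact (hU y).1 hyU ⟨y, hy⟩ hcon rfl

theorem isLineBundle_divSheaf (D : Div X) : IsLineBundle (ratSheaf (divSubmodule D)) := by
  intro x
  obtain ⟨U, hxU, g, hg, hgU⟩ := exists_local_equation D x
  obtain ⟨e, he⟩ := exists_ratSheaf_section (M := divSubmodule D) (U := U) (f := g)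
    (fun y hyU hy => Or.inr (hgU y hyU hy).ge)
  refine ⟨U, hxU, e, isFrame_of_range (fun V _ => ratSheafToRat _ V)
    (fun V _ => ratSheafToRat_injective V) hg (fun V _ _ => he _)
    fun V _ hVU s => exists_section_iff.2 fun y hyV hy => ?_⟩
  rw [← le_ord_iff_div_mem hy hg, hgU y (hVU hyV) hy]
  exact mem_range_ratSheafToRat.1 ⟨s, rfl⟩ y hyV hy

/-- The line bundle `𝒪(D)`. -/
def divBundle (D : Div X) : LineBundle X := ⟨ratSheaf (divSubmodule D), isLineBundle_divSheaf D⟩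

/-- The tautological rational trivialization of `𝒪(D)`. -/
def divTriv (D : Div X) : RatTriv (divBundle D) where
  toRat U _ := ratSheafToRat (divSubmodule D) U
  toRat_res h s := ratSheafToRat_res h s
  toRat_injective U _ := ratSheafToRat_injective U

theorem hasDivisor_divTriv (D : Div X) : (divTriv D).HasDivisor D := by
  intro U _ f
  refine mem_range_ratSheafToRat.trans ⟨fun h => ?_, fun h x hxU hx => ?_⟩
  · by_cases hf : f = 0
    · exact Or.inl hf
    · exact Or.inr fun x hxU => (h x.1 hxU x.2).resolve_left hf
  · exact h.imp_right fun h => h ⟨x, hx⟩ hxU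

end SheafOfDivisor

/-! ### Rational trivializations of line bundles -/

section RatTriv

variable {X : Scheme.{0}} [IsIntegral X] {L M : LineBundle X}

theorem LineBundle.exists_frame (L : LineBundle X) : ∃ (U : X.Opens) (_ : Nonempty U)
    (e : Γ(L.sheaf, U)), IsFrame L.sheaf e := by
  obtain ⟨U, hU, e, he⟩ := L.isLineBundle (genericPoint X)
  exact ⟨U, ⟨⟨_, hU⟩⟩, e, he⟩

theorem RatTriv.toRat_smul (τ : RatTriv L) {U : X.Opens} [Nonempty U] (a : Γ(X, U))
    (s : Γ(L.sheaf, U)) :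
    τ.toRat U (a • s) = algebraMap _ X.functionField a * τ.toRat U s := by
  rw [map_smul, Algebra.smul_def]

theorem RatTriv.toRat_frame_ne_zero (τ : RatTriv L) {U : X.Opens} [Nonempty U]
    {e : Γ(L.sheaf, U)} (he : IsFrame L.sheaf e) : τ.toRat U e ≠ 0 := by
  intro h
  have h1 : e = 0 := τ.toRat_injective U (by rw [h, map_zero])
  have h2 : (1 : Γ(X, U)) = 0 := he.smul_injective (by rw [h1, smul_zero, smul_zero])
  exact one_ne_zero h2

theorem eq_zero_of_restr_eq_zero (L : LineBundle X) {U V : X.Opens} [Nonempty V] (h : V ≤ U)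
    {s : Γ(L.sheaf, U)} (hs : restr L.sheaf h s = 0) : s = 0 := by
  apply section_ext
  intro x hx
  obtain ⟨W, hxW, e, he⟩ := L.isLineBundle x
  have : Nonempty W := ⟨⟨x, hxW⟩⟩
  have : Nonempty U := ⟨⟨x, hx⟩⟩
  have h1 : Nonempty (U ⊓ W : X.Opens) := nonempty_inf U W
  have h2 : Nonempty (V ⊓ (U ⊓ W) : X.Opens) := nonempty_inf V (U ⊓ W)
  obtain ⟨a, ha⟩ := he.exists_smul_eq (inf_le_right : U ⊓ W ≤ W) (restr L.sheaf inf_le_left s)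
  have h3 := congrArg (restr L.sheaf (inf_le_right : V ⊓ (U ⊓ W) ≤ U ⊓ W)) ha
  rw [restr_smul, restr_restr,
    restr_restr, ← restr_restr h (inf_le_left : V ⊓ (U ⊓ W) ≤ V), hs, restr_zero] at h3
  have h4 : resFun (inf_le_right : V ⊓ (U ⊓ W) ≤ U ⊓ W) a = 0 :=
    (he.restr (inf_le_right.trans inf_le_right)).smul_injective (h3.trans (zero_smul _ _).symm)
  have h5 : a = 0 := by
    apply algebraMap_sections_injective
    rw [← algebraMap_resFun (inf_le_right : V ⊓ (U ⊓ W) ≤ U ⊓ W), h4, map_zero, map_zero]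
  exact ⟨U ⊓ W, ⟨hx, hxW⟩, inf_le_left, by rw [← ha, h5, zero_smul, restr_zero]⟩

/-- A frame over a nonempty open set determines a rational trivialization, in which the frame may
be given any nonzero value. -/
theorem exists_ratTriv {U₀ : X.Opens} [Nonempty U₀] {e : Γ(L.sheaf, U₀)}
    (he : IsFrame L.sheaf e) {g : X.functionField} (hg : g ≠ 0) :
    ∃ τ : RatTriv L, τ.toRat U₀ e = g := by
  have hne (U : X.Opens) [Nonempty U] : Nonempty (U ⊓ U₀ : X.Opens) := nonempty_inf U U₀
  choose c hc using fun (U : X.Opens) (s : Γ(L.sheaf, U)) =>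
    he.exists_smul_eq (inf_le_right : U ⊓ U₀ ≤ U₀) (restr L.sheaf inf_le_left s)
  have huniq (U : X.Opens) (s : Γ(L.sheaf, U)) (a : Γ(X, U ⊓ U₀))
      (ha : a • restr L.sheaf inf_le_right e = restr L.sheaf inf_le_left s) : c U s = a :=
    (he.restr inf_le_right).smul_injective ((hc U s).trans ha.symm)
  let t (U : X.Opens) [Nonempty U] : Γ(L.sheaf, U) →ₗ[Γ(X, U)] X.functionField :=
    { toFun := fun s =>
        haveI := hne U
        algebraMap Γ(X, U ⊓ U₀) X.functionField (c U s) * g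
      map_add' := fun s s' => by
        have := hne U
        rw [huniq U (s + s') (c U s + c U s') (by rw [add_smul, hc, hc, restr_add]),
          map_add, add_mul]
      map_smul' := fun a s => by
        have := hne U
        rw [huniq U (a • s) (resFun inf_le_left a * c U s) (by rw [mul_smul, hc, restr_smul]),
          map_mul, algebraMap_resFun, RingHom.id_apply, Algebra.smul_def, mul_assoc] }
  refine ⟨⟨fun U _ => t U, fun {U V} _ _ h s => ?_, fun U _ => ?_⟩, ?_⟩
  · have := hne U
    have := hne V
    have h1 : V ⊓ U₀ ≤ U ⊓ U₀ := inf_le_inf_right _ h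
    have h2 := huniq V (restr L.sheaf h s) (resFun h1 (c U s)) (by
      have := congrArg (restr L.sheaf h1) (hc U s)
      rw [restr_smul, restr_restr, restr_restr] at this
      rw [this, restr_restr])
    change algebraMap _ _ (c V _) * g = algebraMap _ _ (c U _) * g
    rw [h2, algebraMap_resFun]
  · rw [injective_iff_map_eq_zero]
    intro s hs
    have := hne U
    have h1 : c U s = 0 := by
      apply algebraMap_sections_injective
      rw [map_zero]
      exact (mul_eq_zero.1 hs).resolve_right hg
    have h2 := hc U s
    rw [h1, zero_smul] at h2
    exact eq_zero_of_restr_eq_zero L inf_le_left h2.symm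
  · have := hne U₀
    change algebraMap _ _ (c U₀ e) * g = g
    rw [huniq U₀ e 1 (one_smul _ _), map_one, one_mul]

variable (L) in
theorem exists_ratTriv_lineBundle : Nonempty (RatTriv L) := by
  obtain ⟨U, _, e, he⟩ := L.exists_frame
  obtain ⟨τ, -⟩ := exists_ratTriv he one_ne_zero
  exact ⟨τ⟩

theorem RatTriv.eq_mul_of_frame (τ σ : RatTriv L) {U₀ : X.Opens} [Nonempty U₀]
    {e : Γ(L.sheaf, U₀)} (he : IsFrame L.sheaf e) {h : X.functionField}
    (hh : τ.toRat U₀ e = h * σ.toRat U₀ e) (U : X.Opens) [Nonempty U] (s : Γ(L.sheaf, U)) :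
    τ.toRat U s = h * σ.toRat U s := by
  have : Nonempty (U ⊓ U₀ : X.Opens) := nonempty_inf U U₀
  obtain ⟨a, ha⟩ := he.exists_smul_eq (inf_le_right : U ⊓ U₀ ≤ U₀) (restr L.sheaf inf_le_left s)
  have key (ρ : RatTriv L) : ρ.toRat U s = algebraMap _ X.functionField a * ρ.toRat U₀ e := by
    rw [← ρ.toRat_res (inf_le_left : U ⊓ U₀ ≤ U) s, ← ha, ρ.toRat_smul, ρ.toRat_res]
  rw [key τ, key σ, hh]
  ring

/-- A rational trivialization multiplied by a rational function. -/
def RatTriv.scale (τ : RatTriv L) (h : X.functionFieldˣ) : RatTriv L where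
  toRat U _ := (LinearMap.mulLeft Γ(X, U) (h : X.functionField)).comp (τ.toRat U)
  toRat_res hV s := by
    simp only [LinearMap.comp_apply]
    rw [τ.toRat_res]
    rfl
  toRat_injective U _ := by
    refine Function.Injective.comp (g := fun f => (h : X.functionField) * f) ?_
      (τ.toRat_injective U)
    exact mul_right_injective₀ h.ne_zero

theorem RatTriv.scale_toRat (τ : RatTriv L) (h : X.functionFieldˣ) (U : X.Opens) [Nonempty U]
    (s : Γ(L.sheaf, U)) : (τ.scale h).toRat U s = h * τ.toRat U s := rfl

theorem RatTriv.ext_toRat {τ σ : RatTriv L}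
    (h : ∀ (U : X.Opens) [Nonempty U] (s : Γ(L.sheaf, U)), τ.toRat U s = σ.toRat U s) : τ = σ := by
  rcases τ with ⟨t, _, _⟩
  rcases σ with ⟨t', _, _⟩
  obtain rfl : @t = @t' := by
    funext U hU
    exact LinearMap.ext fun s => h U s
  rfl

/-- Any two rational trivializations are proportional. -/
theorem RatTriv.exists_eq_scale (τ σ : RatTriv L) : ∃ h : X.functionFieldˣ, τ = σ.scale h := by
  obtain ⟨U₀, _, e, he⟩ := L.exists_frame
  have h1 := τ.toRat_frame_ne_zero he
  have h2 := σ.toRat_frame_ne_zero he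
  exact ⟨Units.mk0 _ (div_ne_zero h1 h2), RatTriv.ext_toRat fun U _ s =>
    τ.eq_mul_of_frame σ he (div_mul_cancel₀ _ h2).symm U s⟩

/-- Pull back of a rational trivialization along an isomorphism. -/
def RatTriv.ofIso (σ : RatTriv M) (φ : L.sheaf ≅ M.sheaf) : RatTriv L where
  toRat U _ :=
    { toFun := fun s => σ.toRat U (φ.hom.app U s)
      map_add' := fun s t => by rw [map_add, map_add]
      map_smul' := fun a s => by rw [Scheme.Modules.Hom.app_smul, map_smul]; rfl }
  toRat_res {U V} _ _ h s := by
    have h1 := ConcreteCategory.congr_hom (φ.hom.mapPresheaf.naturality (homOfLE h).op) s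
    change σ.toRat V (φ.hom.app V (restr L.sheaf h s)) = σ.toRat U (φ.hom.app U s)
    rw [← σ.toRat_res h]
    exact congrArg _ h1
  toRat_injective U _ := by
    exact fun s t hst =>
      (ConcreteCategory.bijective_of_isIso (φ.hom.app U)).1 (σ.toRat_injective U hst)

theorem RatTriv.ofIso_toRat (σ : RatTriv M) (φ : L.sheaf ≅ M.sheaf) (U : X.Opens) [Nonempty U]
    (s : Γ(L.sheaf, U)) : (σ.ofIso φ).toRat U s = σ.toRat U (φ.hom.app U s) := rfl

theorem RatTriv.range_ofIso (σ : RatTriv M) (φ : L.sheaf ≅ M.sheaf) (U : X.Opens) [Nonempty U] :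
    Set.range ((σ.ofIso φ).toRat U) = Set.range (σ.toRat U) :=
  (ConcreteCategory.bijective_of_isIso (φ.hom.app U)).2.range_comp (σ.toRat U)

theorem RatTriv.exists_hom_of_range_le (τ : RatTriv L) (σ : RatTriv M)
    (h : ∀ (U : X.Opens) [Nonempty U], Set.range (τ.toRat U) ⊆ Set.range (σ.toRat U)) :
    ∃ φ : L.sheaf ⟶ M.sheaf, ∀ (U : X.Opens) [Nonempty U] (s : Γ(L.sheaf, U)),
      σ.toRat U (φ.app U s) = τ.toRat U s := by
  have key (U : X.Opens) : ∃ f : Γ(L.sheaf, U) →ₗ[Γ(X, U)] Γ(M.sheaf, U),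
      ∀ [Nonempty U] (s : Γ(L.sheaf, U)), σ.toRat U (f s) = τ.toRat U s := by
    by_cases hU : Nonempty U
    · choose f hf using fun s : Γ(L.sheaf, U) => h U ⟨s, rfl⟩
      refine ⟨⟨⟨f, fun s t => ?_⟩, fun a s => ?_⟩, fun s => hf s⟩
      · apply σ.toRat_injective U
        rw [map_add, hf, hf, hf, map_add]
      · apply σ.toRat_injective U
        rw [map_smul]
        change σ.toRat U (f (a • s)) = a • σ.toRat U (f s)
        rw [hf, hf, map_smul]
    · exact ⟨0, (hU ‹_›).elim⟩
  choose f hf using key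
  obtain ⟨φ, hφ⟩ := exists_hom f (fun U V hVU s => by
    by_cases hV : Nonempty V
    · have hU : Nonempty U := hV.map fun x => ⟨x.1, hVU x.2⟩
      apply σ.toRat_injective V
      rw [hf, σ.toRat_res, hf, τ.toRat_res]
    · have := subsingleton_moduleSections M.sheaf V hV
      exact Subsingleton.elim _ _)
  exact ⟨φ, fun U _ s => by rw [hφ, hf]⟩

theorem RatTriv.exists_iso_of_range_eq (τ : RatTriv L) (σ : RatTriv M)
    (h : ∀ (U : X.Opens) [Nonempty U], Set.range (τ.toRat U) = Set.range (σ.toRat U)) :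
    ∃ φ : L.sheaf ≅ M.sheaf, ∀ (U : X.Opens) [Nonempty U] (s : Γ(L.sheaf, U)),
      σ.toRat U (φ.hom.app U s) = τ.toRat U s := by
  obtain ⟨φ, hφ⟩ := τ.exists_hom_of_range_le σ fun U _ => (h U).le
  obtain ⟨ψ, hψ⟩ := σ.exists_hom_of_range_le τ fun U _ => (h U).ge
  refine ⟨⟨φ, ψ, ?_, ?_⟩, hφ⟩
  · ext U s
    by_cases hU : Nonempty U
    · apply τ.toRat_injective U
      exact (hψ U _).trans (hφ U s)
    · have := subsingleton_moduleSections L.sheaf U hU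
      exact Subsingleton.elim _ _
  · ext U s
    by_cases hU : Nonempty U
    · apply σ.toRat_injective U
      exact (hφ U _).trans (hψ U s)
    · have := subsingleton_moduleSections M.sheaf U hU
      exact Subsingleton.elim _ _

theorem RatTriv.mem_range_of_local (τ : RatTriv L) {U : X.Opens} [Nonempty U]
    {f : X.functionField} (h : ∀ x ∈ U, ∃ (V : X.Opens) (_ : x ∈ V) (_ : Nonempty V) (_ : V ≤ U),
      f ∈ Set.range (τ.toRat V)) : f ∈ Set.range (τ.toRat U) := by
  choose V hxV hV hVU s hs using fun x : U => h x.1 x.2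
  obtain ⟨t, ht, -⟩ := TopCat.Sheaf.existsUnique_gluing' ⟨L.sheaf.presheaf, L.sheaf.isSheaf⟩ V U
    (fun x => homOfLE (hVU x)) (fun x hx => Opens.mem_iSup.2 ⟨⟨x, hx⟩, hxV ⟨x, hx⟩⟩) s (by
      intro x y
      have := nonempty_inf (V x) (V y)
      apply τ.toRat_injective (V x ⊓ V y)
      exact ((τ.toRat_res inf_le_left _).trans (hs x)).trans
        ((τ.toRat_res inf_le_right _).trans (hs y)).symm)
  let x : U := ⟨genericPoint X, genericPoint_mem U⟩
  exact ⟨t, by rw [← hs x, ← ht x]; exact (τ.toRat_res (hVU x) t).symm⟩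

end RatTriv

/-! ### The divisor of a rational trivialization -/

theorem exists_common_frames {X : Scheme.{0}} (L M : LineBundle X) (x : X) :
    ∃ (W : X.Opens) (_ : x ∈ W) (e : Γ(L.sheaf, W)) (f : Γ(M.sheaf, W)),
      IsFrame L.sheaf e ∧ IsFrame M.sheaf f := by
  obtain ⟨U, hxU, e, he⟩ := L.isLineBundle x
  obtain ⟨V, hxV, f, hf⟩ := M.isLineBundle x
  exact ⟨U ⊓ V, ⟨hxU, hxV⟩, _, _, he.restr inf_le_left, hf.restr inf_le_right⟩

/-- Rational trivializations of the factors of a tensor product induce one of the product. -/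
theorem TensorPairing.exists_ratTriv {X : Scheme.{0}} [IsIntegral X] {L M N : LineBundle X}
    (b : TensorPairing L M N) (τ : RatTriv L) (σ : RatTriv M) :
    ∃ ρ : RatTriv N, ∀ (U : X.Opens) [Nonempty U] (s : Γ(L.sheaf, U)) (t : Γ(M.sheaf, U)),
      ρ.toRat U (b.pair U s t) = τ.toRat U s * σ.toRat U t := by
  obtain ⟨W, hW, e, f, he, hf⟩ := exists_common_frames L M (genericPoint X)
  have : Nonempty W := ⟨⟨_, hW⟩⟩
  obtain ⟨ρ, hρ⟩ := FlatPic.exists_ratTriv (b.isFrame_pair e f he hf)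
    (mul_ne_zero (τ.toRat_frame_ne_zero he) (σ.toRat_frame_ne_zero hf))
  refine ⟨ρ, fun U' _ s t => ?_⟩
  have := nonempty_inf U' W
  obtain ⟨a, ha⟩ := he.exists_smul_eq (inf_le_right : U' ⊓ W ≤ W) (restr L.sheaf inf_le_left s)
  obtain ⟨c, hc⟩ := hf.exists_smul_eq (inf_le_right : U' ⊓ W ≤ W) (restr M.sheaf inf_le_left t)
  rw [← ρ.toRat_res (inf_le_left : U' ⊓ W ≤ U'), ← b.pair_res, ← ha, ← hc,
    LinearMap.map_smul₂, ρ.toRat_smul, (b.pair _ _).map_smul, ρ.toRat_smul, b.pair_res,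
    ρ.toRat_res, hρ, ← τ.toRat_res (inf_le_left : U' ⊓ W ≤ U') s,
    ← σ.toRat_res (inf_le_left : U' ⊓ W ≤ U') t,
    ← ha, ← hc, τ.toRat_smul, σ.toRat_smul, τ.toRat_res, σ.toRat_res]
  ring

section RatTrivDivisor

variable {X : Scheme.{0}} [X.Over SpecC] [IsIntegral X] [SmoothOfRelativeDimension 1 (X ↘ SpecC)]
  {L M N : LineBundle X}

/-- Over the domain of a frame `e`, the image of `τ` consists of the rational functions whose order
is nowhere less than that of `τ e`. -/
theorem RatTriv.mem_range_iff_of_frame (τ : RatTriv L) {U V : X.Opens} [Nonempty U] [Nonempty V]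
    (h : V ≤ U) {e : Γ(L.sheaf, U)} (he : IsFrame L.sheaf e) {f : X.functionField} :
    f ∈ Set.range (τ.toRat V) ↔ ∀ x ∈ V, x ∈ closedPoints X →
      f = 0 ∨ Scheme.ord (τ.toRat U e) x ≤ Scheme.ord f x := by
  have h0 := τ.toRat_frame_ne_zero he
  have key : f ∈ Set.range (τ.toRat V) ↔
      ∃ a : Γ(X, V), algebraMap _ X.functionField a = f / τ.toRat U e := by
    constructor
    · rintro ⟨s, rfl⟩
      obtain ⟨a, rfl⟩ := he.exists_smul_eq h s
      exact ⟨a, by rw [τ.toRat_smul, τ.toRat_res, mul_div_cancel_right₀ _ h0]⟩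
    · rintro ⟨a, ha⟩
      exact ⟨a • restr L.sheaf h e, by rw [τ.toRat_smul, τ.toRat_res, ha, div_mul_cancel₀ _ h0]⟩
  rw [key, exists_section_iff]
  exact forall₃_congr fun x _ hx => (le_ord_iff_div_mem hx h0).symm

theorem RatTriv.ord_frame_le (τ : RatTriv L) {U V : X.Opens} [Nonempty U] [Nonempty V]
    {e : Γ(L.sheaf, U)} (he : IsFrame L.sheaf e) {s : Γ(L.sheaf, V)} (hs : τ.toRat V s ≠ 0)
    {x : X} (hxU : x ∈ U) (hxV : x ∈ V) (hx : x ∈ closedPoints X) :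
    Scheme.ord (τ.toRat U e) x ≤ Scheme.ord (τ.toRat V s) x := by
  have := nonempty_inf U V
  refine ((τ.mem_range_iff_of_frame (inf_le_left : U ⊓ V ≤ U) he).1
    ⟨restr L.sheaf inf_le_right s, rfl⟩ x ⟨hxU, hxV⟩ hx).elim (fun h => (hs ?_).elim) fun h => ?_
  · rwa [τ.toRat_res] at h
  · rwa [τ.toRat_res] at h

theorem RatTriv.HasDivisor.isFrame {τ : RatTriv L} {D : Div X} (hD : τ.HasDivisor D)
    {U : X.Opens} [Nonempty U] {e : Γ(L.sheaf, U)} (h0 : τ.toRat U e ≠ 0)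
    (he : ∀ x : closedPoints X, x.1 ∈ U → Scheme.ord (τ.toRat U e) x.1 = -D x) :
    IsFrame L.sheaf e := by
  refine isFrame_of_range (fun V _ => τ.toRat V) (fun V _ => τ.toRat_injective V) h0
    (fun V _ h => τ.toRat_res h e) fun V _ h s => exists_section_iff.2 fun x hxV hx => ?_
  rw [← le_ord_iff_div_mem hx h0, he ⟨x, hx⟩ (h hxV)]
  exact ((hD V _).1 ⟨s, rfl⟩).imp_right fun h => h ⟨x, hx⟩ hxV

theorem RatTriv.HasDivisor.scale {τ : RatTriv L} {D D' : Div X} (hD : τ.HasDivisor D)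
    {h : X.functionFieldˣ}
    (hD' : ∀ x : closedPoints X, D' x = D x - Scheme.ord (h : X.functionField) x.1) :
    (τ.scale h).HasDivisor D' := by
  intro U _ f
  have h1 : f ∈ Set.range ((τ.scale h).toRat U) ↔ f / h ∈ Set.range (τ.toRat U) := by
    constructor
    · rintro ⟨s, rfl⟩
      exact ⟨s, by rw [τ.scale_toRat, mul_div_cancel_left₀ _ h.ne_zero]⟩
    · rintro ⟨s, hs⟩
      exact ⟨s, by rw [τ.scale_toRat, hs, mul_div_cancel₀ _ h.ne_zero]⟩
  rw [h1, hD U]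
  by_cases hf : f = 0
  · simp [hf]
  · simp only [hf, div_eq_zero_iff, h.ne_zero, or_self, false_or]
    refine forall₂_congr fun x _ => ?_
    rw [div_eq_mul_inv, Scheme.ord_mul hf (inv_ne_zero h.ne_zero), ord_inv h.ne_zero, hD']
    lia

theorem RatTriv.HasDivisor.ofIso {σ : RatTriv M} {D : Div X} (hD : σ.HasDivisor D)
    (φ : L.sheaf ≅ M.sheaf) : (σ.ofIso φ).HasDivisor D := by
  intro U _ f
  rw [σ.range_ofIso]
  exact hD U f

theorem RatTriv.HasDivisor.exists_iso {τ : RatTriv L} {σ : RatTriv M} {D : Div X}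
    (hτ : τ.HasDivisor D) (hσ : σ.HasDivisor D) :
    ∃ φ : L.sheaf ≅ M.sheaf, ∀ (U : X.Opens) [Nonempty U] (s : Γ(L.sheaf, U)),
      σ.toRat U (φ.hom.app U s) = τ.toRat U s :=
  τ.exists_iso_of_range_eq σ fun U _ => Set.ext fun f => (hτ U f).trans (hσ U f).symm

variable [QuasiCompact (X ↘ SpecC)]

theorem RatTriv.HasDivisor.ord_frame {τ : RatTriv L} {D : Div X} (hD : τ.HasDivisor D)
    {U : X.Opens} [Nonempty U] {e : Γ(L.sheaf, U)} (he : IsFrame L.sheaf e) (x : closedPoints X)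
    (hxU : x.1 ∈ U) : Scheme.ord (τ.toRat U e) x.1 = -D x := by
  apply le_antisymm
  · obtain ⟨W, hxW, g, hg, hgW⟩ := exists_local_equation D x.1
    have : Nonempty W := ⟨⟨_, hxW⟩⟩
    obtain ⟨s, rfl⟩ := (hD W g).2 (Or.inr fun y hyW => (hgW y.1 hyW y.2).ge)
    exact (τ.ord_frame_le he hg hxU hxW x.2).trans (hgW x.1 hxW x.2).le
  · exact ((hD U _).1 ⟨e, rfl⟩).resolve_left (τ.toRat_frame_ne_zero he) x hxU

/-- Every rational trivialization identifies the line bundle with some `𝒪(D)`: the coefficients of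
`D` are minus the orders of local frames. -/
theorem RatTriv.exists_hasDivisor (τ : RatTriv L) : ∃ D : Div X, τ.HasDivisor D := by
  choose U hxU e he using L.isLineBundle
  have hne (x : X) : Nonempty (U x) := ⟨⟨x, hxU x⟩⟩
  have hord (x : X) {V : X.Opens} [Nonempty V] {f : Γ(L.sheaf, V)} (hf : IsFrame L.sheaf f)
      (hxV : x ∈ V) (hx : x ∈ closedPoints X) :
      Scheme.ord (τ.toRat _ (e x)) x = Scheme.ord (τ.toRat V f) x :=
    le_antisymm (τ.ord_frame_le (he x) (τ.toRat_frame_ne_zero hf) (hxU x) hxV hx)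
      (τ.ord_frame_le hf (τ.toRat_frame_ne_zero (he x)) hxV (hxU x) hx)
  let η := genericPoint X
  refine ⟨Finsupp.ofSupportFinite (fun x => -Scheme.ord (τ.toRat _ (e x.1)) x.1) ?_, ?_⟩
  · refine ((finite_closedPoints_not_mem (U η)).union
      (finite_ord_ne_zero (τ.toRat_frame_ne_zero (he η)))).subset fun x hx => ?_
    by_cases hxη : x.1 ∈ U η
    · right
      intro h
      refine hx ?_
      change -Scheme.ord _ _ = 0
      rw [hord x.1 (he η) hxη x.2, h, neg_zero]
    · exact Or.inl hxη
  · intro V _ f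
    change _ ↔ f = 0 ∨ ∀ x : closedPoints X, x.1 ∈ V →
      - -Scheme.ord (τ.toRat _ (e x.1)) x.1 ≤ Scheme.ord f x.1
    simp only [neg_neg]
    constructor
    · rintro ⟨s, rfl⟩
      by_cases hs : τ.toRat V s = 0
      · exact Or.inl hs
      · exact Or.inr fun x hxV => τ.ord_frame_le (he x.1) hs (hxU x.1) hxV x.2
    · intro hf
      refine τ.mem_range_of_local fun x hxV => ?_
      have := nonempty_inf V (U x)
      refine ⟨V ⊓ U x, ⟨hxV, hxU x⟩, this, inf_le_left,
        (τ.mem_range_iff_of_frame inf_le_right (he x)).2 fun y hy hyc => ?_⟩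
      refine hf.imp_right fun h => ?_
      rw [← hord y (he x) hy.2 hyc]
      exact h ⟨y, hyc⟩ hy.1

theorem RatTriv.HasDivisor.unique {τ : RatTriv L} {D D' : Div X} (hD : τ.HasDivisor D)
    (hD' : τ.HasDivisor D') : D = D' := by
  ext x
  obtain ⟨U, hxU, e, he⟩ := L.isLineBundle x.1
  have : Nonempty U := ⟨⟨_, hxU⟩⟩
  have := (hD.ord_frame he x hxU).symm.trans (hD'.ord_frame he x hxU)
  lia

theorem RatTriv.HasDivisor.exists_eq_sub {τ σ : RatTriv L} {D D' : Div X} (hD : τ.HasDivisor D)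
    (hD' : σ.HasDivisor D') : ∃ h : X.functionFieldˣ, D' = D - principalDiv h := by
  obtain ⟨h, rfl⟩ := σ.exists_eq_scale τ
  exact ⟨h, hD'.unique (hD.scale fun x => rfl)⟩

/-! ### Tensor products of line bundles -/

theorem TensorPairing.hasDivisor (b : TensorPairing L M N) {τ : RatTriv L} {σ : RatTriv M}
    {ρ : RatTriv N} (hρ : ∀ (U : X.Opens) [Nonempty U] (s : Γ(L.sheaf, U)) (t : Γ(M.sheaf, U)),
      ρ.toRat U (b.pair U s t) = τ.toRat U s * σ.toRat U t) {D D' : Div X}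
    (hD : τ.HasDivisor D) (hD' : σ.HasDivisor D') : ρ.HasDivisor (D + D') := by
  obtain ⟨E, hE⟩ := ρ.exists_hasDivisor
  convert hE
  ext x
  obtain ⟨W, hxW, e, f, he, hf⟩ := exists_common_frames L M x.1
  have : Nonempty W := ⟨⟨_, hxW⟩⟩
  have h1 := hE.ord_frame (b.isFrame_pair _ _ he hf) x hxW
  rw [hρ, Scheme.ord_mul (τ.toRat_frame_ne_zero he) (σ.toRat_frame_ne_zero hf),
    hD.ord_frame he x hxW, hD'.ord_frame hf x hxW] at h1
  rw [Finsupp.add_apply]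
  lia

/-- The multiplication `𝒪(D) ⊗ 𝒪(D') → 𝒪(D + D')`. -/
theorem exists_tensorPairing {τ : RatTriv L} {σ : RatTriv M} {ρ : RatTriv N} {D D' : Div X}
    (hD : τ.HasDivisor D) (hD' : σ.HasDivisor D') (hE : ρ.HasDivisor (D + D')) :
    ∃ b : TensorPairing L M N, ∀ (U : X.Opens) [Nonempty U] (s : Γ(L.sheaf, U))
      (t : Γ(M.sheaf, U)), ρ.toRat U (b.pair U s t) = τ.toRat U s * σ.toRat U t := by
  have key (U : X.Opens) : ∃ f : Γ(L.sheaf, U) →ₗ[Γ(X, U)] Γ(M.sheaf, U) →ₗ[Γ(X, U)] Γ(N.sheaf, U),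
      ∀ [Nonempty U] (s : Γ(L.sheaf, U)) (t : Γ(M.sheaf, U)),
        ρ.toRat U (f s t) = τ.toRat U s * σ.toRat U t := by
    by_cases hU : Nonempty U
    · have (s : Γ(L.sheaf, U)) (t : Γ(M.sheaf, U)) :
          ∃ r, ρ.toRat U r = τ.toRat U s * σ.toRat U t := by
        refine (hE U _).2 ?_
        rcases (hD U _).1 ⟨s, rfl⟩ with hs | hs
        · exact Or.inl (by rw [hs, zero_mul])
        rcases (hD' U _).1 ⟨t, rfl⟩ with ht | ht
        · exact Or.inl (by rw [ht, mul_zero])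
        by_cases hs0 : τ.toRat U s = 0
        · exact Or.inl (by rw [hs0, zero_mul])
        by_cases ht0 : σ.toRat U t = 0
        · exact Or.inl (by rw [ht0, mul_zero])
        refine Or.inr fun x hxU => ?_
        rw [Scheme.ord_mul hs0 ht0, Finsupp.add_apply]
        have := hs x hxU
        have := ht x hxU
        lia
      choose r hr using this
      refine ⟨LinearMap.mk₂ Γ(X, U) r ?_ ?_ ?_ ?_, fun s t => hr s t⟩
      all_goals
        intros
        apply ρ.toRat_injective U
        simp only [hr, map_add, map_smul, Algebra.smul_def]
        ring
    · exact ⟨0, (hU ‹_›).elim⟩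
  choose f hf using key
  refine ⟨⟨f, fun {U V} h s t => ?_, fun {U} s t hs ht => ?_⟩, fun U _ s t => hf U s t⟩
  · by_cases hV : Nonempty V
    · have hU : Nonempty U := hV.map fun x => ⟨x.1, h x.2⟩
      apply ρ.toRat_injective V
      rw [hf, ρ.toRat_res, hf, τ.toRat_res, σ.toRat_res]
    · have := subsingleton_moduleSections N.sheaf V hV
      exact Subsingleton.elim _ _
  · by_cases hU : Nonempty U
    · have hs0 := τ.toRat_frame_ne_zero hs
      have ht0 := σ.toRat_frame_ne_zero ht
      refine hE.isFrame (by rw [hf]; exact mul_ne_zero hs0 ht0) fun x hxU => ?_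
      rw [hf, Scheme.ord_mul hs0 ht0, hD.ord_frame hs x hxU, hD'.ord_frame ht x hxU,
        Finsupp.add_apply]
      lia
    · intro V hVU
      have hV : ¬ Nonempty V := fun h => hU (h.map fun x => ⟨x.1, hVU x.2⟩)
      have := subsingleton_sections V hV
      have := subsingleton_moduleSections N.sheaf V hV
      exact ⟨fun _ _ _ => Subsingleton.elim _ _, fun s => ⟨0, Subsingleton.elim _ _⟩⟩

end RatTrivDivisor

/-! ### The form of a connection -/

section ConnectionForm

variable {X : Scheme.{0}} [X.Over SpecC] [IsIntegral X]

theorem preserves_genericPoint (w : Derivation ℂ X.functionField X.functionField) :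
    Preserves w (genericPoint X) := by
  intro f _
  obtain ⟨U, hU, s, hs⟩ := X.presheaf.exists_germ_eq (x := genericPoint X) (w f)
  have : Nonempty U := ⟨⟨_, hU⟩⟩
  rw [← hs]
  exact algebraMap_section_mem_localRing s hU

theorem HasConnectionForm.scale {E : FlatLineBundle X} {τ : RatTriv E.toLineBundle} {ω : RatDiff X}
    (h : HasConnectionForm E τ ω) (f : X.functionFieldˣ) :
    HasConnectionForm E (τ.scale f) (ω - dlog X (Additive.ofMul f)) := by
  intro U _ v w hv s
  have hf := f.ne_zero
  rw [τ.scale_toRat, τ.scale_toRat, h U v w hv, map_sub, lift_dlog, Derivation.leibniz, smul_eq_mul,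
    smul_eq_mul]
  field_simp
  ring

variable [SmoothOfRelativeDimension 1 (X ↘ SpecC)]

theorem exists_affine_extends (w : Derivation ℂ X.functionField X.functionField) (W : X.Opens)
    [Nonempty W] : ∃ (U : X.affineOpens) (_ : U.1 ≤ W) (_ : Nonempty U.1)
      (v : Derivation ℂ Γ(X, U.1) Γ(X, U.1)), Extends v w := by
  obtain ⟨U, -, h⟩ := (preserves_genericPoint w).exists_extends (genericPoint_mem W)
  exact ⟨U, h⟩

variable {E F G : FlatLineBundle X}

/-- The covariant derivative of a section along a vector field, as a rational function, depends
only on the rational function and the derivation of the function field that they define. -/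
theorem toRat_nabla_congr (τ : RatTriv E.toLineBundle) {U U' : X.affineOpens} [Nonempty U.1]
    [Nonempty U'.1] {v : Derivation ℂ Γ(X, U.1) Γ(X, U.1)}
    {v' : Derivation ℂ Γ(X, U'.1) Γ(X, U'.1)} {w : Derivation ℂ X.functionField X.functionField}
    (hv : Extends v w) (hv' : Extends v' w) {s : Γ(E.sheaf, U.1)} {s' : Γ(E.sheaf, U'.1)}
    (hs : τ.toRat U.1 s = τ.toRat U'.1 s') :
    τ.toRat U.1 (E.conn.nabla U v s) = τ.toRat U'.1 (E.conn.nabla U' v' s') := by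
  have := nonempty_inf U.1 U'.1
  obtain ⟨V, hVU, _, v'', hv''⟩ := exists_affine_extends w (U.1 ⊓ U'.1)
  have h1 : V.1 ≤ U.1 := hVU.trans inf_le_left
  have h2 : V.1 ≤ U'.1 := hVU.trans inf_le_right
  rw [← τ.toRat_res h1, ← τ.toRat_res h2,
    ← E.conn.nabla_res h1 v v'' (hv.res h1 hv''), ← E.conn.nabla_res h2 v' v'' (hv'.res h2 hv'')]
  congr 2
  apply τ.toRat_injective
  rw [τ.toRat_res, τ.toRat_res, hs]

/-- In a rational trivialization a connection is `d + ω` for some rational differential `ω`. -/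
theorem exists_hasConnectionForm (τ : RatTriv E.toLineBundle) :
    ∃ ω : RatDiff X, HasConnectionForm E τ ω := by
  obtain ⟨w₀, hw₀, hlift⟩ := exists_derivation_generator X
  obtain ⟨W, _, e₀, he₀⟩ := E.toLineBundle.exists_frame
  have hg := τ.toRat_frame_ne_zero he₀
  set g := τ.toRat W e₀
  obtain ⟨U₀, hU₀, _, v₀, hv₀⟩ := exists_affine_extends w₀ W
  obtain ⟨ω, hω⟩ := hlift.2 ((τ.toRat U₀.1
    (E.conn.nabla U₀ v₀ (restr E.sheaf hU₀ e₀)) - w₀ g) / g)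
  refine ⟨ω, fun U _ v w hv s => ?_⟩
  obtain ⟨c, rfl⟩ := hw₀ w
  -- Pass to an affine open set on which `w₀` and `c` are regular and `e₀` is a frame.
  obtain ⟨C, _, _, c', rfl⟩ := exists_section_of_mem_localRing (x := genericPoint X) (f := c) (by
    obtain ⟨A, hA, a, rfl⟩ := X.presheaf.exists_germ_eq (x := genericPoint X) c
    have : Nonempty A := ⟨⟨_, hA⟩⟩
    exact algebraMap_section_mem_localRing a hA)
  have := nonempty_inf U.1 W
  have := nonempty_inf (U.1 ⊓ W) C
  obtain ⟨V, hV, _, v', hv'⟩ := exists_affine_extends w₀ (U.1 ⊓ W ⊓ C)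
  have hVU : V.1 ≤ U.1 := fun x hx => (hV hx).1.1
  have hVW : V.1 ≤ W := fun x hx => (hV hx).1.2
  have hVC : V.1 ≤ C := fun x hx => (hV hx).2
  have hcv := hv'.smul (resFun hVC c')
  rw [algebraMap_resFun] at hcv
  obtain ⟨b, hb⟩ := he₀.exists_smul_eq hVW (restr E.sheaf hVU s)
  have hs : τ.toRat U.1 s = algebraMap _ X.functionField b * g := by
    rw [← τ.toRat_res hVU, ← hb, τ.toRat_smul, τ.toRat_res]
  have h0 : τ.toRat V.1 (E.conn.nabla V v' (restr E.sheaf hVW e₀)) =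
      w₀ g + w₀.liftKaehlerDifferential ω * g := by
    rw [hω, div_mul_cancel₀ _ hg, add_sub_cancel]
    exact toRat_nabla_congr τ hv' hv₀ (by rw [τ.toRat_res, τ.toRat_res])
  have h1 := toRat_nabla_congr τ hv hcv (s := s) (s' := b • restr E.sheaf hVW e₀) (by
    rw [hs, τ.toRat_smul, τ.toRat_res])
  rw [h1, (E.conn.nabla V).map_smul, AddMonoidHom.smul_apply, E.conn.leibniz, τ.toRat_smul,
    map_add, τ.toRat_smul, τ.toRat_smul, h0, τ.toRat_res, algebraMap_resFun, ← hv', hs, lift_smul,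
    Derivation.smul_apply, Derivation.leibniz, smul_eq_mul, smul_eq_mul, smul_eq_mul]
  ring

/-- To compare two forms it suffices to pair them with the derivations of the function field that
are vector fields on a small affine open set. -/
theorem ratDiff_ext_of_affine (W : X.Opens) [Nonempty W] {ω ω' : RatDiff X}
    (h : ∀ (U : X.affineOpens) [Nonempty U.1] (_ : U.1 ≤ W)
      (v : Derivation ℂ Γ(X, U.1) Γ(X, U.1)) (w : Derivation ℂ X.functionField X.functionField),
      Extends v w → w.liftKaehlerDifferential ω = w.liftKaehlerDifferential ω') : ω = ω' := by
  obtain ⟨w₀, -, hlift⟩ := exists_derivation_generator X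
  obtain ⟨U, hU, _, v, hv⟩ := exists_affine_extends w₀ W
  exact hlift.1 (h U hU v w₀ hv)

theorem HasConnectionForm.unique {τ : RatTriv E.toLineBundle} {ω ω' : RatDiff X}
    (h : HasConnectionForm E τ ω) (h' : HasConnectionForm E τ ω') : ω = ω' := by
  obtain ⟨W, _, e, he⟩ := E.toLineBundle.exists_frame
  refine ratDiff_ext_of_affine W fun U _ hU v w hv => ?_
  have h1 := (h U v w hv (restr E.sheaf hU e)).symm.trans (h' U v w hv _)
  rw [τ.toRat_res] at h1
  exact mul_right_cancel₀ (τ.toRat_frame_ne_zero he) (add_left_cancel h1)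

theorem HasConnectionForm.sub_mem_dlogRange {τ σ : RatTriv E.toLineBundle} {ω ω' : RatDiff X}
    (h : HasConnectionForm E τ ω) (h' : HasConnectionForm E σ ω') : ω' - ω ∈ dlogRange X := by
  obtain ⟨f, rfl⟩ := τ.exists_eq_scale σ
  have := h.unique (h'.scale f)
  exact ⟨Additive.ofMul f, by rw [this, sub_sub_cancel]⟩

/-- The local form of the relation between residues and divisors. -/
theorem isResidueAt_iff_add_dlog_mem {x : X} (hx : x ∈ closedPoints X) {ω : RatDiff X} {n : ℤ}
    {g : X.functionFieldˣ} (hg : Scheme.ord (g : X.functionField) x = -n) :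
    IsResidueAt X x ω n ↔ ω + dlog X (Additive.ofMul g) ∈ regularAt X x := by
  rw [← isResidueAt_zero_iff hx]
  have h1 := isResidueAt_dlog hx g
  rw [hg] at h1
  constructor
  · intro h
    simpa using h.add h1
  · intro h
    simpa using h.add h1.neg

/-- The form of a connection has simple poles, and its residues are the coefficients of the divisor
of the rational trivialization. -/
theorem HasConnectionForm.isResidueAt [QuasiCompact (X ↘ SpecC)] {τ : RatTriv E.toLineBundle}
    {ω : RatDiff X} (h : HasConnectionForm E τ ω) {D : Div X} (hD : τ.HasDivisor D)
    (x : closedPoints X) : IsResidueAt X x.1 ω (D x : ℤ) := by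
  obtain ⟨W, hxW, e, he⟩ := E.toLineBundle.isLineBundle x.1
  obtain ⟨z, hz⟩ := exists_parameter x.2
  obtain ⟨w, hwx, hw⟩ := exists_derivation_parameter x.2 hz
  obtain ⟨U, hxU, hUW, _, v, hv⟩ := hwx.exists_extends hxW
  replace he := he.restr hUW
  have hg := τ.toRat_frame_ne_zero he
  rw [isResidueAt_iff_add_dlog_mem x.2 (g := Units.mk0 _ hg) (hD.ord_frame he x hxU),
    mem_regularAt_iff x.2 hz hwx hw]
  obtain ⟨a, ha⟩ := he.exists_smul_eq le_rfl (E.conn.nabla U v (restr E.sheaf hUW e))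
  have h1 := congrArg (τ.toRat U.1) ha
  rw [restr_self, τ.toRat_smul, h U v w hv] at h1
  have h2 : w.liftKaehlerDifferential (ω + dlog X (Additive.ofMul (Units.mk0 _ hg))) =
      algebraMap _ X.functionField a := by
    rw [map_add, lift_dlog, Units.val_mk0]
    field_simp
    linear_combination -h1
  rw [h2]
  exact algebraMap_section_mem_localRing a hxU

end ConnectionForm

/-! ### The connection with a given form -/

section Construction

variable {X : Scheme.{0}} [X.Over SpecC] [IsIntegral X] [SmoothOfRelativeDimension 1 (X ↘ SpecC)]
  {L : LineBundle X}

/-- If the residues of `ω` are the coefficients of the divisor of `τ`, then `d + ω` preserves the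
image of `L` in the rational functions: writing `g` for a local equation, `d + ω` acts on `b g` as
`g (db + b (ω + dg / g))`, and `ω + dg / g` is regular. -/
theorem RatTriv.HasDivisor.add_lift_mul_mem_range [QuasiCompact (X ↘ SpecC)] {τ : RatTriv L}
    {D : Div X} (hD : τ.HasDivisor D) {ω : RatDiff X}
    (hω : ∀ x : closedPoints X, IsResidueAt X x.1 ω (D x : ℤ)) {U : X.Opens} [Nonempty U]
    {w : Derivation ℂ X.functionField X.functionField} (hw : ∀ x ∈ U, Preserves w x)
    (s : Γ(L.sheaf, U)) :
    w (τ.toRat U s) + w.liftKaehlerDifferential ω * τ.toRat U s ∈ Set.range (τ.toRat U) := by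
  have key (x : closedPoints X) (hxU : x.1 ∈ U) :
      w (τ.toRat U s) + w.liftKaehlerDifferential ω * τ.toRat U s = 0 ∨
      -D x ≤ Scheme.ord (w (τ.toRat U s) + w.liftKaehlerDifferential ω * τ.toRat U s) x.1 := by
    obtain ⟨V, hxV, g, hg, hgV⟩ := exists_local_equation D x.1
    have hgx := hgV x.1 hxV x.2
    rw [← hgx, le_ord_iff_div_mem x.2 hg]
    have hb : τ.toRat U s / g ∈ localRing X x.1 := by
      rw [← le_ord_iff_div_mem x.2 hg, hgx]
      exact ((hD U _).1 ⟨s, rfl⟩).imp_right fun h => h x hxU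
    have h1 := (hw x.1 hxU).lift_mem
      ((isResidueAt_iff_add_dlog_mem x.2 (g := Units.mk0 g hg) hgx).1 (hω x))
    rw [map_add, lift_dlog, Units.val_mk0] at h1
    convert add_mem (hw x.1 hxU _ hb) (mul_mem hb h1) using 1
    rw [Derivation.leibniz_div, smul_eq_mul, smul_eq_mul, smul_eq_mul]
    field_simp
    ring
  by_cases h0 : w (τ.toRat U s) + w.liftKaehlerDifferential ω * τ.toRat U s = 0
  · exact ⟨0, by rw [map_zero, h0]⟩
  · exact (hD U _).2 (Or.inr fun x hxU => (key x hxU).resolve_left h0)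

/-- The connection `d + ω`. -/
theorem exists_flatConnection [QuasiCompact (X ↘ SpecC)] {τ : RatTriv L} {D : Div X}
    (hD : τ.HasDivisor D) {ω : RatDiff X}
    (hω : ∀ x : closedPoints X, IsResidueAt X x.1 ω (D x : ℤ)) :
    ∃ F : FlatConnection L.sheaf, HasConnectionForm ⟨L, F⟩ τ ω := by
  have key (U : X.affineOpens) :
      ∃ N : Derivation ℂ Γ(X, U.1) Γ(X, U.1) →ₗ[Γ(X, U.1)] (Γ(L.sheaf, U.1) →+ Γ(L.sheaf, U.1)),
        ∀ [Nonempty U.1] (v : Derivation ℂ Γ(X, U.1) Γ(X, U.1))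
          (w : Derivation ℂ X.functionField X.functionField), Extends v w →
          ∀ s : Γ(L.sheaf, U.1), τ.toRat U.1 (N v s) =
            w (τ.toRat U.1 s) + w.liftKaehlerDifferential ω * τ.toRat U.1 s := by
    by_cases hU : Nonempty U.1
    · choose w hw using fun v : Derivation ℂ Γ(X, U.1) Γ(X, U.1) => exists_extends U.2 v
      choose N hN using fun (v : Derivation ℂ Γ(X, U.1) Γ(X, U.1)) (s : Γ(L.sheaf, U.1)) =>
        hD.add_lift_mul_mem_range hω (fun x hx => (hw v).preserves U.2 hx) s
      refine ⟨⟨⟨fun v => ⟨⟨N v, ?_⟩, fun s t => ?_⟩, fun v v' => ?_⟩, fun a v => ?_⟩, ?_⟩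
      · apply τ.toRat_injective U.1
        rw [hN]
        simp only [map_zero, mul_zero, add_zero]
      · apply τ.toRat_injective U.1
        simp only [hN, map_add]
        ring
      · ext s
        apply τ.toRat_injective U.1
        change τ.toRat U.1 (N (v + v') s) = τ.toRat U.1 (N v s + N v' s)
        rw [map_add, hN, hN, hN, (hw (v + v')).right_unique U.2 ((hw v).add (hw v')),
          Derivation.add_apply, lift_add]
        ring
      · ext s
        apply τ.toRat_injective U.1
        change τ.toRat U.1 (N (a • v) s) = τ.toRat U.1 (a • N v s)
        rw [τ.toRat_smul, hN, hN, (hw (a • v)).right_unique U.2 ((hw v).smul a),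
          Derivation.smul_apply, lift_smul, smul_eq_mul]
        ring
      · intro _ v w' hw' s
        change τ.toRat U.1 (N v s) = _
        rw [hN, (hw v).right_unique U.2 hw']
    · exact ⟨0, (hU ‹_›).elim⟩
  choose N hN using key
  refine ⟨⟨N, fun U v f s => ?_, fun U v v' s => ?_, fun {U V} h v v' hv s => ?_⟩,
    fun U _ => hN U⟩
  · by_cases hU : Nonempty U.1
    · obtain ⟨w, hw⟩ := exists_extends U.2 v
      apply τ.toRat_injective U.1
      rw [hN U v w hw, map_add, τ.toRat_smul, τ.toRat_smul, τ.toRat_smul, hN U v w hw, ← hw,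
        Derivation.leibniz, smul_eq_mul, smul_eq_mul]
      ring
    · have := subsingleton_moduleSections L.sheaf U.1 hU
      exact Subsingleton.elim _ _
  · by_cases hU : Nonempty U.1
    · obtain ⟨w, hw⟩ := exists_extends U.2 v
      obtain ⟨w', hw'⟩ := exists_extends U.2 v'
      apply τ.toRat_injective U.1
      rw [map_sub, hN U _ _ (hw.lie hw'), hN U v w hw, hN U v' w' hw', hN U v' w' hw', hN U v w hw,
        lift_lie, Derivation.commutator_apply, map_add, map_add, Derivation.leibniz,
        Derivation.leibniz, smul_eq_mul, smul_eq_mul, smul_eq_mul, smul_eq_mul]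
      ring
    · have := subsingleton_moduleSections L.sheaf U.1 hU
      exact Subsingleton.elim _ _
  · by_cases hV : Nonempty V.1
    · have hU : Nonempty U.1 := hV.map fun x => ⟨x.1, h x.2⟩
      obtain ⟨w, hw⟩ := exists_extends U.2 v
      obtain ⟨w', hw'⟩ := exists_extends V.2 v'
      obtain rfl := hw.of_res h U.2 hw' hv
      apply τ.toRat_injective V.1
      rw [hN V v' w hw', τ.toRat_res, τ.toRat_res, hN U v w hw]
    · have := subsingleton_moduleSections L.sheaf V.1 hV
      exact Subsingleton.elim _ _

end Construction

/-! ### Line bundles with connection and their forms -/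

section FlatLineBundles

variable {X : Scheme.{0}} [X.Over SpecC] [IsIntegral X] {E F G : FlatLineBundle X}

/-- In some rational trivialization the connection of `E` is `d + ω`. -/
def HasForm (E : FlatLineBundle X) (ω : RatDiff X) : Prop :=
  ∃ τ : RatTriv E.toLineBundle, HasConnectionForm E τ ω

theorem HasForm.of_equiv {ω : RatDiff X} (h : HasForm F ω) (hEF : E ≈ F) : HasForm E ω := by
  obtain ⟨σ, hσ⟩ := h
  obtain ⟨φ, hφ⟩ := hEF
  refine ⟨σ.ofIso φ, fun U _ v w hv s => ?_⟩
  rw [σ.ofIso_toRat, σ.ofIso_toRat, hφ, hσ U v w hv]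

theorem HasForm.of_sub_mem {ω ω' : RatDiff X} (h : HasForm E ω) (h' : ω - ω' ∈ dlogRange X) :
    HasForm E ω' := by
  obtain ⟨τ, hτ⟩ := h
  obtain ⟨f, hf⟩ := h'
  refine ⟨τ.scale f.toMul, ?_⟩
  have := hτ.scale f.toMul
  rwa [ofMul_toMul, hf, sub_sub_cancel] at this

variable [SmoothOfRelativeDimension 1 (X ↘ SpecC)]

theorem HasForm.sub_mem_dlogRange {ω ω' : RatDiff X} (h : HasForm E ω) (h' : HasForm E ω') :
    ω - ω' ∈ dlogRange X := by
  obtain ⟨τ, hτ⟩ := h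
  obtain ⟨σ, hσ⟩ := h'
  exact hσ.sub_mem_dlogRange hτ

variable [QuasiCompact (X ↘ SpecC)]

variable (E) in
theorem exists_hasForm : ∃ ω : thirdKindInt X, HasForm E ω := by
  obtain ⟨τ⟩ := exists_ratTriv_lineBundle E.toLineBundle
  obtain ⟨D, hD⟩ := τ.exists_hasDivisor
  obtain ⟨ω, hω⟩ := exists_hasConnectionForm τ
  exact ⟨⟨ω, mem_thirdKindInt_iff.2 fun x hx => ⟨_, hω.isResidueAt hD ⟨x, hx⟩⟩⟩, τ, hω⟩

theorem HasConnectionForm.hasDivisor {ω : thirdKindInt X} {τ : RatTriv E.toLineBundle}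
    (h : HasConnectionForm E τ ω) : τ.HasDivisor (residueDiv X ω) := by
  obtain ⟨D, hD⟩ := τ.exists_hasDivisor
  convert hD
  ext x
  exact residueDiv_eq_of_isResidueAt (h.isResidueAt hD x)

theorem exists_flatLineBundle (ω : thirdKindInt X) : ∃ E : FlatLineBundle X, HasForm E ω := by
  obtain ⟨F, hF⟩ := exists_flatConnection (hasDivisor_divTriv (residueDiv X ω))
    (isResidueAt_residueDiv ω)
  exact ⟨_, _, hF⟩

theorem HasForm.equiv {ω : thirdKindInt X} (h : HasForm E ω) (h' : HasForm F ω) : E ≈ F := by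
  obtain ⟨τ, hτ⟩ := h
  obtain ⟨σ, hσ⟩ := h'
  obtain ⟨φ, hφ⟩ := hτ.hasDivisor.exists_iso hσ.hasDivisor
  refine ⟨φ, fun U v s => ?_⟩
  by_cases hU : Nonempty U.1
  · obtain ⟨w, hw⟩ := exists_extends U.2 v
    apply σ.toRat_injective U.1
    rw [hφ, hτ U v w hw, hσ U v w hw, hφ]
  · have := subsingleton_moduleSections F.sheaf U.1 hU
    exact Subsingleton.elim _ _

/-- Tensoring line bundles with connection amounts to adding their forms. -/
theorem isFlatTensor_iff {ω ω' : thirdKindInt X} (hE : HasForm E ω) (hF : HasForm F ω') :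
    IsFlatTensor E F G ↔ HasForm G ((ω + ω' : thirdKindInt X) : RatDiff X) := by
  obtain ⟨τ, hτ⟩ := hE
  obtain ⟨σ, hσ⟩ := hF
  constructor
  · rintro ⟨b, hb⟩
    obtain ⟨ρ, hρ⟩ := b.exists_ratTriv τ σ
    obtain ⟨η, hη⟩ := exists_hasConnectionForm ρ
    refine ⟨ρ, ?_⟩
    convert hη
    obtain ⟨W, hW, e, f, he, hf⟩ :=
      exists_common_frames E.toLineBundle F.toLineBundle (genericPoint X)
    have : Nonempty W := ⟨⟨_, hW⟩⟩
    refine ratDiff_ext_of_affine W fun U _ hU v w hv => ?_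
    have he0 := τ.toRat_frame_ne_zero (he.restr hU)
    have hf0 := σ.toRat_frame_ne_zero (hf.restr hU)
    have h1 := congrArg (ρ.toRat U.1) (hb U v (restr E.sheaf hU e) (restr F.sheaf hU f))
    rw [map_add, hη U v w hv, hρ, hρ, hρ, hτ U v w hv, hσ U v w hv, Derivation.leibniz,
      smul_eq_mul, smul_eq_mul] at h1
    refine mul_right_cancel₀ (mul_ne_zero he0 hf0) ?_
    rw [AddSubgroup.coe_add, map_add]
    linear_combination -h1
  · rintro ⟨ρ, hρ⟩
    have hD := hρ.hasDivisor
    rw [map_add] at hD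
    obtain ⟨b, hb⟩ := exists_tensorPairing hτ.hasDivisor hσ.hasDivisor hD
    refine ⟨b, fun U v s t => ?_⟩
    by_cases hU : Nonempty U.1
    · obtain ⟨w, hw⟩ := exists_extends U.2 v
      apply ρ.toRat_injective U.1
      rw [map_add, hρ U v w hw, hb, hb, hb, hτ U v w hw, hσ U v w hw, Derivation.leibniz,
        AddSubgroup.coe_add, map_add, smul_eq_mul, smul_eq_mul]
      ring
    · have := subsingleton_moduleSections G.sheaf U.1 hU
      exact Subsingleton.elim _ _

theorem isTrivialWithForm_iff {η : RatDiff X} (hη : η ∈ regularDiff X) :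
    IsTrivialWithForm E η ↔ HasForm E η := by
  have : Nonempty (⊤ : X.Opens) := ⟨⟨genericPoint X, trivial⟩⟩
  constructor
  · rintro ⟨e, he, hc⟩
    obtain ⟨τ, hτ⟩ := exists_ratTriv he (one_ne_zero (α := X.functionField))
    obtain ⟨ω, hω⟩ := exists_hasConnectionForm τ
    refine ⟨τ, ?_⟩
    convert hω
    refine ratDiff_ext_of_affine ⊤ fun U _ hU v w hv => ?_
    obtain ⟨g, hg, h1⟩ := hc U v w hv
    have h2 := congrArg (τ.toRat U.1) h1
    rw [hω U v w hv, τ.toRat_smul, τ.toRat_res, hτ, Derivation.map_one_eq_zero, zero_add, mul_one,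
      mul_one, hg] at h2
    exact h2.symm
  · rintro ⟨τ, hτ⟩
    have hD := HasConnectionForm.hasDivisor (ω := ⟨η, regularDiff_le_thirdKindInt hη⟩) hτ
    rw [(residueDiv_eq_zero_iff ⟨η, _⟩).2 hη] at hD
    obtain ⟨e, he⟩ := (hD ⊤ 1).2 (Or.inr fun x _ => by rw [ord_one]; simp)
    have hfr : IsFrame E.sheaf e := hD.isFrame (by rw [he]; exact one_ne_zero) fun x _ => by
      rw [he, ord_one]
      simp
    refine ⟨e, hfr, fun U _ v w hv => ?_⟩
    obtain ⟨g, hg⟩ := hfr.exists_smul_eq le_top (E.conn.nabla U v (restr E.sheaf le_top e))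
    have h2 := congrArg (τ.toRat U.1) hg
    rw [hτ U v w hv, τ.toRat_smul, τ.toRat_res, he, Derivation.map_one_eq_zero, zero_add, mul_one,
      mul_one] at h2
    exact ⟨g, h2, hg.symm⟩

end FlatLineBundles

/-! ### The Picard groups as quotients -/

/-- A set that is identified with a quotient of an abelian group inherits the group structure. -/
theorem exists_addCommGroup_quotient {A : Type*} {B : Type*} [AddCommGroup A] (H : AddSubgroup A)
    {f : A → B} (hf : Function.Surjective f) (h : ∀ a b, f a = f b ↔ a - b ∈ H) :
    ∃ (_ : AddCommGroup B) (e : A ⧸ H ≃+ B), ∀ a, e (QuotientAddGroup.mk a) = f a := by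
  have h' (a b : A) : f a = f b ↔ (QuotientAddGroup.mk a : A ⧸ H) = QuotientAddGroup.mk b := by
    rw [QuotientAddGroup.eq_iff_sub_mem, h]
  let g : A ⧸ H → B := Quotient.lift f fun a b hab => (h' a b).2 (Quotient.sound hab)
  have hg : Function.Bijective g := by
    refine ⟨fun a b => ?_, fun b => ?_⟩
    · induction a using QuotientAddGroup.induction_on with | H a =>
      induction b using QuotientAddGroup.induction_on with | H b =>
      exact (h' a b).1
    · obtain ⟨a, rfl⟩ := hf b
      exact ⟨QuotientAddGroup.mk a, rfl⟩
  let e : A ⧸ H ≃ B := Equiv.ofBijective g hg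
  let _ := e.symm.addCommGroup
  exact ⟨inferInstance, e.symm.addEquiv.symm, fun a => rfl⟩

section Groups

variable {X : Scheme.{0}} [X.Over SpecC] [IsIntegral X] [SmoothOfRelativeDimension 1 (X ↘ SpecC)]
  [QuasiCompact (X ↘ SpecC)]

variable (X) in
/-- The group of principal divisors. -/
def principalDivs : AddSubgroup (Div X) where
  carrier := Set.range (principalDiv (X := X))
  zero_mem' := ⟨1, by ext x; exact ord_one⟩
  add_mem' := by
    rintro _ _ ⟨f, rfl⟩ ⟨g, rfl⟩
    exact ⟨f * g, by ext x; exact Scheme.ord_mul f.ne_zero g.ne_zero⟩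
  neg_mem' := by
    rintro _ ⟨f, rfl⟩
    refine ⟨f⁻¹, ?_⟩
    ext x
    rw [principalDiv_apply, Units.val_inv_eq_inv_val, ord_inv f.ne_zero]
    rfl

theorem divBundle_cls_eq_iff (D : Div X) (L : LineBundle X) :
    (divBundle D).cls = L.cls ↔ ∃ τ : RatTriv L, τ.HasDivisor D := by
  refine Quotient.eq.trans ⟨?_, ?_⟩
  · rintro ⟨φ⟩
    exact ⟨_, (hasDivisor_divTriv D).ofIso φ.symm⟩
  · rintro ⟨τ, hτ⟩
    obtain ⟨φ, -⟩ := (hasDivisor_divTriv D).exists_iso hτ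
    exact ⟨φ⟩

theorem divBundle_cls_eq_divBundle_cls_iff (D D' : Div X) :
    (divBundle D).cls = (divBundle D').cls ↔ D - D' ∈ principalDivs X := by
  rw [divBundle_cls_eq_iff]
  constructor
  · rintro ⟨τ, hτ⟩
    obtain ⟨h, hh⟩ := hτ.exists_eq_sub (hasDivisor_divTriv D')
    exact ⟨h, by rw [hh, sub_sub_cancel]⟩
  · rintro ⟨h, hh⟩
    refine ⟨(divTriv D').scale h⁻¹, (hasDivisor_divTriv D').scale fun x => ?_⟩
    rw [Units.val_inv_eq_inv_val, ord_inv h.ne_zero, ← principalDiv_apply h x, hh,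
      Finsupp.sub_apply]
    lia

theorem exists_divBundle_cls (L : LineBundle X) : ∃ D : Div X, (divBundle D).cls = L.cls := by
  obtain ⟨τ⟩ := exists_ratTriv_lineBundle L
  obtain ⟨D, hD⟩ := τ.exists_hasDivisor
  exact ⟨D, (divBundle_cls_eq_iff D L).2 ⟨τ, hD⟩⟩

theorem nonempty_tensorPairing_iff {L M N : LineBundle X} {D D' : Div X}
    (hL : (divBundle D).cls = L.cls) (hM : (divBundle D').cls = M.cls) :
    Nonempty (TensorPairing L M N) ↔ (divBundle (D + D')).cls = N.cls := by
  obtain ⟨τ, hτ⟩ := (divBundle_cls_eq_iff D L).1 hL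
  obtain ⟨σ, hσ⟩ := (divBundle_cls_eq_iff D' M).1 hM
  rw [divBundle_cls_eq_iff]
  constructor
  · rintro ⟨b⟩
    obtain ⟨ρ, hρ⟩ := b.exists_ratTriv τ σ
    exact ⟨ρ, b.hasDivisor hρ hτ hσ⟩
  · rintro ⟨ρ, hρ⟩
    obtain ⟨b, -⟩ := exists_tensorPairing hτ hσ hρ
    exact ⟨b⟩

variable (X) in
/-- The group `Pic X`, as the group of divisors modulo principal divisors. -/
theorem exists_pic_group : ∃ (_ : AddCommGroup (Pic X)) (cl : Div X →+ Pic X),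
    (∀ (D : Div X) (L : LineBundle X), cl D = L.cls ↔ ∃ τ : RatTriv L, τ.HasDivisor D) ∧
    (∀ L M N : LineBundle X, L.cls + M.cls = N.cls ↔ Nonempty (TensorPairing L M N)) ∧
    Function.Surjective cl ∧ ∀ D, cl D = 0 ↔ D ∈ principalDivs X := by
  have hsurj : Function.Surjective fun D : Div X => (divBundle D).cls := fun c => by
    obtain ⟨L, rfl⟩ := Quotient.exists_rep c
    exact exists_divBundle_cls L
  obtain ⟨inst, e, he⟩ := exists_addCommGroup_quotient (principalDivs X) hsurj
    divBundle_cls_eq_divBundle_cls_iff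
  let cl : Div X →+ Pic X := e.toAddMonoidHom.comp (QuotientAddGroup.mk' _)
  have hcl (D : Div X) : cl D = (divBundle D).cls := he D
  refine ⟨inst, cl, fun D L => ?_, fun L M N => ?_, fun c => ?_, fun D => ?_⟩
  · rw [hcl, divBundle_cls_eq_iff]
  · obtain ⟨D, hD⟩ := exists_divBundle_cls L
    obtain ⟨D', hD'⟩ := exists_divBundle_cls M
    rw [nonempty_tensorPairing_iff hD hD', ← hD, ← hD', ← hcl, ← hcl, ← hcl, map_add]
  · obtain ⟨D, rfl⟩ := hsurj c
    exact ⟨D, hcl D⟩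
  · change e (QuotientAddGroup.mk D) = 0 ↔ _
    rw [map_eq_zero_iff _ e.injective, QuotientAddGroup.eq_zero_iff]

variable (X) in
/-- The group of line bundles with flat connection, as the group of differentials of the third kind
with integral residues modulo logarithmic differentials. -/
theorem exists_picFlat_group : ∃ (_ : AddCommGroup (PicFlat X))
    (Φ : thirdKindInt X ⧸ (dlogRange X).addSubgroupOf (thirdKindInt X) ≃+ PicFlat X),
    (∀ (ω : thirdKindInt X) (E : FlatLineBundle X),
      Φ (QuotientAddGroup.mk ω) = E.cls ↔ HasForm E ω) ∧
    ∀ E F G : FlatLineBundle X, E.cls + F.cls = G.cls ↔ IsFlatTensor E F G := by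
  choose B hB using exists_flatLineBundle (X := X)
  have hcls (ω : thirdKindInt X) (E : FlatLineBundle X) : (B ω).cls = E.cls ↔ HasForm E ω :=
    Quotient.eq.trans ⟨fun h => (hB ω).of_equiv (Setoid.symm h), fun h => (hB ω).equiv h⟩
  have hsurj : Function.Surjective fun ω => (B ω).cls := fun c => by
    obtain ⟨E, rfl⟩ := Quotient.exists_rep c
    obtain ⟨ω, hω⟩ := exists_hasForm E
    exact ⟨ω, (hcls ω E).2 hω⟩
  obtain ⟨inst, Φ, hΦ⟩ := exists_addCommGroup_quotient
    ((dlogRange X).addSubgroupOf (thirdKindInt X)) hsurj fun ω ω' => by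
      rw [hcls, AddSubgroup.mem_addSubgroupOf, AddSubgroup.coe_sub]
      refine ⟨fun h => h.sub_mem_dlogRange (hB ω'), fun h => (hB ω').of_sub_mem ?_⟩
      rw [← neg_sub]
      exact neg_mem h
  have key (ω : thirdKindInt X) (E : FlatLineBundle X) :
      Φ (QuotientAddGroup.mk ω) = E.cls ↔ HasForm E ω := by rw [hΦ, hcls]
  refine ⟨inst, Φ, key, fun E F G => ?_⟩
  obtain ⟨ω, hω⟩ := exists_hasForm E
  obtain ⟨ω', hω'⟩ := exists_hasForm F
  rw [isFlatTensor_iff hω hω', ← key, ← (key ω E).2 hω, ← (key ω' F).2 hω', QuotientAddGroup.mk_add,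
    map_add]

theorem exists_unit_of_mem_dlogRange {η : RatDiff X} (hη : η ∈ regularDiff X)
    (h : η ∈ dlogRange X) : ∃ u : Γ(X, ⊤)ˣ, η = dlog X (Additive.ofMul
      (Units.map (X.presheaf.germ ⊤ (genericPoint X) trivial).hom.toMonoidHom u)) := by
  have : Nonempty (⊤ : X.Opens) := ⟨⟨genericPoint X, trivial⟩⟩
  obtain ⟨f, rfl⟩ := h
  have h1 := residueDiv_dlog (f := f.toMul) (ω := ⟨_, regularDiff_le_thirdKindInt hη⟩) rfl
  rw [(residueDiv_eq_zero_iff ⟨_, _⟩).2 hη] at h1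
  obtain ⟨u, hu⟩ := exists_section_unit (U := ⊤) f.toMul.ne_zero fun x _ hx => by
    rw [← principalDiv_apply f.toMul ⟨x, hx⟩, ← h1, Finsupp.zero_apply]
  refine ⟨u, congrArg _ (congrArg Additive.ofMul (Units.ext hu.symm : f.toMul = _))⟩

end Groups

end FlatPic
end

theorem proposition2p1 (X : Scheme.{0}) [X.Over FlatPic.SpecC] [AlgebraicGeometry.IsIntegral X]
    [IsSeparated (X ↘ FlatPic.SpecC)] [QuasiCompact (X ↘ FlatPic.SpecC)]
    [SmoothOfRelativeDimension 1 (X ↘ FlatPic.SpecC)] :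
    -- `Ω¹(X)` and `P = dlog K^×` are subgroups of `Ω₃^ℤ(X)`
    FlatPic.regularDiff X ≤ FlatPic.thirdKindInt X ∧
    FlatPic.dlogRange X ≤ FlatPic.thirdKindInt X ∧
    -- `Pic X` and `Pic^♭ X` are abelian groups under tensor product
    ∃ (_ : AddCommGroup (FlatPic.Pic X)) (_ : AddCommGroup (FlatPic.PicFlat X)),
      (∀ L M N : FlatPic.LineBundle X,
        L.cls + M.cls = N.cls ↔ Nonempty (FlatPic.TensorPairing L M N)) ∧
      (∀ E F G : FlatPic.FlatLineBundle X,
        E.cls + F.cls = G.cls ↔ FlatPic.IsFlatTensor E F G) ∧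
      -- the maps of the diagram, and the identification `Φ`
      ∃ (res : FlatPic.thirdKindInt X →+ FlatPic.Div X)
        (cl : FlatPic.Div X →+ FlatPic.Pic X)
        (ι : FlatPic.regularDiff X →+ FlatPic.PicFlat X)
        (p : FlatPic.PicFlat X →+ FlatPic.Pic X)
        (Φ : FlatPic.thirdKindInt X ⧸ (FlatPic.dlogRange X).addSubgroupOf (FlatPic.thirdKindInt X)
          ≃+ FlatPic.PicFlat X),
        -- what these maps are
        (∀ (ω : FlatPic.thirdKindInt X) (x : closedPoints X),
          FlatPic.IsResidueAt X x.1 ω (res ω x : ℤ)) ∧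
        (∀ (D : FlatPic.Div X) (L : FlatPic.LineBundle X),
          cl D = L.cls ↔ ∃ τ : FlatPic.RatTriv L, τ.HasDivisor D) ∧
        (∀ (η : FlatPic.regularDiff X) (E : FlatPic.FlatLineBundle X),
          ι η = E.cls ↔ FlatPic.IsTrivialWithForm E η) ∧
        (∀ E : FlatPic.FlatLineBundle X, p E.cls = E.toLineBundle.cls) ∧
        (∀ (ω : FlatPic.thirdKindInt X) (E : FlatPic.FlatLineBundle X),
          Φ (QuotientAddGroup.mk ω) = E.cls ↔
            ∃ τ : FlatPic.RatTriv E.toLineBundle, FlatPic.HasConnectionForm E τ ω) ∧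
        -- `res` carries `dlog f` to the divisor of `f`
        (∀ (f : X.functionFieldˣ) (ω : FlatPic.thirdKindInt X),
          (ω : FlatPic.RatDiff X) = FlatPic.dlog X (Additive.ofMul f) →
            ∀ x : closedPoints X, res ω x = Scheme.ord (f : X.functionField) x.1) ∧
        -- the two squares commute
        (∀ ω : FlatPic.thirdKindInt X, p (Φ (QuotientAddGroup.mk ω)) = cl (res ω)) ∧
        (∀ (η : FlatPic.regularDiff X) (ω : FlatPic.thirdKindInt X),
          (ω : FlatPic.RatDiff X) = η → Φ (QuotientAddGroup.mk ω) = ι η) ∧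
        -- exactness of the two rows
        (∀ ω : FlatPic.thirdKindInt X,
          res ω = 0 ↔ (ω : FlatPic.RatDiff X) ∈ FlatPic.regularDiff X) ∧
        p.ker = ι.range ∧
        (∀ η : FlatPic.regularDiff X, ι η = 0 ↔ ∃ u : Γ(X, ⊤)ˣ,
          (η : FlatPic.RatDiff X) =
            FlatPic.dlog X (Additive.ofMul
              (Units.map (X.presheaf.germ ⊤ (genericPoint X) trivial).hom.toMonoidHom u))) ∧
        (IsAffine X → Function.Surjective res ∧ Function.Surjective p) := by
  refine ⟨FlatPic.regularDiff_le_thirdKindInt, FlatPic.dlogRange_le_thirdKindInt, ?_⟩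
  obtain ⟨instPic, cl, hcl, hadd, hclsurj, hker⟩ := FlatPic.exists_pic_group X
  obtain ⟨instFlat, Φ, hΦ, hflat⟩ := FlatPic.exists_picFlat_group X
  let H := (FlatPic.dlogRange X).addSubgroupOf (FlatPic.thirdKindInt X)
  let q : FlatPic.thirdKindInt X →+ FlatPic.thirdKindInt X ⧸ H := QuotientAddGroup.mk' H
  let incl := AddSubgroup.inclusion (FlatPic.regularDiff_le_thirdKindInt (X := X))
  let ι : FlatPic.regularDiff X →+ FlatPic.PicFlat X := Φ.toAddMonoidHom.comp (q.comp incl)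
  have hι (η : FlatPic.regularDiff X) : ι η = Φ (QuotientAddGroup.mk (incl η)) := rfl
  -- `p` is induced by `cl ∘ res`, which kills the logarithmic differentials.
  have hH : H ≤ (cl.comp (FlatPic.residueDiv X)).ker := by
    rintro ω ⟨f, hf⟩
    exact (hker _).2 ⟨f.toMul, (FlatPic.residueDiv_dlog hf.symm).symm⟩
  let p : FlatPic.PicFlat X →+ FlatPic.Pic X :=
    (QuotientAddGroup.lift H _ hH).comp Φ.symm.toAddMonoidHom
  have hp (ω : FlatPic.thirdKindInt X) :
      p (Φ (QuotientAddGroup.mk ω)) = cl (FlatPic.residueDiv X ω) := by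
    change QuotientAddGroup.lift H _ hH (Φ.symm (Φ _)) = _
    rw [Φ.symm_apply_apply]
    rfl
  have hrep (a : FlatPic.PicFlat X) :
      ∃ ω : FlatPic.thirdKindInt X, Φ (QuotientAddGroup.mk ω) = a := by
    obtain ⟨b, rfl⟩ := Φ.surjective a
    obtain ⟨ω, rfl⟩ := QuotientAddGroup.mk_surjective b
    exact ⟨ω, rfl⟩
  refine ⟨instPic, instFlat, hadd, hflat, FlatPic.residueDiv X, cl, ι, p, Φ,
    FlatPic.isResidueAt_residueDiv, hcl, fun η E => ?_, fun E => ?_, hΦ, fun f ω h x => ?_, hp,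
    fun η ω h => ?_, FlatPic.residueDiv_eq_zero_iff, ?_, fun η => ?_, fun _ => ⟨?_, ?_⟩⟩
  · rw [hι, hΦ]
    exact (FlatPic.isTrivialWithForm_iff η.2).symm
  · obtain ⟨ω, hω⟩ := FlatPic.exists_hasForm E
    rw [← (hΦ ω E).2 hω, hp, hcl]
    obtain ⟨τ, hτ⟩ := hω
    exact ⟨τ, hτ.hasDivisor⟩
  · rw [FlatPic.residueDiv_dlog h, FlatPic.principalDiv_apply]
  · rw [hι]
    congr 2
    exact Subtype.ext h
  · ext a
    constructor
    · intro ha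
      obtain ⟨ω, rfl⟩ := hrep a
      obtain ⟨f, hf⟩ := (hker _).1 ((hp ω).symm.trans ha)
      -- Subtracting `dlog f` removes the residues of `ω` without changing its class.
      let δ : FlatPic.thirdKindInt X :=
        ⟨FlatPic.dlog X (Additive.ofMul f), FlatPic.dlogRange_le_thirdKindInt ⟨_, rfl⟩⟩
      have h0 : FlatPic.residueDiv X (ω - δ) = 0 := by
        rw [map_sub, ← hf, FlatPic.residueDiv_dlog (ω := δ) rfl, sub_self]
      refine ⟨⟨_, (FlatPic.residueDiv_eq_zero_iff _).1 h0⟩, ?_⟩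
      rw [hι]
      congr 1
      refine QuotientAddGroup.eq_iff_sub_mem.2 (AddSubgroup.mem_addSubgroupOf.2 ?_)
      refine ⟨-Additive.ofMul f, ?_⟩
      rw [map_neg]
      change _ = ((ω : FlatPic.RatDiff X) - FlatPic.dlog X (Additive.ofMul f)) - ω
      abel
    · rintro ⟨η, rfl⟩
      rw [AddMonoidHom.mem_ker, hι, hp, (FlatPic.residueDiv_eq_zero_iff (incl η)).2 η.2, map_zero]
  · rw [hι, map_eq_zero_iff _ Φ.injective, QuotientAddGroup.eq_zero_iff,
      AddSubgroup.mem_addSubgroupOf]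
    refine ⟨FlatPic.exists_unit_of_mem_dlogRange η.2, ?_⟩
    rintro ⟨u, hu⟩
    exact ⟨_, hu.symm⟩
  · exact FlatPic.residueDiv_surjective
  · intro c
    obtain ⟨D, rfl⟩ := hclsurj c
    obtain ⟨ω, rfl⟩ := FlatPic.residueDiv_surjective D
    exact ⟨_, hp ω⟩
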